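/- Let $\ell>0$, $m\in\mathbb R$, $\alpha\in[0,\pi)$, let $V:[0,\ell]\to\mathbb R$ be continuous, and let $\beta_1,\beta_2,\beta_1',\beta_2'\in\mathbb R$ with $\rho:=\beta_1'\beta_2-\beta_1\beta_2'>0$. Let $\mathcal H=L^2((0,\ell))\oplus\mathbb C$ with inner product $(\varphi,\chi)_{\mathcal H}=\int_0^\ell\overline{\varphi_1}\chi_1\,dz+\rho^{-1}\overline{\varphi_2}\chi_2$, and let $A$ be the operator in $\mathcal H$ $$A\varphi=\big([-\partial_z^2+m^2+V]\varphi_1,\ -[\beta_1\varphi_1(\ell)-\beta_2\partial_z\varphi_1(\ell)]\big)$$ whose domain $D(A)$ consists of the $\varphi=(\varphi_1,\varphi_2)\in\mathcal H$ such that $\varphi_1,\partial_z\varphi_1$ are absolutely continuous on $[0,\ell]$, $\partial_z^2\varphi_1\in L^2((0,\ell))$, $\cos\alpha\,\varphi_1(0)+\sin\alpha\,\partial_z\varphi_1(0)=0$ and $\varphi_2=\beta_1'\varphi_1(\ell)-\beta_2'\partial_z\varphi_1(\ell)$. Give $D(A)$ the graph norm $\|\varphi\|_{\mathcal H}+\|A\varphi\|_{\mathcal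 H}$. Assume that $m^2+V\ge 0$ on $[0,\ell]$, that $\beta_2'\ne0$, $\beta_2\neq 0$, that $\alpha=0$ or $\frac\pi2\le\alpha<\pi$, that $\beta_1\ge0,\ \beta_2<0,\ \beta_1'<0$ if $\beta_2'>0$, and that $\beta_1\le0,\ \beta_2>0,\ \beta_1'>0$ if $\beta_2'<0$. Put $E(t)=-\dfrac{\sin(t\sqrt A)}{\sqrt A}$ (functional calculus of the nonnegative self-adjoint operator $A$; the function $\lambda\mapsto\sin(t\sqrt\lambda)/\sqrt\lambda$ is given the value $t$ at $\lambda=0$), and $$(\mathsf E_{\rm ret}f)(t)=\int_t^\infty E(t-t')f(t')\,dt',\qquad(\mathsf E_{\rm adv}f)(t)=-\int_{-\infty}^tE(t-t')f(t')\,dt'$$ for continuous compactly supported $f:\mathbb R\to\mathcal H$. Let $Q_A=\partial_t^2+A$. For $O\subset\mathbb R\times[0,\ell]$ let $J_\pm(O)$ be the set of the $(t,z)\in\mathbb R\times[0,\ell]$ such that $|z-z'|\le\pm(t-t')$ for some $(t',z')\in O$. Then $\mathsf E_{\rm ret}$ is a retarded Green's operator and $\mathsf E_{\rm adv}$ is an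 advanced Green's operator. That is: (0) $\mathsf E_{\rm ret}$ and $\mathsf E_{\rm adv}$ map $C^2_0(\mathbb R,D(A))$ into $C^2(\mathbb R,D(A))$ and are integral operators with kernels $\Theta(t'-t)E(t-t')$ and $-\Theta(t-t')E(t-t')$, where $\Theta$ is the Heaviside function, $E(t)$ is a bounded operator on $\mathcal H$ that depends continuously on $t$ in operator norm, and $E\in C^2(\mathbb R,\mathcal B(D(A),\mathcal H))$; (i) $Q_A\mathsf E_{\rm ret}f=\mathsf E_{\rm ret}Q_Af=f$ and $Q_A\mathsf E_{\rm adv}f=\mathsf E_{\rm adv}Q_Af=f$ for all $f\in C_0^2(\mathbb R,D(A))$; (ii) $\operatorname{supp}(\mathsf E_{\rm ret}f)_1\subset J_-(\operatorname{supp}f_1)$ and $\operatorname{supp}(\mathsf E_{\rm adv}f)_1\subset J_+(\operatorname{supp}f_1)$ for all $f\in C_0^2(\mathbb R,D(A))$, with supports taken in $\mathbb R\times[0,\ell]$. -/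

import Mathlib

open MeasureTheory Set
open scoped ComplexConjugate ContDiff

noncomputable section

namespace DynBC

/-- The data of the bulk-boundary system on `ℝ × [0, ℓ]`: interval length, mass, boundary angle
at `z = 0`, boundary coefficients at `z = ℓ`, and the real continuous potential, together with the
standing assumptions on them. -/
structure System where
  ℓ : ℝ
  m : ℝ
  α : ℝ
  β₁ : ℝ
  β₂ : ℝ
  β₁' : ℝ
  β₂' : ℝ
  V : ℝ → ℝ
  ℓ_pos : 0 < ℓ
  α_mem : α ∈ Ico 0 Real.pi
  V_cont : ContinuousOn V (Icc 0 ℓ)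
  ρ_pos : 0 < β₁' * β₂ - β₁ * β₂'

/-- The determinant `ρ = β₁' β₂ - β₁ β₂'`. -/
def System.ρ (P : System) : ℝ := P.β₁' * P.β₂ - P.β₁ * P.β₂'

/-- The sufficient conditions for the positivity of `A` (besides `ρ > 0` and `α < π`, which are
part of `System`). -/
structure System.PositivityConditions (P : System) : Prop where
  potential_nonneg : ∀ x ∈ Icc 0 P.ℓ, 0 ≤ P.m ^ 2 + P.V x
  β₂'_ne_zero : P.β₂' ≠ 0
  angle : P.α = 0 ∨ Real.pi / 2 ≤ P.α
  of_pos : 0 < P.β₂' → 0 ≤ P.β₁ ∧ P.β₂ < 0 ∧ P.β₁' < 0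
  of_neg : P.β₂' < 0 → P.β₁ ≤ 0 ∧ 0 < P.β₂ ∧ 0 < P.β₁'

/-! ### The Hilbert space `L²((0, ℓ)) ⊕ ℂ` with the weight `ρ⁻¹` on the second summand -/

/-- Lebesgue measure on `(0, ℓ)`. -/
def System.μ (P : System) : Measure ℝ := volume.restrict (Ioo 0 P.ℓ)

/-- The bulk summand `L²((0, ℓ))`. -/
def L2 (P : System) : Type := Lp ℂ 2 P.μ

instance (P : System) : NormedAddCommGroup (L2 P) :=
  inferInstanceAs (NormedAddCommGroup (Lp ℂ 2 P.μ))
instance (P : System) : InnerProductSpace ℂ (L2 P) :=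
  inferInstanceAs (InnerProductSpace ℂ (Lp ℂ 2 P.μ))
instance (P : System) : CompleteSpace (L2 P) := inferInstanceAs (CompleteSpace (Lp ℂ 2 P.μ))

/-- The boundary summand: a copy of `ℂ` that carries the inner product `ρ⁻¹ * conj x * y`. -/
def Bdry (_P : System) : Type := ℂ

/-- The weighted inner product on the boundary summand. -/
@[reducible]
def bdryCore (P : System) : InnerProductSpace.Core ℂ ℂ where
  inner x y := (P.ρ⁻¹ : ℂ) * (conj x * y)
  conj_inner_symm x y := by
    simp only [map_mul, map_inv₀, Complex.conj_ofReal, Complex.conj_conj]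
    ring
  re_inner_nonneg x := by
    rw [← Complex.normSq_eq_conj_mul_self, ← Complex.ofReal_inv, ← Complex.ofReal_mul]
    exact mul_nonneg (inv_nonneg.2 P.ρ_pos.le) (Complex.normSq_nonneg _)
  add_left x y z := by
    rw [map_add]; ring
  smul_left x y r := by
    rw [smul_eq_mul, map_mul]; ring
  definite x hx := by
    have hρ : (P.ρ : ℂ) ≠ 0 := Complex.ofReal_ne_zero.2 P.ρ_pos.ne'
    simpa [hρ] using hx

instance (P : System) : NormedAddCommGroup (Bdry P) :=
  @InnerProductSpace.Core.toNormedAddCommGroup ℂ ℂ _ _ _ (bdryCore P)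
instance (P : System) : InnerProductSpace ℂ (Bdry P) :=
  @InnerProductSpace.ofCore ℂ ℂ _ _ _ (bdryCore P).toCore
instance (P : System) : FiniteDimensional ℂ (Bdry P) := inferInstanceAs (FiniteDimensional ℂ ℂ)
instance (P : System) : CompleteSpace (Bdry P) := FiniteDimensional.complete ℂ (Bdry P)

/-- The Hilbert space `H = L²((0, ℓ)) ⊕ ℂ`. -/
abbrev H (P : System) : Type := WithLp 2 (L2 P × Bdry P)

/-- The bulk component `φ₁` of `φ ∈ H`, as a function defined almost everywhere. -/
def comp₁ {P : System} (φ : H P) : ℝ → ℂ := ⇑(show Lp ℂ 2 P.μ from φ.fst)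

/-- The boundary component `φ₂` of `φ ∈ H`. -/
def comp₂ {P : System} (φ : H P) : ℂ := φ.snd

theorem comp₁_add {P : System} (φ χ : H P) : comp₁ (φ + χ) =ᵐ[P.μ] comp₁ φ + comp₁ χ :=
  Lp.coeFn_add (show Lp ℂ 2 P.μ from φ.fst) (show Lp ℂ 2 P.μ from χ.fst)

theorem comp₁_smul {P : System} (c : ℂ) (φ : H P) : comp₁ (c • φ) =ᵐ[P.μ] c • comp₁ φ :=
  Lp.coeFn_smul c (show Lp ℂ 2 P.μ from φ.fst)

theorem comp₂_add {P : System} (φ χ : H P) : comp₂ (φ + χ) = comp₂ φ + comp₂ χ := rfl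

theorem comp₂_smul {P : System} (c : ℂ) (φ : H P) : comp₂ (c • φ) = c * comp₂ φ := rfl

theorem ext_H {P : System} {φ χ : H P} (h1 : comp₁ φ =ᵐ[P.μ] comp₁ χ)
    (h2 : comp₂ φ = comp₂ χ) : φ = χ := by
  apply WithLp.ofLp_injective
  exact Prod.ext (Lp.ext h1) h2

/-- The inner product of `H` is `∫₀^ℓ conj φ₁ χ₁ dz + ρ⁻¹ conj φ₂ χ₂`. -/
theorem inner_H (P : System) (φ χ : H P) :
    inner ℂ φ χ = (∫ z in Ioo 0 P.ℓ, conj (comp₁ φ z) * comp₁ χ z)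
      + (P.ρ⁻¹ : ℂ) * (conj (comp₂ φ) * comp₂ χ) := by
  rw [WithLp.prod_inner_apply]
  congr 1
  change inner ℂ (show Lp ℂ 2 P.μ from φ.fst) (show Lp ℂ 2 P.μ from χ.fst) = _
  rw [MeasureTheory.L2.inner_def]
  refine integral_congr_ae (Filter.Eventually.of_forall fun z => ?_)
  exact mul_comm _ _

/-! ### The operator `A` -/

/-- `u` and `v = ∂_z u` are absolutely continuous on `[0, ℓ]`, `w = ∂_z² u` is in `L²((0, ℓ))`,
and `u` satisfies the boundary condition at `z = 0`. -/
structure IsProfile (P : System) (u v w : ℝ → ℂ) : Prop where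
  ac : AbsolutelyContinuousOnInterval u 0 P.ℓ
  ac' : AbsolutelyContinuousOnInterval v 0 P.ℓ
  deriv_eq : ∀ z ∈ Icc 0 P.ℓ, HasDerivWithinAt u (v z) (Icc 0 P.ℓ) z
  deriv_ae : ∀ᵐ z ∂P.μ, HasDerivAt v (w z) z
  memLp : MemLp w 2 P.μ
  bc : (Real.cos P.α : ℂ) * u 0 + (Real.sin P.α : ℂ) * v 0 = 0

/-- `u` is the bulk component of `φ ∈ D(A)`, with derivatives `v` and `w`. -/
structure Represents (P : System) (φ : H P) (u v w : ℝ → ℂ) : Prop extends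
    IsProfile P u v w where
  ae_eq : comp₁ φ =ᵐ[P.μ] u
  snd_eq : comp₂ φ = P.β₁' * u P.ℓ - P.β₂' * v P.ℓ

theorem Represents.add {P : System} {φ χ : H P} {u v w u' v' w' : ℝ → ℂ}
    (h : Represents P φ u v w) (h' : Represents P χ u' v' w') :
    Represents P (φ + χ) (u + u') (v + v') (w + w') where
  ac := h.ac.add h'.ac
  ac' := h.ac'.add h'.ac'
  deriv_eq z hz := (h.deriv_eq z hz).add (h'.deriv_eq z hz)
  deriv_ae := by
    filter_upwards [h.deriv_ae, h'.deriv_ae] with z h1 h2 using h1.add h2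
  memLp := h.memLp.add h'.memLp
  bc := by
    have h1 := h.bc
    have h2 := h'.bc
    simp only [Pi.add_apply]
    linear_combination h1 + h2
  ae_eq := by
    filter_upwards [comp₁_add φ χ, h.ae_eq, h'.ae_eq] with z h1 h2 h3
    rw [h1, Pi.add_apply, Pi.add_apply, h2, h3]
  snd_eq := by
    have h1 := h.snd_eq
    have h2 := h'.snd_eq
    rw [comp₂_add, h1, h2]
    simp only [Pi.add_apply]
    ring

theorem Represents.smul {P : System} {φ : H P} {u v w : ℝ → ℂ} (c : ℂ)
    (h : Represents P φ u v w) :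
    Represents P (c • φ) (c • u) (c • v) (c • w) where
  ac := h.ac.const_smul c
  ac' := h.ac'.const_smul c
  deriv_eq z hz := (h.deriv_eq z hz).const_smul c
  deriv_ae := by
    filter_upwards [h.deriv_ae] with z h1 using h1.const_smul c
  memLp := h.memLp.const_smul c
  bc := by
    have h1 := h.bc
    simp only [Pi.smul_apply, smul_eq_mul]
    linear_combination c * h1
  ae_eq := by
    filter_upwards [comp₁_smul c φ, h.ae_eq] with z h1 h2
    rw [h1, Pi.smul_apply, Pi.smul_apply, h2]
  snd_eq := by
    have h1 := h.snd_eq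
    rw [comp₂_smul, h1]
    simp only [Pi.smul_apply, smul_eq_mul]
    ring

theorem represents_zero (P : System) : Represents P 0 0 0 0 where
  ac := by simpa [AbsolutelyContinuousOnInterval] using tendsto_const_nhds
  ac' := by simpa [AbsolutelyContinuousOnInterval] using tendsto_const_nhds
  deriv_eq z _ := hasDerivWithinAt_const z _ (0 : ℂ)
  deriv_ae := Filter.Eventually.of_forall fun z => hasDerivAt_const z (0 : ℂ)
  memLp := MemLp.zero
  bc := by simp
  ae_eq := Lp.coeFn_zero ℂ 2 P.μ
  snd_eq := by
    change (0 : ℂ) = _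
    simp

/-- The representing functions are unique. -/
theorem Represents.unique {P : System} {φ : H P} {u v w u' v' w' : ℝ → ℂ}
    (h : Represents P φ u v w) (h' : Represents P φ u' v' w') :
    EqOn u u' (Icc 0 P.ℓ) ∧ EqOn v v' (Icc 0 P.ℓ) ∧ w =ᵐ[P.μ] w' := by
  have hu : EqOn u u' (Icc 0 P.ℓ) := by
    have hae : u =ᵐ[volume.restrict (Icc 0 P.ℓ)] u' := by
      rw [← Measure.restrict_congr_set Ioo_ae_eq_Icc]
      exact h.ae_eq.symm.trans h'.ae_eq
    refine Measure.eqOn_Icc_of_ae_eq volume P.ℓ_pos.ne hae ?_ ?_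
    · exact fun z hz => (h.deriv_eq z hz).continuousWithinAt
    · exact fun z hz => (h'.deriv_eq z hz).continuousWithinAt
  have hv : EqOn v v' (Icc 0 P.ℓ) := fun z hz =>
    (uniqueDiffOn_Icc P.ℓ_pos z hz).eq_deriv _ (h.deriv_eq z hz)
      ((h'.deriv_eq z hz).congr hu (hu hz))
  refine ⟨hu, hv, ?_⟩
  filter_upwards [h.deriv_ae, h'.deriv_ae, ae_restrict_mem (μ := volume) measurableSet_Ioo]
    with z h1 h2 hz
  refine h1.unique (h2.congr_of_eventuallyEq ?_)
  filter_upwards [Icc_mem_nhds hz.1 hz.2] with y hy using hv hy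

/-- The domain `D(A)` as a subspace of `H`. -/
def domainA (P : System) : Submodule ℂ (H P) where
  carrier := {φ | ∃ u v w, Represents P φ u v w}
  add_mem' := by
    rintro _ _ ⟨u, v, w, h⟩ ⟨u', v', w', h'⟩
    exact ⟨_, _, _, h.add h'⟩
  zero_mem' := ⟨0, 0, 0, represents_zero P⟩
  smul_mem' := by
    rintro c _ ⟨u, v, w, h⟩
    exact ⟨_, _, _, h.smul c⟩

variable {P : System}

/-- The continuous representative on `[0, ℓ]` of the bulk component `φ₁`, for `φ ∈ D(A)`. -/
def bulk (φ : domainA P) : ℝ → ℂ := φ.2.choose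

/-- Its first derivative `∂_z φ₁`. -/
def bulk' (φ : domainA P) : ℝ → ℂ := φ.2.choose_spec.choose

/-- Its second derivative `∂_z² φ₁` (almost everywhere). -/
def bulk'' (φ : domainA P) : ℝ → ℂ := φ.2.choose_spec.choose_spec.choose

theorem represents_bulk (φ : domainA P) :
    Represents P (φ : H P) (bulk φ) (bulk' φ) (bulk'' φ) :=
  φ.2.choose_spec.choose_spec.choose_spec

/-- `[-∂_z² + m² + V] φ₁`. -/
def bulkA (φ : domainA P) (z : ℝ) : ℂ :=
  -bulk'' φ z + ((P.m ^ 2 + P.V z : ℝ) : ℂ) * bulk φ z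

theorem memLp_bulkA (φ : domainA P) : MemLp (bulkA φ) 2 P.μ := by
  have h := represents_bulk φ
  refine h.memLp.neg.add ?_
  have hc : ContinuousOn (fun z => ((P.m ^ 2 + P.V z : ℝ) : ℂ) * bulk φ z) (Icc 0 P.ℓ) := by
    refine ContinuousOn.mul ?_ fun z hz => (h.deriv_eq z hz).continuousWithinAt
    exact Complex.continuous_ofReal.comp_continuousOn (continuousOn_const.add P.V_cont)
  obtain ⟨C, hC⟩ := isCompact_Icc.exists_bound_of_continuousOn hc
  have : IsFiniteMeasure P.μ := by
    unfold System.μ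
    infer_instance
  refine MemLp.of_bound ?_ C ?_
  · exact (hc.mono Ioo_subset_Icc_self).aestronglyMeasurable measurableSet_Ioo
  · filter_upwards [ae_restrict_mem (μ := volume) measurableSet_Ioo] with z hz
    exact hC z (Ioo_subset_Icc_self hz)

/-- The vector `A φ`. -/
def applyA (φ : domainA P) : H P :=
  WithLp.toLp 2 ((memLp_bulkA φ).toLp (bulkA φ),
    ((-(P.β₁ * bulk φ P.ℓ - P.β₂ * bulk' φ P.ℓ) : ℂ) : Bdry P))

theorem applyA_eq {φ : domainA P} {u v w : ℝ → ℂ} (h : Represents P (φ : H P) u v w) :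
    (comp₁ (applyA φ) =ᵐ[P.μ] fun z => -w z + ((P.m ^ 2 + P.V z : ℝ) : ℂ) * u z) ∧
    comp₂ (applyA φ) = -(P.β₁ * u P.ℓ - P.β₂ * v P.ℓ) := by
  obtain ⟨hu, hv, hw⟩ := (represents_bulk φ).unique h
  have hℓ : P.ℓ ∈ Icc 0 P.ℓ := right_mem_Icc.2 P.ℓ_pos.le
  constructor
  · change ((memLp_bulkA φ).toLp (bulkA φ) : ℝ → ℂ) =ᵐ[P.μ] _
    filter_upwards [(memLp_bulkA φ).coeFn_toLp, hw,
      ae_restrict_mem (μ := volume) measurableSet_Ioo] with z h1 h2 h3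
    rw [h1, bulkA, h2, hu (Ioo_subset_Icc_self h3)]
  · change -(P.β₁ * bulk φ P.ℓ - P.β₂ * bulk' φ P.ℓ) = _
    rw [hu hℓ, hv hℓ]

variable (P) in
/-- The operator `A` in `H` with domain `D(A)`. -/
def opA : H P →ₗ.[ℂ] H P where
  domain := domainA P
  toFun :=
    { toFun := applyA
      map_add' := fun φ χ => by
        obtain ⟨h1, h2⟩ := applyA_eq (φ := φ + χ) ((represents_bulk φ).add (represents_bulk χ))
        obtain ⟨h3, h4⟩ := applyA_eq (represents_bulk φ)
        obtain ⟨h5, h6⟩ := applyA_eq (represents_bulk χ)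
        apply ext_H
        · filter_upwards [h1, h3, h5, comp₁_add (applyA φ) (applyA χ)]
            with z e1 e3 e5 e
          rw [e, Pi.add_apply, e1, e3, e5]
          simp only [Pi.add_apply]
          ring
        · rw [comp₂_add, h2, h4, h6]
          simp only [Pi.add_apply]
          ring
      map_smul' := fun c φ => by
        obtain ⟨h1, h2⟩ := applyA_eq (φ := c • φ) ((represents_bulk φ).smul c)
        obtain ⟨h3, h4⟩ := applyA_eq (represents_bulk φ)
        apply ext_H
        · filter_upwards [h1, h3, comp₁_smul c (applyA φ)] with z e1 e3 e
          rw [RingHom.id_apply, e, Pi.smul_apply, e1, e3]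
          simp only [Pi.smul_apply, smul_eq_mul]
          ring
        · rw [RingHom.id_apply, comp₂_smul, h2, h4]
          simp only [Pi.smul_apply, smul_eq_mul]
          ring }

/-! ### `D(A)` with the graph norm -/

variable (P) in
/-- The domain of `A`, as a space in its own right, to be endowed with the graph norm. -/
def DA : Type := (opA P).domain

instance : AddCommGroup (DA P) := inferInstanceAs (AddCommGroup (opA P).domain)
instance : Module ℂ (DA P) := inferInstanceAs (Module ℂ (opA P).domain)

variable (P) in
/-- The inclusion of `D(A)` in `H`. -/
def inclLin : DA P →ₗ[ℂ] H P := (opA P).domain.subtype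

variable (P) in
/-- The operator `A` as a map `D(A) → H`. -/
def mapA : DA P →ₗ[ℂ] H P := (opA P).toFun

variable (P) in
/-- The graph map `φ ↦ (φ, A φ)`. -/
def graphMap : DA P →ₗ[ℂ] WithLp 1 (H P × H P) :=
  (WithLp.linearEquiv 1 ℂ (H P × H P)).symm.toLinearMap ∘ₗ (inclLin P).prod (mapA P)

theorem graphMap_injective : Function.Injective (graphMap P) := fun _ _ h =>
  Subtype.ext (congrArg (fun x : WithLp 1 (H P × H P) => x.fst) h)

instance : NormedAddCommGroup (DA P) :=
  NormedAddCommGroup.induced (DA P) (WithLp 1 (H P × H P)) (graphMap P) graphMap_injective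

instance : NormedSpace ℂ (DA P) :=
  NormedSpace.induced ℂ (DA P) (WithLp 1 (H P × H P)) (graphMap P)

/-- The norm of `D(A)` is the graph norm `‖φ‖ + ‖A φ‖`. -/
theorem norm_DA (φ : DA P) : ‖φ‖ = ‖inclLin P φ‖ + ‖mapA P φ‖ := by
  change ‖graphMap P φ‖ = _
  rw [WithLp.prod_norm_eq_of_L1]
  rfl

variable (P) in
/-- The inclusion `D(A) → H` as a bounded operator. -/
def incl : DA P →L[ℂ] H P :=
  (inclLin P).mkContinuous 1 fun φ => by
    rw [norm_DA, one_mul]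
    exact le_add_of_nonneg_right (norm_nonneg _)

/-! ### Functional calculus and the kernel `E(t) = - A^{-1/2} sin(t A^{1/2})` -/

section FunctionalCalculus

variable {K : Type*} [NormedAddCommGroup K] [InnerProductSpace ℂ K] [CompleteSpace K]

/-- `R = (1 + T)⁻¹`: `R` is a bounded operator with values in the domain of `T` that inverts
`1 + T` from both sides. -/
structure IsShiftInverse (T : K →ₗ.[ℂ] K) (R : K →L[ℂ] K) : Prop where
  mem : ∀ ψ, R ψ ∈ T.domain
  right_inv : ∀ ψ, R ψ + T ⟨R ψ, mem ψ⟩ = ψ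
  left_inv : ∀ φ : T.domain, R ((φ : K) + T φ) = φ

open Classical in
/-- The bounded operator `(1 + T)⁻¹` (zero if `1 + T` is not boundedly invertible). -/
def shiftInverse (T : K →ₗ.[ℂ] K) : K →L[ℂ] K :=
  if h : ∃ R, IsShiftInverse T R then h.choose else 0

/-- The functional calculus `g(T)` of a nonnegative self-adjoint operator `T`, for continuous
`g : [0, ∞) → ℝ` that tends to `0` at infinity. With `R = (1 + T)⁻¹`, whose spectrum lies in
`[0, 1]`, one has `T = R⁻¹ - 1`, so that `g(T)` is the function `r ↦ g(1 / r - 1)` of the bounded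
self-adjoint operator `R`, extended by continuity by the value `0` at `r = 0`. -/
def funCalc (T : K →ₗ.[ℂ] K) (g : ℝ → ℝ) : K →L[ℂ] K :=
  cfc (fun r : ℝ => if r = 0 then 0 else g (1 / r - 1)) (shiftInverse T)

end FunctionalCalculus

/-- The function `x ↦ sin(t √x) / √x` on `[0, ∞)`, with the value `t` at `x = 0`. -/
def sinDiv (t x : ℝ) : ℝ := if x = 0 then t else Real.sin (t * √x) / √x

variable (P) in
/-- `E(t) = - sin(t √A) / √A`. -/
def kernelE (t : ℝ) : H P →L[ℂ] H P := -funCalc (opA P) (sinDiv t)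

variable (P) in
/-- `(E_ret f)(t) = ∫_t^∞ E(t - t') f(t') dt'`. -/
def opRet (f : ℝ → H P) (t : ℝ) : H P := ∫ t' in Ioi t, kernelE P (t - t') (f t')

variable (P) in
/-- `(E_adv f)(t) = - ∫_{-∞}^t E(t - t') f(t') dt'`. -/
def opAdv (f : ℝ → H P) (t : ℝ) : H P := -∫ t' in Iio t, kernelE P (t - t') (f t')

/-! ### Klein-Gordon operator, causal structure, Green's operators -/

/-- The Klein-Gordon operator `Q_A f = ∂_t² f + A f`, for `f : ℝ → D(A)`. -/
def QA (f : ℝ → DA P) (t : ℝ) : H P :=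
  iteratedDeriv 2 (fun s => incl P (f s)) t + mapA P (f t)

variable (P) in
/-- The spacetime `ℝ × [0, ℓ]`. -/
abbrev Spacetime : Type := ℝ × Icc (0 : ℝ) P.ℓ

/-- The causal future of `O` in `ℝ × [0, ℓ]` with the metric `-dt² + dz²`. -/
def Jplus (O : Set (Spacetime P)) : Set (Spacetime P) :=
  {q | ∃ p ∈ O, |(q.2 : ℝ) - p.2| ≤ q.1 - p.1}

/-- The causal past of `O`. -/
def Jminus (O : Set (Spacetime P)) : Set (Spacetime P) :=
  {q | ∃ p ∈ O, |(q.2 : ℝ) - p.2| ≤ p.1 - q.1}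

/-- The support in `ℝ × [0, ℓ]` of the bulk component `f₁`, for `f : ℝ → D(A)`. -/
def supp₁ (f : ℝ → DA P) : Set (Spacetime P) :=
  closure {p | bulk (f p.1) (p.2 : ℝ) ≠ 0}

/-- `G` is the integral operator with kernel `θ(t - t') E(t - t')`, and it maps `C²₀(ℝ, D(A))`
into `C²(ℝ, D(A))`. Here `θ` is a scalar factor, `E` is a norm continuous family of bounded
operators on `H`, and `E` is twice continuously differentiable as a family of bounded operators
from `D(A)` to `H`. -/
structure IsIntegralOperator (G : (ℝ → H P) → ℝ → H P) (θ : ℝ → ℝ)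
    (E : ℝ → H P →L[ℂ] H P) : Prop where
  continuous : Continuous E
  contDiff : ContDiff ℝ 2 (fun t => (E t).comp (incl P))
  integrable : ∀ f : ℝ → H P, Continuous f → HasCompactSupport f → ∀ t,
    Integrable fun t' => θ (t - t') • E (t - t') (f t')
  eq_integral : ∀ f : ℝ → H P, Continuous f → HasCompactSupport f → ∀ t,
    G f t = ∫ t', θ (t - t') • E (t - t') (f t')
  maps : ∀ f : ℝ → DA P, ContDiff ℝ 2 f → HasCompactSupport f →
    ∃ g : ℝ → DA P, ContDiff ℝ 2 g ∧ ∀ t, incl P (g t) = G (fun s => incl P (f s)) t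

/-- `G` inverts `Q_A` from both sides, `Q_A G f = G Q_A f = f`, and `supp (G f)₁ ⊆ J (supp f₁)`,
for every `f` in `C²₀(ℝ, D(A))`. -/
structure IsGreen (G : (ℝ → H P) → ℝ → H P) (J : Set (Spacetime P) → Set (Spacetime P)) :
    Prop where
  right_inv : ∀ f g : ℝ → DA P, ContDiff ℝ 2 f → HasCompactSupport f → ContDiff ℝ 2 g →
    (∀ t, incl P (g t) = G (fun s => incl P (f s)) t) → ∀ t, QA g t = incl P (f t)
  left_inv : ∀ f : ℝ → DA P, ContDiff ℝ 2 f → HasCompactSupport f →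
    ∀ t, G (QA f) t = incl P (f t)
  supp_subset : ∀ f g : ℝ → DA P, ContDiff ℝ 2 f → HasCompactSupport f → ContDiff ℝ 2 g →
    (∀ t, incl P (g t) = G (fun s => incl P (f s)) t) → supp₁ g ⊆ J (supp₁ f)

/-- Retarded Green's operators: kernel `Θ(t' - t) E(t - t')`, supports in the causal past. -/
def IsRetardedGreen (G : (ℝ → H P) → ℝ → H P) : Prop :=
  (∃ E, IsIntegralOperator G ((Iio 0).indicator 1) E) ∧ IsGreen G Jminus

/-- Advanced Green's operators: kernel `-Θ(t - t') E(t - t')`, supports in the causal future. -/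
def IsAdvancedGreen (G : (ℝ → H P) → ℝ → H P) : Prop :=
  (∃ E, IsIntegralOperator G (-(Ioi 0).indicator 1) E) ∧ IsGreen G Jplus

end DynBC

end

open MeasureTheory Set
open scoped ComplexConjugate ContDiff

noncomputable section

namespace DynBC

/-! ### Functional calculus of a nonnegative symmetric operator through `(1 + T)⁻¹` -/

section ShiftInverse

variable {K : Type*} [NormedAddCommGroup K] [InnerProductSpace ℂ K] [CompleteSpace K]
  {T : K →ₗ.[ℂ] K} {R : K →L[ℂ] K}

/-! Everything is expressed through the single bounded operator `R = (1 + A)⁻¹`. Integration by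
parts gives a symmetric form for `A`. The weight `ρ⁻¹` on the boundary summand makes its part at `z
= ℓ` Hermitian, and the sign conditions make it nonnegative by completing a square
(`endForm_self_nonneg`); the angle condition does the same at `z = 0` (`bc_nonneg`). Surjectivity of
`1 + A` comes from solving `-u'' + k² u = g` explicitly, correcting the boundary component by a
homogeneous solution (`freeShift_surjective`), and restoring the potential by a Neumann series
(`one_add_opA_surjective`). Hence `R` exists, is self-adjoint, and has spectrum in `[0, 1]`.

Write `S(t) = sin(t√A)/√A` and `C(t) = cos(t√A) R`, both continuous functions of `R`. Taylor bounds
uniform on the spectrum give, in operator norm, `(S R)' = C` and `C' = S R - S`. With `F = (1 + A)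
f` one has `f = R F` and `Q_A f = R F'' + F - R F`, where only bounded operators occur. The
integrand `S(τ) (R w'' + w - R w)` is the derivative of `S R w' - C w`, whose value at `0` is `-R
w(0)` (`isGreenKernel_aux`). This one identity yields both inversion formulas, because the Green's
operators are convolutions and their kernels commute with `R`.

For the supports, the energy of a solution is weighted by `w(z) = exp(-2s √((z - z₀)² + ε²))`, which
satisfies `|w'| ≤ 2 s w`; the boundary component is weighted by `w(ℓ)`. The weighted energy grows at
rate at most `2s + 2` apart from the source (`localEnergy_deriv_le`), so growth at rate `2s` in time
matches decay at rate `2s` in space: propagation speed one. If `(t₀, z₀)` has distance `δ > 0` from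
the cone condition, Grönwall bounds the weighted solution at time `t₀` by a constant times
`exp(-2sδ)` (`re_inner_expWeight_solution_le`), whereas near `z₀` the weight is at least `exp(-sδ)`
for `ε = δ/4`. Letting `s → ∞` forces the solution to vanish near `z₀`
(`bulk_eq_zero_of_notMem_Jplus`). The retarded case follows by time reversal. -/

omit [CompleteSpace K] in
theorem isShiftInverse_shiftInverse (h : ∃ R, IsShiftInverse T R) :
    IsShiftInverse T (shiftInverse T) := by
  rw [shiftInverse, dif_pos h]
  exact h.choose_spec

-- Pair `(1 + T) (R ψ) = ψ` with `R ψ` and drop the nonnegative form of `T`. Both `‖R‖ ≤ 1` and `R ≥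
-- 0` follow from this inequality.
omit [CompleteSpace K] in
theorem IsShiftInverse.norm_sq_le (h : IsShiftInverse T R)
    (hpos : ∀ φ : T.domain, 0 ≤ (inner ℂ (φ : K) (T φ)).re) (ψ : K) :
    ‖R ψ‖ ^ 2 ≤ (inner ℂ (R ψ) ψ).re := by
  conv_rhs => rw [← h.right_inv ψ]
  have h1 := hpos ⟨R ψ, h.mem ψ⟩
  have h2 : (inner ℂ (R ψ) (R ψ)).re = ‖R ψ‖ ^ 2 := inner_self_eq_norm_sq (𝕜 := ℂ) (R ψ)
  rw [h.right_inv]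
  have h3 := congrArg (fun x => (inner ℂ (R ψ) x).re) (h.right_inv ψ)
  simp only [inner_add_right, Complex.add_re] at h3
  simp only at h1
  linarith

omit [CompleteSpace K] in
theorem IsShiftInverse.norm_le_one (h : IsShiftInverse T R)
    (hpos : ∀ φ : T.domain, 0 ≤ (inner ℂ (φ : K) (T φ)).re) : ‖R‖ ≤ 1 := by
  refine R.opNorm_le_bound zero_le_one fun ψ => ?_
  have h1 := h.norm_sq_le hpos ψ
  have h2 : (inner ℂ (R ψ) ψ).re ≤ ‖R ψ‖ * ‖ψ‖ := re_inner_le_norm (𝕜 := ℂ) _ _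
  rcases (norm_nonneg (R ψ)).eq_or_lt with h0 | h0
  · rw [← h0]; positivity
  · nlinarith

theorem IsShiftInverse.isSelfAdjoint (h : IsShiftInverse T R)
    (hsym : ∀ φ χ : T.domain, inner ℂ (T φ) (χ : K) = inner ℂ (φ : K) (T χ)) :
    IsSelfAdjoint R := by
  rw [ContinuousLinearMap.isSelfAdjoint_iff_isSymmetric]
  intro ψ χ
  change inner ℂ (R ψ) χ = inner ℂ ψ (R χ)
  have h1 := hsym ⟨R ψ, h.mem ψ⟩ ⟨R χ, h.mem χ⟩
  calc inner ℂ (R ψ) χ = inner ℂ (R ψ) (R χ + T ⟨R χ, h.mem χ⟩) := by rw [h.right_inv]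
    _ = inner ℂ (R ψ + T ⟨R ψ, h.mem ψ⟩) (R χ) := by
      rw [inner_add_left, inner_add_right, h1]
    _ = inner ℂ ψ (R χ) := by rw [h.right_inv]

/-- Positivity of `R` gives the lower end and `‖R‖ ≤ 1` the upper one. Thanks to this, scalar
estimates on `[0, 1]` suffice for every operator estimate below. -/
theorem IsShiftInverse.spectrum_subset (h : IsShiftInverse T R)
    (hsym : ∀ φ χ : T.domain, inner ℂ (T φ) (χ : K) = inner ℂ (φ : K) (T χ))
    (hpos : ∀ φ : T.domain, 0 ≤ (inner ℂ (φ : K) (T φ)).re) : spectrum ℝ R ⊆ Icc 0 1 := by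
  have hsa := h.isSelfAdjoint hsym
  have hR : 0 ≤ R := by
    rw [ContinuousLinearMap.nonneg_iff_isPositive, ContinuousLinearMap.isPositive_iff_complex]
    intro ψ
    have him : (inner ℂ (R ψ) ψ).im = 0 := by
      have := (ContinuousLinearMap.isSelfAdjoint_iff_isSymmetric.1 hsa) ψ ψ
      change inner ℂ (R ψ) ψ = inner ℂ ψ (R ψ) at this
      rw [← inner_conj_symm ψ] at this
      exact Complex.conj_eq_iff_im.1 this.symm
    exact ⟨Complex.ext rfl him.symm, (sq_nonneg _).trans (h.norm_sq_le hpos ψ)⟩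
  intro r hr
  refine ⟨spectrum_nonneg_of_nonneg hR hr, ?_⟩
  have := IsometricContinuousFunctionalCalculus.norm_spectrum_le R hr hsa
  exact (le_abs_self r).trans (this.trans (h.norm_le_one hpos))

end ShiftInverse

/-! ### The functions `sin (t √x) / √x` and `cos (t √x) / (1 + x)` of `r = 1 / (1 + x)` -/

theorem abs_sin_sub_self_le (b : ℝ) : |Real.sin b - b| ≤ 2 * b ^ 2 := by
  wlog hb : 0 ≤ b generalizing b
  · have := this (-b) (by linarith)
    rw [Real.sin_neg, neg_sq, ← abs_neg] at this
    convert this using 2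
    ring
  rcases hb.eq_or_lt with rfl | hb
  · simp
  rw [abs_sub_comm, abs_of_nonneg (sub_nonneg.2 (Real.sin_le hb.le))]
  -- Up to `1` the cubic lower bound for `sin` is enough; beyond `1` one has `b - sin b ≤ b + 1 ≤ 2
  -- b²`.
  rcases le_total b 1 with h1 | h1
  · have := Real.sin_gt_sub_cube hb
    nlinarith [sq_nonneg b, mul_le_mul_of_nonneg_left h1 (sq_nonneg b)]
  · nlinarith [Real.neg_one_le_sin b]

theorem abs_cos_sub_one_le (b : ℝ) : |Real.cos b - 1| ≤ b ^ 2 := by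
  rw [abs_le]
  constructor
  · nlinarith [Real.one_sub_sq_div_two_le_cos (x := b), sq_nonneg b]
  · nlinarith [Real.cos_le_one b, sq_nonneg b]

theorem abs_mul_add_mul_le {x y p q : ℝ} (hx : |x| ≤ 1) (hy : |y| ≤ 1) :
    |x * p + y * q| ≤ |p| + |q| := by
  refine (abs_add_le _ _).trans (add_le_add ?_ ?_)
  · rw [abs_mul]; exact mul_le_of_le_one_left (abs_nonneg _) hx
  · rw [abs_mul]; exact mul_le_of_le_one_left (abs_nonneg _) hy

theorem abs_sin_add_sub_le (a b : ℝ) :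
    |Real.sin (a + b) - Real.sin a - b * Real.cos a| ≤ 3 * b ^ 2 := by
  have h : Real.sin (a + b) - Real.sin a - b * Real.cos a
      = Real.sin a * (Real.cos b - 1) + Real.cos a * (Real.sin b - b) := by
    rw [Real.sin_add]; ring
  rw [h]
  have := abs_mul_add_mul_le (p := Real.cos b - 1) (q := Real.sin b - b)
    (Real.abs_sin_le_one a) (Real.abs_cos_le_one a)
  linarith [abs_cos_sub_one_le b, abs_sin_sub_self_le b]

theorem abs_cos_add_sub_le (a b : ℝ) :
    |Real.cos (a + b) - Real.cos a + b * Real.sin a| ≤ 3 * b ^ 2 := by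
  have h : Real.cos (a + b) - Real.cos a + b * Real.sin a
      = Real.cos a * (Real.cos b - 1) + -Real.sin a * (Real.sin b - b) := by
    rw [Real.cos_add]; ring
  rw [h]
  have := abs_mul_add_mul_le (p := Real.cos b - 1) (q := Real.sin b - b)
    (Real.abs_cos_le_one a) (by rw [abs_neg]; exact Real.abs_sin_le_one a)
  linarith [abs_cos_sub_one_le b, abs_sin_sub_self_le b]

/-- The frequency `√x` as a function of `r = 1 / (1 + x)`. -/
def freq (r : ℝ) : ℝ := √(1 / r - 1)

/-- This is `x / (1 + x) = 1 - 1 / (1 + x)`, the scalar form of `A R = 1 - R`. It is the source of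
every bound in which a factor `r` absorbs the unbounded frequency. -/
theorem freq_sq_mul {r : ℝ} (h0 : 0 < r) (h1 : r ≤ 1) : freq r ^ 2 * r = 1 - r := by
  rw [freq, Real.sq_sqrt]
  · field_simp
  · rw [sub_nonneg, le_div_iff₀ h0]; linarith

/-- `sin (t √x) / √x` as a function of `r = 1 / (1 + x)`. -/
def sinFun (t r : ℝ) : ℝ := if r = 0 then 0 else sinDiv t (1 / r - 1)

/-- `cos (t √x) / (1 + x)` as a function of `r = 1 / (1 + x)`. -/
def cosFun (t r : ℝ) : ℝ := Real.cos (t * freq r) * r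

theorem sinDiv_eq_sinc {x : ℝ} (hx : 0 ≤ x) (t : ℝ) : sinDiv t x = t * Real.sinc (t * √x) := by
  rcases hx.eq_or_lt with rfl | hx
  · simp [sinDiv]
  · have hs : √x ≠ 0 := (Real.sqrt_pos.2 hx).ne'
    rw [sinDiv, if_neg hx.ne']
    rcases eq_or_ne t 0 with rfl | ht
    · simp
    · rw [Real.sinc_of_ne_zero (mul_ne_zero ht hs)]
      field_simp

theorem one_div_sub_one_nonneg {r : ℝ} (h0 : 0 < r) (h1 : r ≤ 1) : 0 ≤ 1 / r - 1 := by
  rw [sub_nonneg, le_div_iff₀ h0]; linarith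

theorem sinFun_eq_sinc {r : ℝ} (h0 : 0 < r) (h1 : r ≤ 1) (t : ℝ) :
    sinFun t r = t * Real.sinc (t * freq r) := by
  rw [sinFun, if_neg h0.ne', sinDiv_eq_sinc (one_div_sub_one_nonneg h0 h1), freq]

theorem freq_mul_sinFun {r : ℝ} (h0 : 0 < r) (h1 : r ≤ 1) (t : ℝ) :
    freq r * sinFun t r = Real.sin (t * freq r) := by
  rw [sinFun_eq_sinc h0 h1]
  rcases eq_or_ne (t * freq r) 0 with h | h
  · rw [h, Real.sinc_zero, Real.sin_zero, mul_one, mul_comm, h]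
  · rw [Real.sinc_of_ne_zero h, ← mul_assoc, mul_comm (freq r) t, mul_div_cancel₀ _ h]

theorem continuousOn_freq : ContinuousOn freq (Ioi 0) := by
  unfold freq
  refine Real.continuous_sqrt.comp_continuousOn ?_
  refine ContinuousOn.sub (ContinuousOn.div continuousOn_const continuousOn_id ?_)
    continuousOn_const
  exact fun r hr => (ne_of_gt hr)

theorem continuousOn_cosFun (t : ℝ) : ContinuousOn (cosFun t) (Icc 0 1) := by
  intro r hr
  rcases hr.1.eq_or_lt with rfl | h0
  · have h : Filter.Tendsto (cosFun t) (nhdsWithin 0 (Icc 0 1)) (nhds 0) := by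
      refine squeeze_zero_norm (a := fun r => |r|) (fun r => ?_) ?_
      · rw [cosFun, norm_mul]
        exact mul_le_of_le_one_left (abs_nonneg _) (Real.abs_cos_le_one _)
      · simpa using (continuous_abs.tendsto (0 : ℝ)).mono_left nhdsWithin_le_nhds
    have h0 : cosFun t 0 = 0 := by simp [cosFun]
    rw [ContinuousWithinAt, h0]
    exact h
  · have h := (continuousOn_freq r h0).continuousAt (Ioi_mem_nhds h0)
    refine ContinuousAt.continuousWithinAt ?_
    unfold cosFun
    fun_prop

/-- Only `r = 0`, that is infinite frequency, is delicate. There `|sin| ≤ 1` and the frequency grows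
like `r ^ (-1/2)`, so the quotient is `O(√r)`. -/
theorem continuousOn_sinFun (t : ℝ) : ContinuousOn (sinFun t) (Icc 0 1) := by
  intro r hr
  rcases hr.1.eq_or_lt with rfl | h0
  · have h : Filter.Tendsto (sinFun t) (nhdsWithin 0 (Icc 0 1)) (nhds 0) := by
      -- One majorant serves two regimes: for `r ≤ 1/2` one has `freq r * √(2r) ≥ 1`, which gives
      -- the bound `√(2r)`; for `r ≥ 1/2` the bound `|t|` is used together with `√(2r) ≥ 1`.
      refine squeeze_zero_norm' (a := fun r => (1 + |t|) * √(2 * r)) ?_ ?_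
      · filter_upwards [self_mem_nhdsWithin] with r hr
        rcases hr.1.eq_or_lt with rfl | h0
        · simp [sinFun]
        have hf := freq_sq_mul h0 hr.2
        have hs := freq_mul_sinFun h0 hr.2 t
        have hf0 : 0 ≤ freq r := Real.sqrt_nonneg _
        have hq : √(2 * r) ^ 2 = 2 * r := Real.sq_sqrt (by linarith)
        have hq0 : 0 ≤ √(2 * r) := Real.sqrt_nonneg _
        rw [Real.norm_eq_abs]
        rcases le_total r (1 / 2) with h2 | h2
        · have h3 : 1 ≤ freq r * √(2 * r) := by
            rw [← one_le_sq_iff₀ (by positivity), mul_pow, hq]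
            nlinarith
          have h4 : freq r * |sinFun t r| ≤ 1 := by
            rw [← abs_of_nonneg hf0, ← abs_mul, hs]
            exact Real.abs_sin_le_one _
          have h5 : |sinFun t r| ≤ √(2 * r) := by
            calc |sinFun t r| = |sinFun t r| * 1 := (mul_one _).symm
              _ ≤ |sinFun t r| * (freq r * √(2 * r)) := by gcongr
              _ = freq r * |sinFun t r| * √(2 * r) := by ring
              _ ≤ 1 * √(2 * r) := by gcongr
              _ = _ := one_mul _
          nlinarith [mul_nonneg (abs_nonneg t) hq0]
        · have h3 : 1 ≤ √(2 * r) := by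
            rw [← one_le_sq_iff₀ hq0, hq]; linarith
          have h4 : |sinFun t r| ≤ |t| := by
            rw [sinFun_eq_sinc h0 hr.2, abs_mul]
            exact mul_le_of_le_one_right (abs_nonneg _) (Real.abs_sinc_le_one _)
          nlinarith [abs_nonneg t]
      · have : Continuous fun r : ℝ => (1 + |t|) * √(2 * r) := by fun_prop
        simpa using (this.tendsto 0).mono_left nhdsWithin_le_nhds
    have h0 : sinFun t 0 = 0 := by simp [sinFun]
    rw [ContinuousWithinAt, h0]
    exact h
  · have h := (continuousOn_freq r h0).continuousAt (Ioi_mem_nhds h0)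
    have h' : ContinuousWithinAt (fun r => t * Real.sinc (t * freq r)) (Icc 0 1) r := by
      refine ContinuousAt.continuousWithinAt ?_
      have := Real.continuous_sinc.continuousAt (x := t * freq r)
      exact continuousAt_const.mul (this.comp (f := fun r => t * freq r) (by fun_prop))
    refine h'.congr_of_eventuallyEq ?_ (sinFun_eq_sinc h0 hr.2 t)
    filter_upwards [self_mem_nhdsWithin, mem_nhdsWithin_of_mem_nhds (Ioi_mem_nhds h0)]
      with s hs hs0 using sinFun_eq_sinc hs0 hs.2 t

theorem abs_sinFun_sub_le {r : ℝ} (hr : r ∈ Icc (0 : ℝ) 1) (t s : ℝ) :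
    |sinFun t r - sinFun s r| ≤ |t - s| := by
  rcases hr.1.eq_or_lt with rfl | h0
  · simp [sinFun]
  rw [sinFun, sinFun, if_neg h0.ne', if_neg h0.ne']
  have hx := one_div_sub_one_nonneg h0 hr.2
  rcases hx.eq_or_lt with h | h
  · rw [← h]; simp [sinDiv]
  · have hs := Real.sqrt_pos.2 h
    rw [sinDiv, sinDiv, if_neg h.ne', if_neg h.ne', ← sub_div, abs_div, abs_of_pos hs,
      div_le_iff₀ hs]
    refine (Real.abs_sin_sub_sin_le _ _).trans_eq ?_
    rw [← sub_mul, abs_mul, abs_of_pos hs]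

/-- The second-order remainder of the sine costs `freq²`, and `r / freq` reduces this to `freq * r ≤
1`. The constant is therefore independent of `r`, as norm differentiability requires. -/
theorem abs_sinFun_taylor {r : ℝ} (hr : r ∈ Icc (0 : ℝ) 1) (t h : ℝ) :
    |sinFun (t + h) r * r - sinFun t r * r - h * cosFun t r| ≤ 3 * h ^ 2 := by
  rcases hr.1.eq_or_lt with rfl | h0
  · simp [cosFun]; positivity
  rcases eq_or_ne (freq r) 0 with hf | hf
  · have h1 : ∀ t, sinFun t r = t := fun t => by simp [sinFun_eq_sinc h0 hr.2, hf]
    rw [h1, h1, cosFun, hf]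
    simp only [mul_zero, Real.cos_zero, one_mul]
    ring_nf
    simp only [abs_zero]
    positivity
  · have hf0 : 0 < freq r := lt_of_le_of_ne (Real.sqrt_nonneg _) hf.symm
    have h1 := freq_sq_mul h0 hr.2
    have hs : ∀ t, sinFun t r = Real.sin (t * freq r) / freq r := fun t => by
      rw [eq_div_iff hf, mul_comm, freq_mul_sinFun h0 hr.2]
    have h2 := abs_sin_add_sub_le (t * freq r) (h * freq r)
    rw [← add_mul] at h2
    have h3 : sinFun (t + h) r * r - sinFun t r * r - h * cosFun t r
        = (Real.sin ((t + h) * freq r) - Real.sin (t * freq r)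
          - h * freq r * Real.cos (t * freq r)) * (r / freq r) := by
      rw [hs, hs, cosFun]
      field_simp
    have h4 : freq r * r ≤ 1 := by
      have h5 : (freq r * r) ^ 2 ≤ 1 := by nlinarith [mul_pow (freq r) r 2, hr.2]
      exact (sq_le_one_iff₀ (by positivity)).1 h5
    rw [h3, abs_mul, abs_of_pos (div_pos h0 hf0)]
    calc _ ≤ 3 * (h * freq r) ^ 2 * (r / freq r) := by gcongr
      _ = 3 * h ^ 2 * (freq r * r) := by field_simp
      _ ≤ 3 * h ^ 2 * 1 := by gcongr
      _ = _ := mul_one _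

/-- The `t`-derivative is `-freq² r` times `sinFun`, and `freq² r = 1 - r` turns it into the
difference shown. The same identity bounds the remainder uniformly in `r`. -/
theorem abs_cosFun_taylor {r : ℝ} (hr : r ∈ Icc (0 : ℝ) 1) (t h : ℝ) :
    |cosFun (t + h) r - cosFun t r - h * (sinFun t r * r - sinFun t r)| ≤ 3 * h ^ 2 := by
  rcases hr.1.eq_or_lt with rfl | h0
  · simp [cosFun, sinFun]; positivity
  have h1 := freq_sq_mul h0 hr.2
  have hs := freq_mul_sinFun h0 hr.2 t
  have h2 := abs_cos_add_sub_le (t * freq r) (h * freq r)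
  rw [← add_mul] at h2
  have h3 : cosFun (t + h) r - cosFun t r - h * (sinFun t r * r - sinFun t r)
      = (Real.cos ((t + h) * freq r) - Real.cos (t * freq r)
          + h * freq r * Real.sin (t * freq r)) * r := by
    rw [cosFun, cosFun, ← hs]
    linear_combination -h * sinFun t r * h1
  rw [h3, abs_mul, abs_of_pos h0]
  calc _ ≤ 3 * (h * freq r) ^ 2 * r := by gcongr
    _ = 3 * h ^ 2 * (freq r ^ 2 * r) := by ring
    _ ≤ 3 * h ^ 2 * 1 := by
      gcongr
      linarith
    _ = _ := mul_one _

theorem hasDerivAt_of_quadratic_bound {F : Type*} [NormedAddCommGroup F] [NormedSpace ℝ F]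
    {f : ℝ → F} {f' : F} {t C : ℝ} (h : ∀ s, ‖f (t + s) - f t - s • f'‖ ≤ C * s ^ 2) :
    HasDerivAt f f' t := by
  rw [hasDerivAt_iff_isLittleO_nhds_zero]
  refine Asymptotics.IsBigO.trans_isLittleO (g := fun s : ℝ => s ^ 2) ?_ ?_
  · refine Asymptotics.IsBigO.of_bound C (Filter.Eventually.of_forall fun s => ?_)
    rw [Real.norm_of_nonneg (sq_nonneg s)]
    exact h s
  · simpa using Asymptotics.isLittleO_pow_pow (𝕜 := ℝ) (m := 1) (n := 2) (by norm_num)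

/-! ### The sine and cosine families as functions of the resolvent -/

section SineCosine

variable {K : Type*} [NormedAddCommGroup K] [InnerProductSpace ℂ K] [CompleteSpace K]
  {R : K →L[ℂ] K}

/-- `sin (t √T) / √T` for `R = (1 + T)⁻¹`. -/
def sinOp (R : K →L[ℂ] K) (t : ℝ) : K →L[ℂ] K := cfc (sinFun t) R

/-- `cos (t √T) (1 + T)⁻¹` for `R = (1 + T)⁻¹`. -/
def cosOp (R : K →L[ℂ] K) (t : ℝ) : K →L[ℂ] K := cfc (cosFun t) R

theorem commute_sinOp (hsa : IsSelfAdjoint R) (t : ℝ) : Commute (sinOp R t) R := by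
  have := cfc_commute_cfc (sinFun t) (fun x : ℝ => x) R
  rwa [cfc_id' ℝ R hsa] at this

variable (hsa : IsSelfAdjoint R) (hsp : spectrum ℝ R ⊆ Icc 0 1)
include hsp

theorem norm_sinOp_sub_le (t s : ℝ) : ‖sinOp R t - sinOp R s‖ ≤ |t - s| := by
  rw [sinOp, sinOp, ← cfc_sub (sinFun t) (sinFun s) R ((continuousOn_sinFun t).mono hsp)
    ((continuousOn_sinFun s).mono hsp)]
  exact norm_cfc_le (abs_nonneg _) fun r hr => abs_sinFun_sub_le (hsp hr) t s

theorem continuous_sinOp : Continuous (sinOp R) := by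
  refine LipschitzWith.continuous (K := 1) (LipschitzWith.of_dist_le_mul fun t s => ?_)
  rw [dist_eq_norm, NNReal.coe_one, one_mul]
  exact norm_sinOp_sub_le hsp t s

include hsa

/-- The factor `R` is what gives a norm derivative: the scalar Taylor bound carries over through
`norm_cfc_le`, with a constant that does not depend on the spectral point. -/
theorem hasDerivAt_sinOp_mul (t : ℝ) :
    HasDerivAt (fun t => sinOp R t * R) (cosOp R t) t := by
  refine hasDerivAt_of_quadratic_bound (C := 3) fun h => ?_
  have hc := fun t => (continuousOn_sinFun t).mono hsp
  have hc' := fun t => (continuousOn_cosFun t).mono hsp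
  have hmul : ∀ t, sinOp R t * R = cfc (fun r => sinFun t r * r) R := fun t => by
    rw [cfc_mul (sinFun t) (fun r => r) R (hc t) continuousOn_id, cfc_id' ℝ R hsa, sinOp]
  have : sinOp R (t + h) * R - sinOp R t * R - h • cosOp R t
      = cfc (fun r => sinFun (t + h) r * r - sinFun t r * r - h * cosFun t r) R := by
    have h1 := hc (t + h)
    have h2 := hc t
    have h3 := hc' t
    rw [cfc_sub (fun r => sinFun (t + h) r * r - sinFun t r * r) (fun r => h * cosFun t r) R
      ((h1.mul continuousOn_id).sub (h2.mul continuousOn_id)) (continuousOn_const.mul h3),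
      cfc_sub (fun r => sinFun (t + h) r * r) (fun r => sinFun t r * r) R
      (h1.mul continuousOn_id) (h2.mul continuousOn_id), ← hmul, ← hmul,
      cfc_const_mul h (cosFun t) R h3]
    rfl
  rw [this]
  exact norm_cfc_le (by positivity) fun r hr => abs_sinFun_taylor (hsp hr) t h

theorem hasDerivAt_cosOp (t : ℝ) :
    HasDerivAt (cosOp R) (sinOp R t * R - sinOp R t) t := by
  refine hasDerivAt_of_quadratic_bound (C := 3) fun h => ?_
  have h2 := (continuousOn_sinFun t).mono hsp
  have hc' := fun t => (continuousOn_cosFun t).mono hsp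
  have hmul : sinOp R t * R = cfc (fun r => sinFun t r * r) R := by
    rw [cfc_mul (sinFun t) (fun r => r) R h2 continuousOn_id, cfc_id' ℝ R hsa, sinOp]
  have : cosOp R (t + h) - cosOp R t - h • (sinOp R t * R - sinOp R t)
      = cfc (fun r => cosFun (t + h) r - cosFun t r - h * (sinFun t r * r - sinFun t r)) R := by
    have h1 := hc' (t + h)
    have h3 := hc' t
    rw [cfc_sub (fun r => cosFun (t + h) r - cosFun t r)
      (fun r => h * (sinFun t r * r - sinFun t r)) R
      (h1.sub h3) (continuousOn_const.mul ((h2.mul continuousOn_id).sub h2)),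
      cfc_sub (cosFun (t + h)) (cosFun t) R h1 h3,
      cfc_const_mul h (fun r => sinFun t r * r - sinFun t r) R ((h2.mul continuousOn_id).sub h2),
      cfc_sub (fun r => sinFun t r * r) (sinFun t) R (h2.mul continuousOn_id) h2, ← hmul]
    rfl
  rw [this]
  exact norm_cfc_le (by positivity) fun r hr => abs_cosFun_taylor (hsp hr) t h

omit hsp in
theorem cosOp_zero : cosOp R 0 = R := by
  have : cosFun 0 = fun r => r := by
    ext r; simp [cosFun]
  rw [cosOp, this, cfc_id' ℝ R hsa]

omit hsa hsp in
theorem sinOp_zero : sinOp R 0 = 0 := by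
  have : sinFun 0 = fun _ => 0 := by
    ext r
    simp [sinFun, sinDiv]
  rw [sinOp, this]
  exact cfc_const_zero ℝ R

end SineCosine

/-! ### Absolutely continuous functions with values in a normed space -/

section AbsolutelyContinuous

variable {F : Type*} [NormedAddCommGroup F] [NormedSpace ℝ F]

theorem absolutelyContinuousOnInterval_of_dist_le {X Y : Type*} [PseudoMetricSpace X]
    [PseudoMetricSpace Y] {f : ℝ → X} {g : ℝ → Y} {a b : ℝ}
    (hg : AbsolutelyContinuousOnInterval g a b)
    (h : ∀ x ∈ uIcc a b, ∀ y ∈ uIcc a b, dist (f x) (f y) ≤ dist (g x) (g y)) :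
    AbsolutelyContinuousOnInterval f a b := by
  rw [absolutelyContinuousOnInterval_iff] at hg ⊢
  intro ε hε
  obtain ⟨δ, hδ, H⟩ := hg ε hε
  refine ⟨δ, hδ, fun E hE hEδ => (Finset.sum_le_sum fun i hi => ?_).trans_lt (H E hE hEδ)⟩
  exact h _ (hE.1 i hi).1 _ (hE.1 i hi).2

/-- Increments of the vector-valued primitive are dominated by increments of the primitive of `‖f‖`,
which reduces the claim to real functions. -/
theorem absolutelyContinuousOnInterval_integral {f : ℝ → F} {a b : ℝ}
    (h : IntervalIntegrable f volume a b) :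
    AbsolutelyContinuousOnInterval (fun x => ∫ y in a..x, f y) a b := by
  refine absolutelyContinuousOnInterval_of_dist_le
    (h.norm.absolutelyContinuousOnInterval_intervalIntegral left_mem_uIcc) fun x hx y hy => ?_
  have hsub : ∀ z ∈ uIcc a b, IntervalIntegrable f volume a z := fun z hz =>
    h.mono_set (uIcc_subset_uIcc_left hz)
  rw [dist_eq_norm, dist_eq_norm, intervalIntegral.integral_interval_sub_left (hsub x hx)
    (hsub y hy), intervalIntegral.integral_interval_sub_left (hsub x hx).norm (hsub y hy).norm,
    Real.norm_eq_abs]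
  exact intervalIntegral.norm_integral_le_abs_integral_norm

/-- Subtracting the primitive of `f'` leaves an absolutely continuous function whose derivative is
almost everywhere zero, hence a constant. -/
theorem integral_eq_sub_of_absolutelyContinuous [CompleteSpace F] {f f' : ℝ → F} {a b : ℝ}
    (hab : a ≤ b) (hf : AbsolutelyContinuousOnInterval f a b)
    (hderiv : ∀ᵐ x ∂volume.restrict (Ioo a b), HasDerivAt f (f' x) x)
    (hint : Integrable f' (volume.restrict (Ioo a b))) :
    ∫ x in Ioo a b, f' x = f b - f a := by
  have hint' : IntervalIntegrable f' volume a b := by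
    rw [intervalIntegrable_iff_integrableOn_Ioo_of_le hab]
    exact hint
  have hac := hf.sub (absolutelyContinuousOnInterval_integral hint')
  obtain ⟨C, hC⟩ := hac.const_of_ae_hasDerivAt_zero (by
    have h1 : ∀ᵐ x, x ∈ Icc a b → HasDerivAt f (f' x) x := by
      rw [← ae_restrict_iff' measurableSet_Icc, ← Measure.restrict_congr_set Ioo_ae_eq_Icc]
      exact hderiv
    filter_upwards [h1, hint'.ae_hasDerivAt_integral] with x h1 h2 hx
    rw [uIcc_of_le hab] at hx
    have h3 := (h1 hx).sub (h2 (by rwa [uIcc_of_le hab]) a left_mem_uIcc)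
    rwa [sub_self] at h3)
  have ha := hC a left_mem_uIcc
  have hb := hC b right_mem_uIcc
  simp only [Pi.sub_apply, intervalIntegral.integral_same, sub_zero] at ha hb
  rw [← integral_Ioc_eq_integral_Ioo, ← intervalIntegral.integral_of_le hab, ha, ← hb]
  abel

end AbsolutelyContinuous

/-! ### Vectors and multiplication operators in `H` -/

section Multiplication

variable {P : System}

instance : IsFiniteMeasure P.μ := by
  unfold System.μ
  infer_instance

/-- The vector of `H` with given components. -/
def mkH {f : ℝ → ℂ} (hf : MemLp f 2 P.μ) (c : ℂ) : H P :=
  WithLp.toLp 2 ((hf.toLp f : Lp ℂ 2 P.μ), (c : Bdry P))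

theorem comp₁_mkH {f : ℝ → ℂ} (hf : MemLp f 2 P.μ) (c : ℂ) : comp₁ (mkH hf c) =ᵐ[P.μ] f :=
  hf.coeFn_toLp

theorem comp₂_mkH {f : ℝ → ℂ} (hf : MemLp f 2 P.μ) (c : ℂ) : comp₂ (mkH hf c) = c := rfl

theorem memLp_comp₁ (φ : H P) : MemLp (comp₁ φ) 2 P.μ := Lp.memLp _

theorem integrable_conj_mul {f g : ℝ → ℂ} (hf : MemLp f 2 P.μ) (hg : MemLp g 2 P.μ) :
    Integrable (fun z => conj (f z) * g z) P.μ :=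
  hf.star.integrable_mul hg

theorem norm_sq_H (φ : H P) :
    ‖φ‖ ^ 2 = (∫ z in Ioo 0 P.ℓ, ‖comp₁ φ z‖ ^ 2) + P.ρ⁻¹ * ‖comp₂ φ‖ ^ 2 := by
  have h1 : ∀ z : ℂ, conj z * z = ((‖z‖ ^ 2 : ℝ) : ℂ) := fun z => by
    rw [Complex.conj_mul']; push_cast; rfl
  have h := inner_self_eq_norm_sq_to_K (𝕜 := ℂ) φ
  rw [inner_H] at h
  simp only [h1] at h
  rw [integral_complex_ofReal] at h
  have h2 : ((‖φ‖ ^ 2 : ℝ) : ℂ)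
      = (((∫ z in Ioo 0 P.ℓ, ‖comp₁ φ z‖ ^ 2) + P.ρ⁻¹ * ‖comp₂ φ‖ ^ 2 : ℝ) : ℂ) := by
    push_cast at h ⊢
    exact h.symm
  exact Complex.ofReal_injective h2

theorem memLp_continuousOn {f : ℝ → ℂ} (hf : ContinuousOn f (Icc 0 P.ℓ)) : MemLp f 2 P.μ := by
  obtain ⟨C, hC⟩ := isCompact_Icc.exists_bound_of_continuousOn hf
  refine MemLp.of_bound ((hf.mono Ioo_subset_Icc_self).aestronglyMeasurable measurableSet_Ioo)
    C ?_
  filter_upwards [ae_restrict_mem (μ := volume) measurableSet_Ioo] with z hz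
  exact hC z (Ioo_subset_Icc_self hz)

theorem memLp_mul {w : ℝ → ℝ} (hw : ContinuousOn w (Icc 0 P.ℓ)) {f : ℝ → ℂ}
    (hf : MemLp f 2 P.μ) : MemLp (fun z => (w z : ℂ) * f z) 2 P.μ := by
  obtain ⟨C, hC⟩ := isCompact_Icc.exists_bound_of_continuousOn hw
  refine hf.of_le_mul (c := C) ?_ ?_
  · exact ((Complex.continuous_ofReal.comp_continuousOn hw).mono
      Ioo_subset_Icc_self).aestronglyMeasurable measurableSet_Ioo |>.mul hf.1
  · filter_upwards [ae_restrict_mem (μ := volume) measurableSet_Ioo] with z hz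
    rw [norm_mul, Complex.norm_real]
    exact mul_le_mul_of_nonneg_right (hC z (Ioo_subset_Icc_self hz)) (norm_nonneg _)

theorem norm_mkH_mul_le {w : ℝ → ℝ} (hw : ContinuousOn w (Icc 0 P.ℓ)) {c C : ℝ} (hC0 : 0 ≤ C)
    (hC : ∀ z ∈ Icc 0 P.ℓ, |w z| ≤ C) (hc : |c| ≤ C) (φ : H P) :
    ‖mkH (memLp_mul hw (memLp_comp₁ φ)) (c * comp₂ φ)‖ ≤ C * ‖φ‖ := by
  refine abs_le_of_sq_le_sq' ?_ (by positivity) |>.2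
  rw [mul_pow, norm_sq_H, norm_sq_H, mul_add, comp₂_mkH, ← integral_const_mul]
  refine add_le_add ?_ ?_
  · have hi : Integrable (fun z => ‖comp₁ φ z‖ ^ 2) P.μ := (memLp_comp₁ φ).integrable_norm_pow
      (by norm_num)
    refine integral_mono_of_nonneg (Filter.Eventually.of_forall fun z => sq_nonneg _)
      (hi.const_mul _) ?_
    filter_upwards [comp₁_mkH (memLp_mul hw (memLp_comp₁ φ)) (c * comp₂ φ),
      ae_restrict_mem (μ := volume) measurableSet_Ioo] with z h1 hz
    rw [h1, norm_mul, mul_pow, Complex.norm_real, Real.norm_eq_abs]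
    have := hC z (Ioo_subset_Icc_self hz)
    gcongr
  · rw [norm_mul, mul_pow, Complex.norm_real, Real.norm_eq_abs, mul_left_comm]
    have := P.ρ_pos
    have : 0 ≤ P.ρ⁻¹ := inv_nonneg.2 P.ρ_pos.le
    gcongr

/-- Multiplication by `w` on `L²((0, ℓ))` and by `c` on `ℂ`. -/
def mulOp {w : ℝ → ℝ} (hw : ContinuousOn w (Icc 0 P.ℓ)) (c : ℝ) : H P →L[ℂ] H P :=
  LinearMap.mkContinuousOfExistsBound
    { toFun := fun φ => mkH (memLp_mul hw (memLp_comp₁ φ)) (c * comp₂ φ)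
      map_add' := fun φ χ => by
        apply ext_H
        · refine (comp₁_mkH _ _).trans ?_
          filter_upwards [comp₁_add φ χ, comp₁_add (mkH (memLp_mul hw (memLp_comp₁ φ))
            (c * comp₂ φ)) (mkH (memLp_mul hw (memLp_comp₁ χ)) (c * comp₂ χ)),
            comp₁_mkH (memLp_mul hw (memLp_comp₁ φ)) (c * comp₂ φ),
            comp₁_mkH (memLp_mul hw (memLp_comp₁ χ)) (c * comp₂ χ)] with z h1 h2 h3 h4
          rw [h2, h1, Pi.add_apply, Pi.add_apply, h3, h4, mul_add]
        · simp only [comp₂_add, comp₂_mkH, mul_add]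
      map_smul' := fun a φ => by
        apply ext_H
        · refine (comp₁_mkH _ _).trans ?_
          filter_upwards [comp₁_smul a φ, comp₁_smul a (mkH (memLp_mul hw (memLp_comp₁ φ))
            (c * comp₂ φ)), comp₁_mkH (memLp_mul hw (memLp_comp₁ φ)) (c * comp₂ φ)]
            with z h1 h2 h3
          rw [RingHom.id_apply, h2, h1, Pi.smul_apply, Pi.smul_apply, h3, smul_eq_mul,
            smul_eq_mul]
          ring
        · simp only [RingHom.id_apply, comp₂_smul, comp₂_mkH]
          ring } (by
    obtain ⟨C, hC⟩ := isCompact_Icc.exists_bound_of_continuousOn hw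
    refine ⟨max C |c|, fun φ => norm_mkH_mul_le hw ?_ ?_ ?_ φ⟩
    · exact (abs_nonneg c).trans (le_max_right _ _)
    · exact fun z hz => (hC z hz).trans (le_max_left _ _)
    · exact le_max_right _ _)

theorem comp₁_mulOp {w : ℝ → ℝ} (hw : ContinuousOn w (Icc 0 P.ℓ)) (c : ℝ) (φ : H P) :
    comp₁ (mulOp hw c φ) =ᵐ[P.μ] fun z => w z * comp₁ φ z := comp₁_mkH _ _

theorem comp₂_mulOp {w : ℝ → ℝ} (hw : ContinuousOn w (Icc 0 P.ℓ)) (c : ℝ) (φ : H P) :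
    comp₂ (mulOp hw c φ) = c * comp₂ φ := rfl

theorem norm_mulOp_le {w : ℝ → ℝ} (hw : ContinuousOn w (Icc 0 P.ℓ)) {c C : ℝ} (hC0 : 0 ≤ C)
    (hC : ∀ z ∈ Icc 0 P.ℓ, |w z| ≤ C) (hc : |c| ≤ C) : ‖mulOp hw c‖ ≤ C :=
  ContinuousLinearMap.opNorm_le_bound _ hC0 (norm_mkH_mul_le hw hC0 hC hc)

theorem inner_mulOp_right {w : ℝ → ℝ} (hw : ContinuousOn w (Icc 0 P.ℓ)) (c : ℝ) (φ χ : H P) :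
    inner ℂ φ (mulOp hw c χ) = (∫ z in Ioo 0 P.ℓ, w z * (conj (comp₁ φ z) * comp₁ χ z))
      + P.ρ⁻¹ * (c * (conj (comp₂ φ) * comp₂ χ)) := by
  rw [inner_H, comp₂_mulOp]
  congr 1
  · refine integral_congr_ae ?_
    filter_upwards [comp₁_mulOp hw c χ] with z h
    rw [h]; ring
  · push_cast; ring

theorem inner_mulOp_left {w : ℝ → ℝ} (hw : ContinuousOn w (Icc 0 P.ℓ)) (c : ℝ) (φ χ : H P) :
    inner ℂ (mulOp hw c φ) χ = inner ℂ φ (mulOp hw c χ) := by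
  rw [inner_mulOp_right, inner_H, comp₂_mulOp]
  congr 1
  · refine integral_congr_ae ?_
    filter_upwards [comp₁_mulOp hw c φ] with z h
    rw [h, map_mul, Complex.conj_ofReal]; ring
  · rw [map_mul, Complex.conj_ofReal]; push_cast; ring

theorem re_inner_mulOp_self {w : ℝ → ℝ} (hw : ContinuousOn w (Icc 0 P.ℓ)) (c : ℝ) (φ : H P) :
    (inner ℂ φ (mulOp hw c φ)).re = (∫ z in Ioo 0 P.ℓ, w z * ‖comp₁ φ z‖ ^ 2)
      + P.ρ⁻¹ * (c * ‖comp₂ φ‖ ^ 2) := by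
  have h1 : ∀ z : ℂ, conj z * z = ((‖z‖ ^ 2 : ℝ) : ℂ) := fun z => by
    rw [Complex.conj_mul']; push_cast; rfl
  rw [inner_mulOp_right]
  simp only [h1, ← Complex.ofReal_mul]
  rw [integral_complex_ofReal, ← Complex.ofReal_add, Complex.ofReal_re]

theorem integrable_mul_norm_sq {w : ℝ → ℝ} (hw : ContinuousOn w (Icc 0 P.ℓ)) {f : ℝ → ℂ}
    (hf : MemLp f 2 P.μ) : Integrable (fun z => w z * ‖f z‖ ^ 2) P.μ := by
  have h := (integrable_conj_mul hf (memLp_mul hw hf)).re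
  refine h.congr (Filter.Eventually.of_forall fun z => ?_)
  have h1 : conj (f z) * ((w z : ℂ) * f z) = ((w z * ‖f z‖ ^ 2 : ℝ) : ℂ) := by
    rw [mul_left_comm, Complex.conj_mul']
    push_cast
    rfl
  change (conj (f z) * ((w z : ℂ) * f z)).re = _
  rw [h1, Complex.ofReal_re]

theorem re_inner_mulOp_mono {w w' : ℝ → ℝ} (hw : ContinuousOn w (Icc 0 P.ℓ))
    (hw' : ContinuousOn w' (Icc 0 P.ℓ)) {c c' : ℝ} (φ : H P)
    (h : ∀ᵐ z ∂P.μ, w z * ‖comp₁ φ z‖ ^ 2 ≤ w' z * ‖comp₁ φ z‖ ^ 2)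
    (hc : c * ‖comp₂ φ‖ ^ 2 ≤ c' * ‖comp₂ φ‖ ^ 2) :
    (inner ℂ φ (mulOp hw c φ)).re ≤ (inner ℂ φ (mulOp hw' c' φ)).re := by
  rw [re_inner_mulOp_self, re_inner_mulOp_self]
  refine add_le_add ?_ (mul_le_mul_of_nonneg_left hc (inv_nonneg.2 P.ρ_pos.le))
  exact integral_mono_ae (integrable_mul_norm_sq hw (memLp_comp₁ φ))
    (integrable_mul_norm_sq hw' (memLp_comp₁ φ)) h

end Multiplication

/-! ### The quadratic form of `A` -/

section Form

variable {P : System}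

theorem mem_zero : (0 : ℝ) ∈ Icc 0 P.ℓ := left_mem_Icc.2 P.ℓ_pos.le

theorem mem_end : P.ℓ ∈ Icc 0 P.ℓ := right_mem_Icc.2 P.ℓ_pos.le

theorem continuousOn_bulk (φ : domainA P) : ContinuousOn (bulk φ) (Icc 0 P.ℓ) :=
  fun z hz => ((represents_bulk φ).deriv_eq z hz).continuousWithinAt

theorem continuousOn_bulk' (φ : domainA P) : ContinuousOn (bulk' φ) (Icc 0 P.ℓ) := by
  simpa [uIcc_of_le P.ℓ_pos.le] using (represents_bulk φ).ac'.continuousOn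

theorem hasDerivAt_bulk (φ : domainA P) {z : ℝ} (hz : z ∈ Ioo 0 P.ℓ) :
    HasDerivAt (bulk φ) (bulk' φ z) z :=
  ((represents_bulk φ).deriv_eq z (Ioo_subset_Icc_self hz)).hasDerivAt (Icc_mem_nhds hz.1 hz.2)

/-- The potential `q = m² + V`. -/
def System.q (P : System) (z : ℝ) : ℝ := P.m ^ 2 + P.V z

theorem continuousOn_q : ContinuousOn P.q (Icc 0 P.ℓ) := continuousOn_const.add P.V_cont

theorem integral_by_parts (φ χ : domainA P) {w : ℝ → ℝ} (hw : ContDiff ℝ 1 w) :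
    ∫ z in Ioo 0 P.ℓ, (w z * (conj (bulk χ z) * bulk'' φ z)
      + (w z * (conj (bulk' χ z) * bulk' φ z) + ((deriv w z : ℝ) : ℂ) * (conj (bulk χ z) * bulk' φ z)))
      = w P.ℓ * (conj (bulk χ P.ℓ) * bulk' φ P.ℓ) - w 0 * (conj (bulk χ 0) * bulk' φ 0) := by
  -- The integrand is the derivative of `w * conj χ₁ * ∂_z φ₁`, a product of three absolutely
  -- continuous functions.
  have hac : AbsolutelyContinuousOnInterval
      (fun z => (w z : ℂ) • ((conj (bulk χ z)) • bulk' φ z)) 0 P.ℓ := by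
    have h1 : AbsolutelyContinuousOnInterval (fun z => (w z : ℂ)) 0 P.ℓ :=
      absolutelyContinuousOnInterval_of_dist_le hw.contDiffOn.absolutelyContinuousOnInterval
        fun x _ y _ => by
          rw [dist_eq_norm, ← Complex.ofReal_sub, Complex.norm_real, ← dist_eq_norm]
    have h2 : AbsolutelyContinuousOnInterval (fun z => conj (bulk χ z)) 0 P.ℓ :=
      absolutelyContinuousOnInterval_of_dist_le (represents_bulk χ).ac
        fun x _ y _ => by
          rw [dist_eq_norm, ← map_sub, RCLike.norm_conj, ← dist_eq_norm]
    exact h1.fun_smul (h2.fun_smul (represents_bulk φ).ac')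
  refine integral_eq_sub_of_absolutelyContinuous P.ℓ_pos.le hac ?_ ?_
  · filter_upwards [(represents_bulk φ).deriv_ae,
      ae_restrict_mem (μ := volume) measurableSet_Ioo] with z h1 hz
    have h2 := (hasDerivAt_bulk χ hz).star
    have h3 : HasDerivAt (fun z => (w z : ℂ)) ((deriv w z : ℝ) : ℂ) z :=
      ((hw.differentiable one_ne_zero) z).hasDerivAt.ofReal_comp
    have h4 := h3.mul (h2.mul h1)
    refine h4.congr_deriv ?_
    simp only [Pi.mul_apply, starRingEnd_apply]
    ring
  · have hw' : ContinuousOn w (Icc 0 P.ℓ) := hw.continuous.continuousOn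
    have hdw : ContinuousOn (deriv w) (Icc 0 P.ℓ) := (hw.continuous_deriv le_rfl).continuousOn
    have hu := memLp_continuousOn (continuousOn_bulk χ)
    have hv := memLp_continuousOn (continuousOn_bulk' χ)
    have hv' := memLp_continuousOn (continuousOn_bulk' φ)
    have i1 := integrable_conj_mul hu (memLp_mul hw' (represents_bulk φ).memLp)
    have i2 := integrable_conj_mul hv (memLp_mul hw' hv')
    have i3 := integrable_conj_mul hu (memLp_mul hdw hv')
    refine (i1.add (i2.add i3)).congr (Filter.Eventually.of_forall fun z => ?_)
    simp only [Pi.add_apply]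
    ring

/-- The boundary part at `z = ℓ` of the form of `A`, in terms of the boundary values of the two
functions and of their derivatives. -/
def endForm (P : System) (a₁ b₁ a b : ℂ) : ℂ :=
  ((-P.ρ⁻¹ : ℝ) : ℂ) * (((P.β₁ * P.β₁' : ℝ) : ℂ) * (conj a₁ * a)
    + ((P.β₂ * P.β₂' : ℝ) : ℂ) * (conj b₁ * b)
    - ((P.β₁ * P.β₂' : ℝ) : ℂ) * (conj a₁ * b + conj b₁ * a))

theorem endForm_conj (a₁ b₁ a b : ℂ) : conj (endForm P a b a₁ b₁) = endForm P a₁ b₁ a b := by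
  simp only [endForm, map_mul, map_sub, map_add, Complex.conj_ofReal, Complex.conj_conj]
  ring

/-- Either sign of `β₂'` gives `β₂ β₂' < 0` and `β₁ β₂' ≥ 0`. With `ρ > 0`, this is all that is
needed for the Hermitian form in `(a, b)` to be nonnegative. -/
theorem endForm_self_nonneg (hP : P.PositivityConditions) (a b : ℂ) :
    0 ≤ (endForm P a b a b).re := by
  have h1 : (endForm P a b a b).re = P.ρ⁻¹ * (-(P.β₁ * P.β₁') * (a.re ^ 2 + a.im ^ 2)
      - P.β₂ * P.β₂' * (b.re ^ 2 + b.im ^ 2)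
      + 2 * (P.β₁ * P.β₂') * (a.re * b.re + a.im * b.im)) := by
    rw [endForm, Complex.re_ofReal_mul, Complex.sub_re, Complex.add_re, Complex.re_ofReal_mul,
      Complex.re_ofReal_mul, Complex.re_ofReal_mul]
    simp only [Complex.add_re, Complex.mul_re, Complex.conj_re, Complex.conj_im]
    ring
  rw [h1]
  refine mul_nonneg (inv_nonneg.2 P.ρ_pos.le) ?_
  have hρ := P.ρ_pos
  have hr : 0 < -(P.β₂ * P.β₂') ∧ 0 ≤ P.β₁ * P.β₂' := by
    rcases hP.β₂'_ne_zero.lt_or_gt with h | h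
    · obtain ⟨h1, h2, -⟩ := hP.of_neg h
      exact ⟨by nlinarith, by nlinarith⟩
    · obtain ⟨h1, h2, -⟩ := hP.of_pos h
      exact ⟨by nlinarith, by positivity⟩
  have hdet : 0 ≤ P.β₁ * P.β₂' * (P.β₁' * P.β₂ - P.β₁ * P.β₂') := mul_nonneg hr.2 hρ.le
  set r := -(P.β₂ * P.β₂') with hr_def
  set c := P.β₁ * P.β₂' with hc_def
  -- Multiplying by `r` lets the square be completed without division: the result is `|r b + c a|²`
  -- plus `c ρ |a|²`.
  refine nonneg_of_mul_nonneg_right ?_ hr.1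
  have : r * (-(P.β₁ * P.β₁') * (a.re ^ 2 + a.im ^ 2)
      - P.β₂ * P.β₂' * (b.re ^ 2 + b.im ^ 2) + 2 * c * (a.re * b.re + a.im * b.im))
      = (r * b.re + c * a.re) ^ 2 + (r * b.im + c * a.im) ^ 2
        + c * (P.β₁' * P.β₂ - P.β₁ * P.β₂') * (a.re ^ 2 + a.im ^ 2) := by
    rw [hr_def, hc_def]; ring
  rw [this]
  positivity

/-- The boundary data of both functions at `0` are annihilated by the same real nonzero vector `(cos
α, sin α)`, so their Wronskian vanishes. This is the symmetry of the boundary term at `0`. -/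
theorem bc_conj {φ χ : domainA P} :
    conj (bulk φ 0) * bulk' χ 0 = bulk χ 0 * conj (bulk' φ 0) := by
  have h1 := congrArg conj (represents_bulk φ).bc
  have h2 := (represents_bulk χ).bc
  simp only [map_add, map_mul, Complex.conj_ofReal, map_zero] at h1
  have h3 : (Real.cos P.α : ℂ) ^ 2 + (Real.sin P.α : ℂ) ^ 2 = 1 := by
    exact_mod_cast Real.cos_sq_add_sin_sq P.α
  linear_combination
    (-(Real.cos P.α : ℂ) * bulk' χ 0 + (Real.sin P.α : ℂ) * bulk χ 0) * -h1
      + ((Real.sin P.α : ℂ) * conj (bulk φ 0) - (Real.cos P.α : ℂ) * conj (bulk' φ 0)) * h2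
      + (conj (bulk φ 0) * bulk' χ 0 - bulk χ 0 * conj (bulk' φ 0)) * -h3

/-- For `α = 0` the value at `0` vanishes; otherwise the derivative there is `-cot α` times the
value, with `-cot α ≥ 0` on `[π/2, π)`. -/
theorem bc_nonneg (hP : P.PositivityConditions) (φ : domainA P) :
    0 ≤ (conj (bulk φ 0) * bulk' φ 0).re := by
  have h1 := (represents_bulk φ).bc
  rcases hP.angle with h | h
  · rw [h] at h1
    simp only [Real.cos_zero, Real.sin_zero, Complex.ofReal_one, one_mul, Complex.ofReal_zero,
      zero_mul, add_zero] at h1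
    simp [h1]
  · have hs : 0 < Real.sin P.α := Real.sin_pos_of_pos_of_lt_pi
      (lt_of_lt_of_le (by positivity) h) P.α_mem.2
    have hc : Real.cos P.α ≤ 0 := Real.cos_nonpos_of_pi_div_two_le_of_le h
      (by linarith [P.α_mem.2, Real.pi_pos])
    have h2 : (Real.sin P.α : ℂ) * (conj (bulk φ 0) * bulk' φ 0)
        = ((-Real.cos P.α * ‖bulk φ 0‖ ^ 2 : ℝ) : ℂ) := by
      rw [Complex.ofReal_mul, Complex.ofReal_neg, Complex.ofReal_pow, ← Complex.conj_mul']
      linear_combination conj (bulk φ 0) * h1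
    have h3 := congrArg Complex.re h2
    rw [Complex.re_ofReal_mul, Complex.ofReal_re] at h3
    refine nonneg_of_mul_nonneg_right ?_ hs
    rw [h3]
    nlinarith [sq_nonneg ‖bulk φ 0‖]

/-- The form of `A` with weight `w`. -/
def energyForm (w : ℝ → ℝ) (χ φ : domainA P) : ℂ :=
  (∫ z in Ioo 0 P.ℓ, (w z : ℂ) * (conj (bulk' χ z) * bulk' φ z
    + P.q z * (conj (bulk χ z) * bulk φ z)))
  + w 0 * (conj (bulk χ 0) * bulk' φ 0)
  + w P.ℓ * endForm P (bulk χ P.ℓ) (bulk' χ P.ℓ) (bulk φ P.ℓ) (bulk' φ P.ℓ)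

theorem energyForm_conj (w : ℝ → ℝ) (χ φ : domainA P) :
    conj (energyForm w φ χ) = energyForm w χ φ := by
  simp only [energyForm, map_add, map_mul, Complex.conj_ofReal, endForm_conj, Complex.conj_conj]
  rw [← integral_conj, ← bc_conj]
  congr 3
  funext z
  simp only [map_add, map_mul, Complex.conj_ofReal, Complex.conj_conj]
  ring

theorem re_energyForm_self_ge (hP : P.PositivityConditions) {w : ℝ → ℝ}
    (hw : ContinuousOn w (Icc 0 P.ℓ)) (hw0 : ∀ z ∈ Icc 0 P.ℓ, 0 ≤ w z) (φ : domainA P) :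
    (∫ z in Ioo 0 P.ℓ, w z * ‖bulk' φ z‖ ^ 2) + (∫ z in Ioo 0 P.ℓ, w z * P.q z * ‖bulk φ z‖ ^ 2)
      ≤ (energyForm w φ φ).re := by
  have h1 : (∫ z in Ioo 0 P.ℓ, (w z : ℂ) * (conj (bulk' φ z) * bulk' φ z
      + P.q z * (conj (bulk φ z) * bulk φ z)))
      = (((∫ z in Ioo 0 P.ℓ, w z * ‖bulk' φ z‖ ^ 2)
        + ∫ z in Ioo 0 P.ℓ, w z * P.q z * ‖bulk φ z‖ ^ 2 : ℝ) : ℂ) := by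
    have i1 : Integrable (fun z => w z * ‖bulk' φ z‖ ^ 2) (volume.restrict (Ioo 0 P.ℓ)) :=
      integrable_mul_norm_sq hw (memLp_continuousOn (continuousOn_bulk' φ))
    have i2 : Integrable (fun z => w z * P.q z * ‖bulk φ z‖ ^ 2) (volume.restrict (Ioo 0 P.ℓ)) :=
      integrable_mul_norm_sq (hw.mul continuousOn_q) (memLp_continuousOn (continuousOn_bulk φ))
    rw [← integral_add i1 i2, ← integral_complex_ofReal]
    congr 1
    funext z
    rw [Complex.conj_mul', Complex.conj_mul']
    push_cast
    ring
  rw [energyForm, h1, Complex.add_re, Complex.add_re, Complex.ofReal_re, Complex.re_ofReal_mul,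
    Complex.re_ofReal_mul]
  have h2 := mul_nonneg (hw0 0 mem_zero) (bc_nonneg hP φ)
  have h3 := mul_nonneg (hw0 P.ℓ mem_end)
    (endForm_self_nonneg hP (bulk φ P.ℓ) (bulk' φ P.ℓ))
  linarith

theorem bulk'_unique {φ : domainA P} {u v w : ℝ → ℂ} (h : Represents P (φ : H P) u v w) :
    bulk' φ =ᵐ[P.μ] v := by
  filter_upwards [ae_restrict_mem (μ := volume) measurableSet_Ioo] with z hz
  exact ((represents_bulk φ).unique h).2.1 (Ioo_subset_Icc_self hz)

variable (P) in
/-- The derivative `φ ↦ (∂_z φ₁, 0)` as a linear map `D(A) → H`. -/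
def derivLin : DA P →ₗ[ℂ] H P where
  toFun φ := mkH (memLp_continuousOn (continuousOn_bulk' (P := P) φ)) 0
  map_add' φ χ := by
    apply ext_H
    · have h1 := bulk'_unique (φ := (φ + χ : domainA P))
        ((represents_bulk (P := P) φ).add (represents_bulk (P := P) χ))
      filter_upwards [comp₁_mkH (memLp_continuousOn (continuousOn_bulk' (P := P) (φ + χ))) 0,
        comp₁_mkH (memLp_continuousOn (continuousOn_bulk' (P := P) φ)) 0,
        comp₁_mkH (memLp_continuousOn (continuousOn_bulk' (P := P) χ)) 0,
        comp₁_add (mkH (memLp_continuousOn (continuousOn_bulk' (P := P) φ)) 0)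
          (mkH (memLp_continuousOn (continuousOn_bulk' (P := P) χ)) 0), h1] with z e1 e2 e3 e4 e5
      rw [e4, Pi.add_apply, e2, e3]
      exact e1.trans e5
    · simp only [comp₂_add, comp₂_mkH, add_zero]
  map_smul' c φ := by
    apply ext_H
    · have h1 := bulk'_unique (φ := (c • φ : domainA P)) ((represents_bulk (P := P) φ).smul c)
      filter_upwards [comp₁_mkH (memLp_continuousOn (continuousOn_bulk' (P := P) (c • φ))) 0,
        comp₁_mkH (memLp_continuousOn (continuousOn_bulk' (P := P) φ)) 0,
        comp₁_smul c (mkH (memLp_continuousOn (continuousOn_bulk' (P := P) φ)) 0), h1]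
        with z e1 e2 e4 e5
      rw [RingHom.id_apply, e4, Pi.smul_apply, e2]
      exact e1.trans e5
    · simp only [RingHom.id_apply, comp₂_smul, comp₂_mkH, mul_zero]

theorem comp₁_derivLin (φ : DA P) : comp₁ (derivLin P φ) =ᵐ[P.μ] bulk' (P := P) φ :=
  comp₁_mkH _ _

theorem comp₂_derivLin (φ : DA P) : comp₂ (derivLin P φ) = 0 := rfl

theorem comp₁_incl (φ : DA P) : comp₁ (incl P φ) =ᵐ[P.μ] bulk (P := P) φ :=
  (represents_bulk (P := P) φ).ae_eq

theorem comp₂_incl (φ : DA P) : comp₂ (incl P φ)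
    = P.β₁' * bulk (P := P) φ P.ℓ - P.β₂' * bulk' (P := P) φ P.ℓ :=
  (represents_bulk (P := P) φ).snd_eq

theorem comp₁_mapA (φ : DA P) : comp₁ (mapA P φ)
    =ᵐ[P.μ] fun z => -bulk'' (P := P) φ z + (P.q z : ℂ) * bulk (P := P) φ z :=
  (applyA_eq (represents_bulk (P := P) φ)).1

theorem comp₂_mapA (φ : DA P) : comp₂ (mapA P φ)
    = -(P.β₁ * bulk (P := P) φ P.ℓ - P.β₂ * bulk' (P := P) φ P.ℓ) :=
  (applyA_eq (represents_bulk (P := P) φ)).2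

/-- Weighted Green's formula: `-(w u')' = -w u'' - w' u'`, so removing `w' ∂_z` from `w A` produces
a symmetric form. The case `w = 1` is the form of `A`; the general case drives the local energy. -/
theorem inner_mulOp_mapA_sub {w : ℝ → ℝ} (hw : ContDiff ℝ 1 w)
    (hw0 : ContinuousOn w (Icc 0 P.ℓ)) (hdw : ContinuousOn (deriv w) (Icc 0 P.ℓ))
    (χ φ : DA P) :
    inner ℂ (incl P χ) (mulOp hw0 (w P.ℓ) (mapA P φ) - mulOp hdw 0 (derivLin P φ))
      = energyForm w χ φ := by
  have hu := memLp_continuousOn (continuousOn_bulk (P := P) χ)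
  have hv := memLp_continuousOn (continuousOn_bulk' (P := P) χ)
  have hu' := memLp_continuousOn (continuousOn_bulk (P := P) φ)
  have hv' := memLp_continuousOn (continuousOn_bulk' (P := P) φ)
  have hw'' := (represents_bulk (P := P) φ).memLp
  have hq := memLp_mul continuousOn_q hu'
  have e1 : (∫ z in Ioo 0 P.ℓ, (w z : ℂ) * (conj (comp₁ (incl P χ) z) * comp₁ (mapA P φ) z))
      = ∫ z in Ioo 0 P.ℓ, (w z : ℂ) * (conj (bulk (P := P) χ z) *
        (-bulk'' (P := P) φ z + (P.q z : ℂ) * bulk (P := P) φ z)) := by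
    refine integral_congr_ae ?_
    filter_upwards [comp₁_incl χ, comp₁_mapA φ] with z h1 h2
    rw [h1, h2]
  have e2 : (∫ z in Ioo 0 P.ℓ, ((deriv w z : ℝ) : ℂ) *
      (conj (comp₁ (incl P χ) z) * comp₁ (derivLin P φ) z))
      = ∫ z in Ioo 0 P.ℓ, ((deriv w z : ℝ) : ℂ) *
        (conj (bulk (P := P) χ z) * bulk' (P := P) φ z) := by
    refine integral_congr_ae ?_
    filter_upwards [comp₁_incl χ, comp₁_derivLin φ] with z h1 h2
    rw [h1, h2]
  have i1 := integrable_conj_mul hu (memLp_mul hw0 hw'')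
  have i2 := integrable_conj_mul hv (memLp_mul hw0 hv')
  have i3 := integrable_conj_mul hu (memLp_mul hdw hv')
  have i4 := integrable_conj_mul hu (memLp_mul hw0 hq)
  have e3 : (∫ z in Ioo 0 P.ℓ, (w z : ℂ) * (conj (bulk (P := P) χ z) *
        (-bulk'' (P := P) φ z + (P.q z : ℂ) * bulk (P := P) φ z)))
      - (∫ z in Ioo 0 P.ℓ, ((deriv w z : ℝ) : ℂ) *
        (conj (bulk (P := P) χ z) * bulk' (P := P) φ z))
      = (∫ z in Ioo 0 P.ℓ, (w z : ℂ) * (conj (bulk' (P := P) χ z) * bulk' (P := P) φ z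
          + P.q z * (conj (bulk (P := P) χ z) * bulk (P := P) φ z)))
        - ∫ z in Ioo 0 P.ℓ, (w z * (conj (bulk (P := P) χ z) * bulk'' (P := P) φ z)
          + (w z * (conj (bulk' (P := P) χ z) * bulk' (P := P) φ z)
            + ((deriv w z : ℝ) : ℂ) * (conj (bulk (P := P) χ z) * bulk' (P := P) φ z))) := by
    rw [← integral_sub, ← integral_sub]
    · congr 1
      funext z
      ring
    · refine (i2.add i4).congr (Filter.Eventually.of_forall fun z => ?_)
      simp only [Pi.add_apply]
      ring
    · refine (i1.add (i2.add i3)).congr (Filter.Eventually.of_forall fun z => ?_)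
      simp only [Pi.add_apply]
      ring
    · refine (i4.sub i1).congr (Filter.Eventually.of_forall fun z => ?_)
      simp only [Pi.sub_apply]
      ring
    · refine i3.congr (Filter.Eventually.of_forall fun z => ?_)
      simp only
      ring
  have hρ : (P.ρ : ℂ) ≠ 0 := Complex.ofReal_ne_zero.2 P.ρ_pos.ne'
  have hρ' : (P.ρ : ℂ) = P.β₁' * P.β₂ - P.β₁ * P.β₂' := by
    rw [System.ρ]; push_cast; rfl
  -- The contribution of the summand `ℂ` is the Hermitian form plus exactly the term that cancels
  -- the endpoint value from integration by parts. The cancellation uses `ρ⁻¹` times the determinant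
  -- of the boundary coefficients.
  have hbd : ∀ a₁ b₁ a b : ℂ, (P.ρ : ℂ)⁻¹ * (conj (P.β₁' * a₁ - P.β₂' * b₁)
      * -(P.β₁ * a - P.β₂ * b)) = endForm P a₁ b₁ a b + conj a₁ * b := by
    intro a₁ b₁ a b
    simp only [endForm, map_sub, map_mul, Complex.conj_ofReal]
    push_cast
    have : conj a₁ * b = (P.ρ : ℂ)⁻¹ * ((P.β₁' * P.β₂ - P.β₁ * P.β₂') * (conj a₁ * b)) := by
      rw [← hρ', inv_mul_cancel_left₀ hρ]
    linear_combination -this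
  have hE : energyForm (P := P) w χ φ
      = (∫ z in Ioo 0 P.ℓ, (w z : ℂ) * (conj (bulk' (P := P) χ z) * bulk' (P := P) φ z
          + P.q z * (conj (bulk (P := P) χ z) * bulk (P := P) φ z)))
        + w 0 * (conj (bulk (P := P) χ 0) * bulk' (P := P) φ 0)
        + w P.ℓ * endForm P (bulk (P := P) χ P.ℓ) (bulk' (P := P) χ P.ℓ)
          (bulk (P := P) φ P.ℓ) (bulk' (P := P) φ P.ℓ) := rfl
  rw [inner_sub_right, inner_mulOp_right, inner_mulOp_right, e1, e2, comp₂_derivLin, mul_zero,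
    Complex.ofReal_zero, zero_mul, mul_zero, add_zero, add_sub_right_comm, e3,
    integral_by_parts (P := P) φ χ hw, hE, comp₂_mapA, comp₂_incl,
    Complex.ofReal_inv]
  linear_combination (w P.ℓ : ℂ) * hbd (bulk (P := P) χ P.ℓ) (bulk' (P := P) χ P.ℓ)
    (bulk (P := P) φ P.ℓ) (bulk' (P := P) φ P.ℓ)

theorem inner_mapA (χ φ : DA P) :
    inner ℂ (incl P χ) (mapA P φ) = energyForm (fun _ => 1) χ φ := by
  rw [← inner_mulOp_mapA_sub contDiff_const continuousOn_const
    (by simpa using continuousOn_const), inner_sub_right, inner_mulOp_right, inner_mulOp_right,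
    comp₂_derivLin, inner_H]
  simp

theorem inner_mapA_symm (φ χ : DA P) :
    inner ℂ (mapA P φ) (incl P χ) = inner ℂ (incl P φ) (mapA P χ) := by
  rw [inner_mapA, ← inner_conj_symm, inner_mapA]
  exact energyForm_conj (P := P) _ _ _

/-- The potential term is kept on the left so that coercivity survives when the potential is removed
in `freeShift`. -/
theorem re_inner_mapA_ge (hP : P.PositivityConditions) (φ : DA P) :
    ‖derivLin P φ‖ ^ 2 + (inner ℂ (incl P φ) (mulOp continuousOn_q 0 (incl P φ))).re
      ≤ (inner ℂ (incl P φ) (mapA P φ)).re := by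
  rw [inner_mapA]
  refine le_of_eq_of_le ?_ (re_energyForm_self_ge (P := P) hP continuousOn_const
    (fun _ _ => zero_le_one) φ)
  rw [norm_sq_H, comp₂_derivLin, re_inner_mulOp_self]
  simp only [norm_zero, ne_eq, OfNat.ofNat_ne_zero, not_false_eq_true, zero_pow, mul_zero,
    add_zero, one_mul, zero_mul]
  congr 1
  · refine integral_congr_ae ?_
    filter_upwards [comp₁_derivLin φ] with z h
    rw [h]
  · refine integral_congr_ae ?_
    filter_upwards [comp₁_incl φ] with z h
    rw [h]

theorem re_inner_mulOp_q_nonneg (hP : P.PositivityConditions) (φ : H P) :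
    0 ≤ (inner ℂ φ (mulOp (P := P) continuousOn_q 0 φ)).re := by
  rw [re_inner_mulOp_self, zero_mul, mul_zero, add_zero]
  refine setIntegral_nonneg measurableSet_Ioo fun z hz => ?_
  exact mul_nonneg (hP.potential_nonneg z (Ioo_subset_Icc_self hz)) (sq_nonneg _)

theorem re_inner_mapA_nonneg (hP : P.PositivityConditions) (φ : DA P) :
    0 ≤ (inner ℂ (incl P φ) (mapA P φ)).re := by
  have := re_inner_mapA_ge hP φ
  have := re_inner_mulOp_q_nonneg hP (incl P φ)
  nlinarith [sq_nonneg ‖derivLin P φ‖]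

/-- The form of `A` dominates `‖∂_z φ₁‖²` and is at most `‖φ‖ ‖A φ‖` in the norm of `H`, hence at
most the square of the graph norm. -/
theorem norm_derivLin_le (hP : P.PositivityConditions) (φ : DA P) : ‖derivLin P φ‖ ≤ ‖φ‖ := by
  have h1 := re_inner_mapA_ge hP φ
  have h2 := re_inner_mulOp_q_nonneg hP (incl P φ)
  have h3 : (inner ℂ (incl P φ) (mapA P φ)).re ≤ ‖incl P φ‖ * ‖mapA P φ‖ :=
    re_inner_le_norm (𝕜 := ℂ) (incl P φ) (mapA P φ)
  have h4 : ‖φ‖ = ‖incl P φ‖ + ‖mapA P φ‖ := norm_DA φ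
  refine abs_le_of_sq_le_sq' ?_ (norm_nonneg _) |>.2
  rw [h4]
  nlinarith [norm_nonneg (incl P φ), norm_nonneg (mapA P φ)]

end Form

/-! ### Bounded invertibility of `1 + A` -/

section Neumann

variable {E K : Type*} [AddCommGroup E] [Module ℂ E] [NormedAddCommGroup K]
  [InnerProductSpace ℂ K]

/-- The bounded inverse of a surjective linear map that is bounded below. -/
theorem exists_bounded_inverse {i L : E →ₗ[ℂ] K} {κ : ℝ} (hκ : 0 < κ)
    (hL : ∀ φ, κ * ‖i φ‖ ≤ ‖L φ‖) (hsurj : Function.Surjective L) :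
    ∃ N : K →L[ℂ] K, ‖N‖ ≤ κ⁻¹ ∧ ∀ φ, N (L φ) = i φ := by
  have hker : ∀ φ χ, L φ = L χ → i φ = i χ := fun φ χ h => by
    have h1 := hL (φ - χ)
    rw [map_sub, map_sub, h, sub_self, norm_zero] at h1
    have h2 : ‖i φ - i χ‖ ≤ 0 := by
      by_contra! h3
      nlinarith
    exact sub_eq_zero.1 (norm_le_zero_iff.1 h2)
  have hs := Function.surjInv_eq hsurj
  let N₀ : K →ₗ[ℂ] K :=
    { toFun := fun ψ => i (Function.surjInv hsurj ψ)
      map_add' := fun ψ χ => by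
        rw [← map_add]
        exact hker _ _ (by rw [map_add, hs, hs, hs])
      map_smul' := fun c ψ => by
        rw [RingHom.id_apply, ← map_smul]
        exact hker _ _ (by rw [map_smul, hs, hs]) }
  have hN : ∀ ψ, ‖N₀ ψ‖ ≤ κ⁻¹ * ‖ψ‖ := fun ψ => by
    rw [inv_mul_eq_div, le_div_iff₀ hκ, mul_comm]
    exact (hL _).trans_eq (by rw [hs])
  refine ⟨N₀.mkContinuous κ⁻¹ hN, N₀.mkContinuous_norm_le (inv_nonneg.2 hκ.le) hN, fun φ => ?_⟩
  exact hker _ _ (hs (L φ))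

/-- With `N = i L⁻¹` one has `L - B i = (1 - B N) L`, and `‖B N‖ < 1` makes the first factor
invertible. -/
theorem surjective_sub_of_norm_lt [CompleteSpace K] {i L : E →ₗ[ℂ] K} {κ : ℝ} (hκ : 0 < κ)
    (hL : ∀ φ, κ * ‖i φ‖ ≤ ‖L φ‖) (hsurj : Function.Surjective L) {B : K →L[ℂ] K}
    (hB : ‖B‖ < κ) (ψ : K) : ∃ φ, L φ - B (i φ) = ψ := by
  obtain ⟨N, hN, hNi⟩ := exists_bounded_inverse hκ hL hsurj
  have h1 : ‖B * N‖ < 1 := by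
    refine (norm_mul_le _ _).trans_lt ?_
    calc ‖B‖ * ‖N‖ ≤ ‖B‖ * κ⁻¹ := by gcongr
      _ < κ * κ⁻¹ := by gcongr
      _ = 1 := mul_inv_cancel₀ hκ.ne'
  obtain ⟨U, hU⟩ := isUnit_one_sub_of_norm_lt_one h1
  obtain ⟨φ, hφ⟩ := hsurj ((↑U⁻¹ : K →L[ℂ] K) ψ)
  refine ⟨φ, ?_⟩
  have h2 : ((↑U : K →L[ℂ] K) * ↑U⁻¹) ψ = ψ := by rw [Units.mul_inv]; rfl
  rw [hU] at h2
  calc L φ - B (i φ) = (1 - B * N) (L φ) := by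
        change _ = L φ - B (N (L φ))
        rw [hNi]
    _ = ψ := by rw [hφ]; exact h2

theorem exists_isShiftInverse [CompleteSpace K] {T : K →ₗ.[ℂ] K}
    (hpos : ∀ φ : T.domain, 0 ≤ (inner ℂ (φ : K) (T φ)).re)
    (hsurj : ∀ ψ, ∃ φ : T.domain, (φ : K) + T φ = ψ) : ∃ R, IsShiftInverse T R := by
  have hL : ∀ φ : T.domain, 1 * ‖T.domain.subtype φ‖ ≤ ‖(T.domain.subtype + T.toFun) φ‖ := by
    intro φ
    have h1 : ‖(φ : K)‖ ^ 2 ≤ (inner ℂ (φ : K) ((φ : K) + T φ)).re := by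
      have h2 : (inner ℂ (φ : K) (φ : K)).re = ‖(φ : K)‖ ^ 2 :=
        inner_self_eq_norm_sq (𝕜 := ℂ) (φ : K)
      rw [inner_add_right, Complex.add_re, h2]
      linarith [hpos φ]
    have h3 : (inner ℂ (φ : K) ((φ : K) + T φ)).re ≤ ‖(φ : K)‖ * ‖(φ : K) + T φ‖ :=
      re_inner_le_norm (𝕜 := ℂ) _ _
    change 1 * ‖(φ : K)‖ ≤ ‖(φ : K) + T φ‖
    rcases (norm_nonneg (φ : K)).eq_or_lt with h0 | h0
    · rw [← h0]; simp
    · nlinarith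
  obtain ⟨R, -, hR⟩ := exists_bounded_inverse zero_lt_one hL hsurj
  have hR' : ∀ φ : T.domain, R ((φ : K) + T φ) = φ := hR
  have hmem : ∀ ψ, R ψ ∈ T.domain := fun ψ => by
    obtain ⟨φ, rfl⟩ := hsurj ψ
    rw [hR']
    exact φ.2
  refine ⟨R, hmem, fun ψ => ?_, hR'⟩
  obtain ⟨φ, hφ⟩ := hsurj ψ
  have h1 : (⟨R ψ, hmem ψ⟩ : T.domain) = φ := Subtype.ext (by
    change R ψ = φ
    rw [← hφ, hR'])
  rw [h1]
  rw [← hφ, hR']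

end Neumann

/-! ### Solving the boundary value problem for `1 + A` -/

section Surjectivity

variable {P : System}

theorem absolutelyContinuousOnInterval_of_hasDerivAt {f f' : ℝ → ℂ} {a b : ℝ}
    (hf : ∀ z, HasDerivAt f (f' z) z) (hf' : Continuous f') :
    AbsolutelyContinuousOnInterval f a b := by
  have h : ContDiff ℝ 1 f := by
    rw [contDiff_one_iff_deriv]
    refine ⟨fun z => (hf z).differentiableAt, ?_⟩
    rwa [funext fun z => (hf z).deriv]
  exact h.contDiffOn.absolutelyContinuousOnInterval

/-- Variation of constants for `y'' = k² (y - G)` with `y 0 = y' 0 = 0`. -/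
theorem exists_forced_solution (k : ℝ) {G : ℝ → ℂ} (hG : Continuous G) :
    ∃ y y' : ℝ → ℂ, (∀ z, HasDerivAt y (y' z) z) ∧
      (∀ z, HasDerivAt y' ((k : ℂ) ^ 2 * (y z - G z)) z) ∧ y 0 = 0 ∧ y' 0 = 0 := by
  have hsh : ∀ z, HasDerivAt (fun z : ℝ => ((Real.sinh (k * z) : ℝ) : ℂ))
      (k * ((Real.cosh (k * z) : ℝ) : ℂ)) z := fun z => by
    have h := ((Real.hasDerivAt_sinh (k * z)).comp z ((hasDerivAt_id z).const_mul k)).ofReal_comp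
    refine h.congr_deriv ?_
    push_cast; ring
  have hch : ∀ z, HasDerivAt (fun z : ℝ => ((Real.cosh (k * z) : ℝ) : ℂ))
      (k * ((Real.sinh (k * z) : ℝ) : ℂ)) z := fun z => by
    have h := ((Real.hasDerivAt_cosh (k * z)).comp z ((hasDerivAt_id z).const_mul k)).ofReal_comp
    refine h.congr_deriv ?_
    push_cast; ring
  have hshc : Continuous fun z : ℝ => ((Real.sinh (k * z) : ℝ) : ℂ) :=
    continuous_iff_continuousAt.2 fun z => (hsh z).continuousAt
  have hchc : Continuous fun z : ℝ => ((Real.cosh (k * z) : ℝ) : ℂ) :=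
    continuous_iff_continuousAt.2 fun z => (hch z).continuousAt
  have ha : ∀ z, HasDerivAt (fun z : ℝ => ∫ x in (0 : ℝ)..z, ((Real.cosh (k * x) : ℝ) : ℂ) * G x)
      (((Real.cosh (k * z) : ℝ) : ℂ) * G z) z := fun z =>
    (hchc.mul hG).integral_hasStrictDerivAt 0 z |>.hasDerivAt
  have hb : ∀ z, HasDerivAt (fun z : ℝ => ∫ x in (0 : ℝ)..z, ((Real.sinh (k * x) : ℝ) : ℂ) * G x)
      (((Real.sinh (k * z) : ℝ) : ℂ) * G z) z := fun z =>
    (hshc.mul hG).integral_hasStrictDerivAt 0 z |>.hasDerivAt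
  have hone : ∀ z, ((Real.cosh (k * z) : ℝ) : ℂ) ^ 2 - ((Real.sinh (k * z) : ℝ) : ℂ) ^ 2 = 1 :=
    fun z => by exact_mod_cast Real.cosh_sq_sub_sinh_sq (k * z)
  set a := fun z : ℝ => ∫ x in (0 : ℝ)..z, ((Real.cosh (k * x) : ℝ) : ℂ) * G x
  set b := fun z : ℝ => ∫ x in (0 : ℝ)..z, ((Real.sinh (k * x) : ℝ) : ℂ) * G x
  refine ⟨fun z => -(k : ℂ) * (((Real.sinh (k * z) : ℝ) : ℂ) * a z
      - ((Real.cosh (k * z) : ℝ) : ℂ) * b z),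
    fun z => -(k : ℂ) ^ 2 * (((Real.cosh (k * z) : ℝ) : ℂ) * a z
      - ((Real.sinh (k * z) : ℝ) : ℂ) * b z), fun z => ?_, fun z => ?_, ?_, ?_⟩
  · refine ((((hsh z).mul (ha z)).sub ((hch z).mul (hb z))).const_mul (-(k : ℂ))).congr_deriv ?_
    ring
  · refine ((((hch z).mul (ha z)).sub ((hsh z).mul (hb z))).const_mul
      (-(k : ℂ) ^ 2)).congr_deriv ?_
    linear_combination -(k : ℂ) ^ 2 * G z * hone z
  · simp [a, b]
  · simp [a, b]

/-- Subtracting the double primitive `G₂` of `g` leaves an equation with continuous forcing, to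
which variation of constants applies classically. All initial data at `0` vanish, so the boundary
condition holds for every `α`. -/
theorem exists_particular_profile (k : ℝ) {g : ℝ → ℂ} (hg : MemLp g 2 P.μ) :
    ∃ u v w, IsProfile P u v w ∧ ∀ z, -w z + (k : ℂ) ^ 2 * u z = g z := by
  have hgi : Integrable ((Ioo 0 P.ℓ).indicator g) :=
    (integrable_indicator_iff measurableSet_Ioo).2 (hg.integrable one_le_two)
  set G₁ := fun z : ℝ => ∫ x in (0 : ℝ)..z, (Ioo 0 P.ℓ).indicator g x with hG₁
  have hG₁c : Continuous G₁ := intervalIntegral.continuous_primitive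
    (fun _ _ => hgi.intervalIntegrable) 0
  set G₂ := fun z : ℝ => ∫ x in (0 : ℝ)..z, G₁ x with hG₂
  have hG₂d : ∀ z, HasDerivAt G₂ (G₁ z) z := fun z =>
    (hG₁c.integral_hasStrictDerivAt 0 z).hasDerivAt
  have hG₂c : Continuous G₂ := continuous_iff_continuousAt.2 fun z => (hG₂d z).continuousAt
  obtain ⟨y, y', hy, hy', hy0, hy0'⟩ := exists_forced_solution k hG₂c
  have hyc : Continuous y := continuous_iff_continuousAt.2 fun z => (hy z).continuousAt
  have hyc' : Continuous y' := continuous_iff_continuousAt.2 fun z => (hy' z).continuousAt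
  have hu : ∀ z, HasDerivAt (fun z => y z - G₂ z) (y' z - G₁ z) z := fun z =>
    (hy z).sub (hG₂d z)
  refine ⟨fun z => y z - G₂ z, fun z => y' z - G₁ z,
    fun z => (k : ℂ) ^ 2 * (y z - G₂ z) - g z, ⟨?_, ?_, ?_, ?_, ?_, ?_⟩, fun z => by ring⟩
  · exact absolutelyContinuousOnInterval_of_hasDerivAt hu (hyc'.sub hG₁c)
  · exact (absolutelyContinuousOnInterval_of_hasDerivAt hy'
      (continuous_const.mul (hyc.sub hG₂c))).sub
      (absolutelyContinuousOnInterval_integral hgi.intervalIntegrable)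
  · exact fun z _ => (hu z).hasDerivWithinAt
  · filter_upwards [ae_restrict_mem (μ := volume) measurableSet_Ioo,
      ae_restrict_of_ae (LocallyIntegrable.ae_hasDerivAt_integral hgi.locallyIntegrable)] with z hz h1
    have h2 := h1 0
    rw [indicator_of_mem hz] at h2
    exact (hy' z).sub h2
  · exact (memLp_continuousOn
      (continuous_const.mul (hyc.sub hG₂c)).continuousOn).sub hg
  · simp [hy0, hy0', hG₁, hG₂]

/-- The solution with initial data `(sin α, -cos α)` satisfies the boundary condition at `0`, and
these data are not both zero. -/
theorem isProfile_homogeneous {k : ℝ} (hk : k ≠ 0) :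
    ∃ u v w, IsProfile P u v w ∧ (∀ z, -w z + (k : ℂ) ^ 2 * u z = 0) ∧ ¬ (u 0 = 0 ∧ v 0 = 0) := by
  have hkc : (k : ℂ) ≠ 0 := Complex.ofReal_ne_zero.2 hk
  have hsh : ∀ z, HasDerivAt (fun z : ℝ => ((Real.sinh (k * z) : ℝ) : ℂ))
      (k * ((Real.cosh (k * z) : ℝ) : ℂ)) z := fun z => by
    have h := ((Real.hasDerivAt_sinh (k * z)).comp z ((hasDerivAt_id z).const_mul k)).ofReal_comp
    refine h.congr_deriv ?_
    push_cast; ring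
  have hch : ∀ z, HasDerivAt (fun z : ℝ => ((Real.cosh (k * z) : ℝ) : ℂ))
      (k * ((Real.sinh (k * z) : ℝ) : ℂ)) z := fun z => by
    have h := ((Real.hasDerivAt_cosh (k * z)).comp z ((hasDerivAt_id z).const_mul k)).ofReal_comp
    refine h.congr_deriv ?_
    push_cast; ring
  have h3 : (Real.cos P.α : ℂ) ^ 2 + (Real.sin P.α : ℂ) ^ 2 = 1 := by
    exact_mod_cast Real.cos_sq_add_sin_sq P.α
  set c := (Real.cos P.α : ℂ)
  set s := (Real.sin P.α : ℂ)
  set u := fun z : ℝ => s * ((Real.cosh (k * z) : ℝ) : ℂ)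
    - c / k * ((Real.sinh (k * z) : ℝ) : ℂ) with hu_def
  set v := fun z : ℝ => s * k * ((Real.sinh (k * z) : ℝ) : ℂ)
    - c * ((Real.cosh (k * z) : ℝ) : ℂ) with hv_def
  have hu : ∀ z, HasDerivAt u (v z) z := fun z => by
    refine (((hch z).const_mul s).sub ((hsh z).const_mul (c / k))).congr_deriv ?_
    rw [hv_def]
    field_simp
  have hv : ∀ z, HasDerivAt v ((k : ℂ) ^ 2 * u z) z := fun z => by
    refine (((hsh z).const_mul (s * k)).sub ((hch z).const_mul c)).congr_deriv ?_
    rw [hu_def]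
    field_simp
  have huc : Continuous u := continuous_iff_continuousAt.2 fun z => (hu z).continuousAt
  have hvc : Continuous v := continuous_iff_continuousAt.2 fun z => (hv z).continuousAt
  refine ⟨u, v, fun z => (k : ℂ) ^ 2 * u z, ⟨?_, ?_, ?_, ?_, ?_, ?_⟩, fun z => by ring, ?_⟩
  · exact absolutelyContinuousOnInterval_of_hasDerivAt hu hvc
  · exact absolutelyContinuousOnInterval_of_hasDerivAt hv (continuous_const.mul huc)
  · exact fun z _ => (hu z).hasDerivWithinAt
  · exact Filter.Eventually.of_forall hv
  · exact memLp_continuousOn (continuous_const.mul huc).continuousOn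
  · simp only [hu_def, hv_def, mul_zero, Real.cosh_zero, Real.sinh_zero, Complex.ofReal_zero,
      Complex.ofReal_one]
    ring
  · rintro ⟨h1, h2⟩
    simp only [hu_def, hv_def, mul_zero, Real.cosh_zero, Real.sinh_zero, Complex.ofReal_zero,
      Complex.ofReal_one, mul_one, sub_zero, zero_sub, neg_eq_zero] at h1 h2
    rw [h1, h2] at h3
    norm_num at h3

theorem IsProfile.represents {u v w : ℝ → ℂ} (h : IsProfile P u v w) :
    ∃ φ : H P, Represents P φ u v w := by
  have hu : MemLp u 2 P.μ :=
    memLp_continuousOn fun z hz => (h.deriv_eq z hz).continuousWithinAt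
  exact ⟨mkH hu (P.β₁' * u P.ℓ - P.β₂' * v P.ℓ), h, comp₁_mkH hu _, rfl⟩

variable (P) in
/-- The operator `k² + A` with the potential removed. -/
def freeShift (k : ℝ) : DA P →ₗ[ℂ] H P :=
  ((k : ℂ) ^ 2) • inclLin P + mapA P - (mulOp (P := P) continuousOn_q 0).toLinearMap ∘ₗ inclLin P

theorem freeShift_apply (k : ℝ) (φ : DA P) : freeShift P k φ
    = (k : ℂ) ^ 2 • incl P φ + mapA P φ - mulOp (P := P) continuousOn_q 0 (incl P φ) := rfl

theorem comp₁_sub (φ χ : H P) : comp₁ (φ - χ) =ᵐ[P.μ] comp₁ φ - comp₁ χ :=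
  Lp.coeFn_sub (show Lp ℂ 2 P.μ from φ.fst) (show Lp ℂ 2 P.μ from χ.fst)

theorem comp₂_sub (φ χ : H P) : comp₂ (φ - χ) = comp₂ φ - comp₂ χ := rfl

theorem freeShift_eq (k : ℝ) (φ : DA P) {u v w : ℝ → ℂ} (h : Represents P (incl P φ) u v w) :
    (comp₁ (freeShift P k φ) =ᵐ[P.μ] fun z => -w z + (k : ℂ) ^ 2 * u z) ∧
    comp₂ (freeShift P k φ) = (k : ℂ) ^ 2 * (P.β₁' * u P.ℓ - P.β₂' * v P.ℓ)
      - (P.β₁ * u P.ℓ - P.β₂ * v P.ℓ) := by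
  have hA : (comp₁ (mapA P φ) =ᵐ[P.μ] fun z => -w z + ((P.m ^ 2 + P.V z : ℝ) : ℂ) * u z) ∧
    comp₂ (mapA P φ) = -(P.β₁ * u P.ℓ - P.β₂ * v P.ℓ) := applyA_eq (P := P) h
  rw [freeShift_apply]
  constructor
  · filter_upwards [hA.1, h.ae_eq, comp₁_mulOp (P := P) continuousOn_q 0 (incl P φ),
      comp₁_smul ((k : ℂ) ^ 2) (incl P φ), comp₁_add ((k : ℂ) ^ 2 • incl P φ) (mapA P φ),
      comp₁_sub ((k : ℂ) ^ 2 • incl P φ + mapA P φ) (mulOp (P := P) continuousOn_q 0 (incl P φ))]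
      with z h1 h2 h3 h4 h5 h6
    rw [h6, Pi.sub_apply, h5, Pi.add_apply, h4, Pi.smul_apply, h3, h1, h2, smul_eq_mul, System.q]
    ring
  · rw [comp₂_sub, comp₂_add, comp₂_smul, comp₂_mulOp, hA.2, h.snd_eq]
    push_cast
    ring

theorem freeShift_bounded_below (hP : P.PositivityConditions) (k : ℝ) (φ : DA P) :
    k ^ 2 * ‖inclLin P φ‖ ≤ ‖freeShift P k φ‖ := by
  change k ^ 2 * ‖incl P φ‖ ≤ _
  have h1 : k ^ 2 * ‖incl P φ‖ ^ 2 ≤ (inner ℂ (incl P φ) (freeShift P k φ)).re := by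
    have h2 : (inner ℂ (incl P φ) (incl P φ)).re = ‖incl P φ‖ ^ 2 :=
      inner_self_eq_norm_sq (𝕜 := ℂ) (incl P φ)
    have h3 := re_inner_mapA_ge hP φ
    rw [freeShift_apply, inner_sub_right, inner_add_right, inner_smul_right, Complex.sub_re,
      Complex.add_re, ← Complex.ofReal_pow, Complex.re_ofReal_mul, h2]
    nlinarith [sq_nonneg ‖derivLin P φ‖]
  have h3 : (inner ℂ (incl P φ) (freeShift P k φ)).re ≤ ‖incl P φ‖ * ‖freeShift P k φ‖ :=
    re_inner_le_norm (𝕜 := ℂ) (incl P φ) (freeShift P k φ)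
  rcases (norm_nonneg (incl P φ)).eq_or_lt with h0 | h0
  · rw [← h0]; simp
  · nlinarith

/-- A particular solution matches the bulk component; a multiple of the homogeneous solution then
adjusts the boundary component without affecting the bulk. -/
theorem freeShift_surjective (hP : P.PositivityConditions) {k : ℝ} (hk : k ≠ 0) :
    Function.Surjective (freeShift P k) := by
  intro ψ
  obtain ⟨u, v, w, hp, he⟩ := exists_particular_profile k (memLp_comp₁ ψ)
  obtain ⟨u₀, v₀, w₀, hp₀, he₀, hne⟩ := isProfile_homogeneous (P := P) hk
  obtain ⟨φ, hφ⟩ := hp.represents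
  obtain ⟨φ₀, hφ₀⟩ := hp₀.represents
  let Φ : DA P := (⟨φ, u, v, w, hφ⟩ : domainA P)
  let Φ₀ : DA P := (⟨φ₀, u₀, v₀, w₀, hφ₀⟩ : domainA P)
  obtain ⟨h1, h2⟩ := freeShift_eq k Φ hφ
  obtain ⟨h3, h4⟩ := freeShift_eq k Φ₀ hφ₀
  -- Otherwise the homogeneous solution would lie in the kernel of `freeShift`, which coercivity
  -- excludes for nonzero initial data.
  have hc : comp₂ (freeShift P k Φ₀) ≠ 0 := by
    intro hc
    have hz : freeShift P k Φ₀ = 0 := by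
      apply ext_H
      · filter_upwards [h3, Lp.coeFn_zero ℂ 2 P.μ] with z e1 e2
        rw [e1, he₀]
        exact e2.symm
      · exact hc
    have hb := freeShift_bounded_below hP k Φ₀
    rw [hz, norm_zero] at hb
    have hk2 : 0 < k ^ 2 := by positivity
    have hφ0 : φ₀ = 0 := by
      rw [← norm_le_zero_iff]
      by_contra! h
      have : 0 < k ^ 2 * ‖φ₀‖ := by positivity
      exact absurd hb (not_le.2 this)
    rw [hφ0] at hφ₀
    obtain ⟨e1, e2, -⟩ := hφ₀.unique (represents_zero P)
    exact hne ⟨e1 mem_zero, e2 mem_zero⟩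
  refine ⟨Φ + ((comp₂ ψ - comp₂ (freeShift P k Φ)) / comp₂ (freeShift P k Φ₀)) • Φ₀, ?_⟩
  rw [map_add, map_smul]
  set κ := (comp₂ ψ - comp₂ (freeShift P k Φ)) / comp₂ (freeShift P k Φ₀) with hκ
  apply ext_H
  · filter_upwards [h1, h3, comp₁_add (freeShift P k Φ) (κ • freeShift P k Φ₀),
      comp₁_smul κ (freeShift P k Φ₀)] with z e1 e2 e3 e4
    rw [e3, Pi.add_apply, e4, Pi.smul_apply, e1, e2, he, he₀, smul_zero, add_zero]
  · rw [comp₂_add, comp₂_smul, hκ, div_mul_cancel₀ _ hc]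
    ring

theorem one_add_opA_surjective (hP : P.PositivityConditions) (ψ : H P) :
    ∃ φ : DA P, incl P φ + mapA P φ = ψ := by
  obtain ⟨C, hC⟩ := isCompact_Icc.exists_bound_of_continuousOn (continuousOn_q (P := P))
  have hC0 : 0 ≤ C := (norm_nonneg _).trans (hC 0 mem_zero)
  -- With `k² = 1 + C` and `0 ≤ q ≤ C`, `1 + A` is `freeShift` minus multiplication by `C - q` on
  -- the bulk and by `C` on the boundary. This perturbation has norm at most `C < k²`.
  set k := √(1 + C) with hk
  have hk2 : k ^ 2 = 1 + C := Real.sq_sqrt (by linarith)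
  have hkpos : 0 < k := Real.sqrt_pos.2 (by linarith)
  have hw : ContinuousOn (fun z => C - P.q z) (Icc 0 P.ℓ) := continuousOn_const.sub continuousOn_q
  have hB : ‖mulOp hw C‖ < k ^ 2 := by
    refine (norm_mulOp_le hw hC0 (fun z hz => ?_) (abs_of_nonneg hC0).le).trans_lt (by linarith)
    have h1 := hC z hz
    have h2 : 0 ≤ P.q z := hP.potential_nonneg z hz
    rw [Real.norm_of_nonneg h2] at h1
    rw [abs_of_nonneg (by linarith)]
    linarith
  obtain ⟨φ, hφ⟩ := surjective_sub_of_norm_lt (by positivity)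
    (freeShift_bounded_below hP k) (freeShift_surjective hP hkpos.ne') hB ψ
  refine ⟨φ, ?_⟩
  rw [← hφ, freeShift_apply]
  change _ = _ - mulOp hw C (incl P φ)
  have hk2' : (k : ℂ) ^ 2 = 1 + C := by exact_mod_cast hk2
  rw [hk2']
  have : mulOp hw C (incl P φ) = (C : ℂ) • incl P φ - mulOp (P := P) continuousOn_q 0 (incl P φ) := by
    apply ext_H
    · filter_upwards [comp₁_mulOp hw C (incl P φ), comp₁_smul (C : ℂ) (incl P φ),
        comp₁_sub ((C : ℂ) • incl P φ) (mulOp (P := P) continuousOn_q 0 (incl P φ)),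
        comp₁_mulOp (P := P) continuousOn_q 0 (incl P φ)] with z h1 h2 h3 h4
      rw [h3, Pi.sub_apply, h2, h1, h4, Pi.smul_apply, smul_eq_mul]
      push_cast
      ring
    · rw [comp₂_sub, comp₂_smul, comp₂_mulOp, comp₂_mulOp]
      simp
  rw [this]
  module

theorem opA_pos (hP : P.PositivityConditions) (φ : (opA P).domain) :
    0 ≤ (inner ℂ (φ : H P) (opA P φ)).re := re_inner_mapA_nonneg hP φ

theorem opA_symm (φ χ : (opA P).domain) :
    inner ℂ (opA P φ) (χ : H P) = inner ℂ (φ : H P) (opA P χ) := inner_mapA_symm (P := P) φ χ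

variable (P) in
/-- `(1 + A)⁻¹`. -/
def resolvent : H P →L[ℂ] H P := shiftInverse (opA P)

theorem isShiftInverse_resolvent (hP : P.PositivityConditions) :
    IsShiftInverse (opA P) (resolvent P) :=
  isShiftInverse_shiftInverse (exists_isShiftInverse (opA_pos hP) (one_add_opA_surjective hP))

end Surjectivity

/-! ### Green's operators of `∂_t² + T` as convolutions -/

section GreenKernel

variable {K : Type*} [NormedAddCommGroup K] [InnerProductSpace ℂ K]

/-- The convolution `∫ k(τ) F(t - τ) dτ`. -/
def greenConv (k : ℝ → K →L[ℂ] K) (F : ℝ → K) (t : ℝ) : K := ∫ τ, k τ (F (t - τ))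

/-- `k` is the kernel of a Green's operator of `∂_t² + T`, for `R = (1 + T)⁻¹`. -/
structure IsGreenKernel (R : K →L[ℂ] K) (k : ℝ → K →L[ℂ] K) : Prop where
  locallyIntegrable : LocallyIntegrable k
  commute : ∀ τ x, R (k τ x) = k τ (R x)
  integral_eq : ∀ w : ℝ → K, ContDiff ℝ 2 w → HasCompactSupport w →
    ∫ τ, k τ (R (deriv (deriv w) τ) + w τ - R (w τ)) = R (w 0)

/-- Evaluation of operators as a real bilinear map. -/
def evalBilin (K : Type*) [NormedAddCommGroup K] [InnerProductSpace ℂ K] :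
    (K →L[ℂ] K) →L[ℝ] K →L[ℝ] K :=
  (ContinuousLinearMap.id ℂ (K →L[ℂ] K)).bilinearRestrictScalars ℝ

variable {R : K →L[ℂ] K} {k : ℝ → K →L[ℂ] K}

theorem integrable_greenConv (hk : LocallyIntegrable k) {F : ℝ → K} (hF : Continuous F)
    (hc : HasCompactSupport F) (t : ℝ) : Integrable fun τ => k τ (F (t - τ)) :=
  hc.convolutionExists_right (evalBilin K) hk hF t

theorem contDiff_greenConv (hk : LocallyIntegrable k) {F : ℝ → K} (hF : ContDiff ℝ 2 F)
    (hc : HasCompactSupport F) : ContDiff ℝ 2 (greenConv k F) :=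
  hc.contDiff_convolution_right (n := 2) (evalBilin K) hk hF

theorem deriv_greenConv (hk : LocallyIntegrable k) {F : ℝ → K} (hF : ContDiff ℝ 1 F)
    (hc : HasCompactSupport F) : deriv (greenConv k F) = greenConv k (deriv F) :=
  funext fun t => (hc.hasDerivAt_convolution_right (evalBilin K) hk hF t).deriv

theorem contDiff_one_deriv {F : ℝ → K} (hF : ContDiff ℝ 2 F) : ContDiff ℝ 1 (deriv F) :=
  (contDiff_succ_iff_deriv (n := 1).1 hF).2.2

theorem deriv_clm_comp (R : K →L[ℂ] K) {F : ℝ → K} (hF : Differentiable ℝ F) :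
    deriv (fun s => R (F s)) = fun s => R (deriv F s) :=
  funext fun s => ((R.restrictScalars ℝ).hasFDerivAt.comp_hasDerivAt s (hF s).hasDerivAt).deriv

theorem IsGreenKernel.clm_greenConv [CompleteSpace K] (hk : IsGreenKernel R k) {F : ℝ → K} (hF : Continuous F)
    (hc : HasCompactSupport F) (t : ℝ) : R (greenConv k F t) = greenConv k (fun s => R (F s)) t := by
  rw [greenConv, ← R.integral_comp_comm (integrable_greenConv hk.locallyIntegrable hF hc t)]
  simp only [hk.commute, greenConv]

/-- Apply the defining identity to the reflected translate `τ ↦ F (t - τ)`; its second derivative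
carries two cancelling signs. -/
theorem IsGreenKernel.greenConv_eq (hk : IsGreenKernel R k) {F : ℝ → K} (hF : ContDiff ℝ 2 F)
    (hc : HasCompactSupport F) (t : ℝ) :
    greenConv k (fun s => R (deriv (deriv F) s) + F s - R (F s)) t = R (F t) := by
  have h := hk.integral_eq (fun τ => F (t - τ)) (hF.comp (contDiff_const.sub contDiff_id))
    (hc.comp_homeomorph (Homeomorph.subLeft t))
  have h1 : deriv (fun τ => F (t - τ)) = fun τ => -deriv F (t - τ) :=
    funext fun τ => deriv_comp_const_sub _ _ _
  have h2 : deriv (fun τ => -deriv F (t - τ)) = fun τ => deriv (deriv F) (t - τ) := by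
    funext τ
    rw [deriv.fun_neg, deriv_comp_const_sub, neg_neg]
  rw [h1, h2, sub_zero] at h
  exact h

variable [CompleteSpace K]

/-- The primitive is `S R w' - C w`: the two terms `C w'` cancel upon differentiation. Its value at
`0` comes from `S(0) = 0` and `C(0) = R`. -/
theorem isGreenKernel_aux (hsa : IsSelfAdjoint R) (hsp : spectrum ℝ R ⊆ Icc 0 1) {w : ℝ → K}
    (hw : ContDiff ℝ 2 w) (hc : HasCompactSupport w) :
    ∃ Φ : ℝ → K, ContDiff ℝ 1 Φ ∧ HasCompactSupport Φ ∧ Φ 0 = -R (w 0) ∧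
      ∀ τ, deriv Φ τ = sinOp R τ (R (deriv (deriv w) τ) + w τ - R (w τ)) := by
  have hw1 := contDiff_one_deriv hw
  have hd1 : ∀ τ, HasDerivAt w (deriv w τ) τ := fun τ =>
    (hw.differentiable two_ne_zero τ).hasDerivAt
  have hd2 : ∀ τ, HasDerivAt (deriv w) (deriv (deriv w) τ) τ := fun τ =>
    (hw1.differentiable one_ne_zero τ).hasDerivAt
  have hev : ∀ {A : ℝ → K →L[ℂ] K} {A' : K →L[ℂ] K} {x : ℝ → K} {x' : K} {τ : ℝ},
      HasDerivAt A A' τ → HasDerivAt x x' τ →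
        HasDerivAt (fun τ => A τ (x τ)) (A' (x τ) + A τ x') τ := by
    intro A A' x x' τ hA hx
    have h := (evalBilin K).hasFDerivAt_of_bilinear hA.hasFDerivAt hx.hasFDerivAt
    refine h.hasDerivAt.congr_deriv ?_
    simp [evalBilin, add_comm]
  have hΦ : ∀ τ, HasDerivAt (fun τ => (sinOp R τ * R) (deriv w τ) - cosOp R τ (w τ))
      (sinOp R τ (R (deriv (deriv w) τ) + w τ - R (w τ))) τ := fun τ => by
    refine ((hev (hasDerivAt_sinOp_mul hsa hsp τ) (hd2 τ)).sub
      (hev (hasDerivAt_cosOp hsa hsp τ) (hd1 τ))).congr_deriv ?_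
    change cosOp R τ (deriv w τ) + sinOp R τ (R (deriv (deriv w) τ))
      - (sinOp R τ (R (w τ)) - sinOp R τ (w τ) + cosOp R τ (deriv w τ)) = _
    rw [map_sub, map_add]
    abel
  refine ⟨fun τ => (sinOp R τ * R) (deriv w τ) - cosOp R τ (w τ), ?_, ?_, ?_, fun τ => (hΦ τ).deriv⟩
  · rw [contDiff_one_iff_deriv]
    refine ⟨fun τ => (hΦ τ).differentiableAt, ?_⟩
    rw [funext fun τ => (hΦ τ).deriv]
    have hw2 : Continuous (deriv (deriv w)) := hw1.continuous_deriv le_rfl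
    exact (continuous_sinOp hsp).clm_apply
      (((R.continuous.comp hw2).add hw.continuous).sub (R.continuous.comp hw.continuous))
  · refine HasCompactSupport.sub ?_ ?_
    · exact hc.deriv.mono' ((Function.support_subset_iff'.2 fun τ hτ => by
        simp [Function.notMem_support.1 hτ]).trans subset_closure)
    · exact hc.mono' ((Function.support_subset_iff'.2 fun τ hτ => by
        simp [Function.notMem_support.1 hτ]).trans subset_closure)
  · simp only [sinOp_zero, cosOp_zero hsa, zero_mul, zero_apply, zero_sub]

theorem isGreenKernel_advanced (hsa : IsSelfAdjoint R) (hsp : spectrum ℝ R ⊆ Icc 0 1) :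
    IsGreenKernel R ((Ioi 0).indicator (sinOp R)) where
  locallyIntegrable := (continuous_sinOp hsp).locallyIntegrable.indicator measurableSet_Ioi
  commute τ x := by
    by_cases h : τ ∈ Ioi (0 : ℝ)
    · rw [indicator_of_mem h]
      exact congrArg (fun A => A x) (commute_sinOp hsa τ).eq.symm
    · rw [indicator_of_notMem h]
      simp
  integral_eq w hw hc := by
    obtain ⟨Φ, h1, h2, h3, h4⟩ := isGreenKernel_aux hsa hsp hw hc
    have h5 := h2.integral_Ioi_deriv_eq h1 0
    rw [h3, neg_neg, ← integral_indicator measurableSet_Ioi] at h5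
    rw [← h5]
    refine integral_congr_ae (Filter.Eventually.of_forall fun τ => ?_)
    by_cases h : τ ∈ Ioi (0 : ℝ)
    · simp only [indicator_of_mem h, h4]
    · simp only [indicator_of_notMem h, zero_apply]

/-- On the negative half-line the fundamental theorem gives `Φ 0` instead of `-Φ 0`, which the sign
in the kernel compensates. -/
theorem isGreenKernel_retarded (hsa : IsSelfAdjoint R) (hsp : spectrum ℝ R ⊆ Icc 0 1) :
    IsGreenKernel R ((Iio 0).indicator (fun τ => -sinOp R τ)) where
  locallyIntegrable := (continuous_sinOp hsp).neg.locallyIntegrable.indicator measurableSet_Iio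
  commute τ x := by
    by_cases h : τ ∈ Iio (0 : ℝ)
    · rw [indicator_of_mem h, neg_apply, neg_apply, map_neg]
      exact congrArg (fun A => -A x) (commute_sinOp hsa τ).eq.symm
    · rw [indicator_of_notMem h]
      simp
  integral_eq w hw hc := by
    obtain ⟨Φ, h1, h2, h3, h4⟩ := isGreenKernel_aux hsa hsp hw hc
    have h5 := h2.integral_Iic_deriv_eq h1 0
    rw [h3, integral_Iic_eq_integral_Iio, ← integral_indicator measurableSet_Iio] at h5
    rw [← neg_eq_iff_eq_neg.2 h5, ← integral_neg]
    refine integral_congr_ae (Filter.Eventually.of_forall fun τ => ?_)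
    by_cases h : τ ∈ Iio (0 : ℝ)
    · simp only [indicator_of_mem h, h4, neg_apply]
    · simp only [indicator_of_notMem h, zero_apply, neg_zero]

end GreenKernel

/-! ### The Green's operators of `Q_A` -/

section GreenOperators

theorem contDiff_sinOp_mul {K E : Type*} [NormedAddCommGroup K] [InnerProductSpace ℂ K]
    [CompleteSpace K] [NormedAddCommGroup E] [NormedSpace ℂ E] {R : K →L[ℂ] K}
    (hsa : IsSelfAdjoint R) (hsp : spectrum ℝ R ⊆ Icc 0 1) (B : E →L[ℂ] K) :
    ContDiff ℝ 2 fun t => (sinOp R t * R).comp B := by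
  have h1 : ContDiff ℝ 2 fun t => sinOp R t * R := by
    rw [show (2 : WithTop ℕ∞) = 1 + 1 from rfl, contDiff_succ_iff_deriv]
    refine ⟨fun t => (hasDerivAt_sinOp_mul hsa hsp t).differentiableAt, by simp, ?_⟩
    rw [funext fun t => (hasDerivAt_sinOp_mul hsa hsp t).deriv, contDiff_one_iff_deriv]
    refine ⟨fun t => (hasDerivAt_cosOp hsa hsp t).differentiableAt, ?_⟩
    rw [funext fun t => (hasDerivAt_cosOp hsa hsp t).deriv]
    exact ((continuous_sinOp hsp).mul continuous_const).sub (continuous_sinOp hsp)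
  exact (((ContinuousLinearMap.compL ℂ E K K).flip B).restrictScalars ℝ).contDiff.comp h1

variable {P : System}

theorem resolvent_isSelfAdjoint (hP : P.PositivityConditions) : IsSelfAdjoint (resolvent P) :=
  (isShiftInverse_resolvent hP).isSelfAdjoint opA_symm

theorem resolvent_spectrum (hP : P.PositivityConditions) :
    spectrum ℝ (resolvent P) ⊆ Icc 0 1 :=
  (isShiftInverse_resolvent hP).spectrum_subset opA_symm (opA_pos hP)

/-- Definitional, because `sinFun t` unfolds to the very function of `r` used in `funCalc`. -/
theorem kernelE_eq (t : ℝ) : kernelE P t = -sinOp (resolvent P) t := rfl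

variable (P) in
/-- `A` as a bounded operator from `D(A)` with the graph norm to `H`. -/
def mapAL : DA P →L[ℂ] H P :=
  (mapA P).mkContinuous 1 fun φ => by
    rw [norm_DA, one_mul]
    exact le_add_of_nonneg_left (norm_nonneg _)

variable (P) in
/-- `1 + A` as a bounded operator from `D(A)` with the graph norm to `H`. -/
def shiftL : DA P →L[ℂ] H P := incl P + mapAL P

theorem shiftL_apply (φ : DA P) : shiftL P φ = incl P φ + mapA P φ := rfl

/-- `(1 + A)⁻¹` as a bounded operator from `H` to `D(A)` with the graph norm. -/
def resolventDA (hP : P.PositivityConditions) : H P →L[ℂ] DA P :=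
  LinearMap.mkContinuousOfExistsBound
    ((resolvent P).toLinearMap.codRestrict (opA P).domain (isShiftInverse_resolvent hP).mem :
      H P →ₗ[ℂ] DA P) (by
    -- The second summand bounds `A R ψ = ψ - R ψ`.
    refine ⟨‖resolvent P‖ + (1 + ‖resolvent P‖), fun ψ => ?_⟩
    rw [norm_DA, add_mul]
    have h1 := (resolvent P).le_opNorm ψ
    refine add_le_add h1 ?_
    have h2 : resolvent P ψ + mapA P ((resolvent P).toLinearMap.codRestrict (opA P).domain
      (isShiftInverse_resolvent hP).mem ψ) = ψ := (isShiftInverse_resolvent hP).right_inv ψ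
    refine (congrArg norm (eq_sub_of_add_eq' h2)).trans_le ?_
    rw [add_mul, one_mul]
    exact (norm_sub_le _ _).trans (by gcongr))

theorem incl_resolventDA (hP : P.PositivityConditions) (ψ : H P) :
    incl P (resolventDA hP ψ) = resolvent P ψ := rfl

theorem mapA_resolventDA (hP : P.PositivityConditions) (ψ : H P) :
    mapA P (resolventDA hP ψ) = ψ - resolvent P ψ :=
  eq_sub_of_add_eq' ((isShiftInverse_resolvent hP).right_inv ψ)

theorem incl_injective : Function.Injective (incl P) := Subtype.val_injective

theorem resolvent_shiftL (hP : P.PositivityConditions) (φ : DA P) :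
    resolvent P (shiftL P φ) = incl P φ := (isShiftInverse_resolvent hP).left_inv φ

theorem mapA_eq (hP : P.PositivityConditions) (φ : DA P) :
    mapA P φ = shiftL P φ - resolvent P (shiftL P φ) := by
  rw [resolvent_shiftL hP, shiftL_apply, add_sub_cancel_left]

/-- Passing to `F = (1 + A) f` removes the unbounded operator: `f = R F` and `A f = F - R F`. -/
theorem QA_eq (hP : P.PositivityConditions) {f : ℝ → DA P} (hf : ContDiff ℝ 2 f) (t : ℝ) :
    QA f t = resolvent P (deriv (deriv fun s => shiftL P (f s)) t) + shiftL P (f t)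
      - resolvent P (shiftL P (f t)) := by
  have hF : ContDiff ℝ 2 fun s => shiftL P (f s) :=
    ((shiftL P).restrictScalars ℝ).contDiff.comp hf
  have h1 : (fun s => incl P (f s)) = fun s => resolvent P (shiftL P (f s)) :=
    funext fun s => (resolvent_shiftL hP (f s)).symm
  rw [QA, iteratedDeriv_succ, iteratedDeriv_one, h1,
    deriv_clm_comp _ (hF.differentiable two_ne_zero),
    deriv_clm_comp _ ((contDiff_one_deriv hF).differentiable one_ne_zero), mapA_eq hP, add_sub_assoc]

/-- On `D(A)` the inclusion factors as `R (1 + A)`, so `E(t)` becomes `-S(t) R (1 + A)`, and `S R`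
is twice differentiable in norm. -/
theorem contDiff_kernelE (hP : P.PositivityConditions) :
    ContDiff ℝ 2 fun t => (kernelE P t).comp (incl P) := by
  have h := contDiff_sinOp_mul (resolvent_isSelfAdjoint hP) (resolvent_spectrum hP) (-shiftL P)
  have h2 : (fun t => (kernelE P t).comp (incl P)) = fun t =>
      (sinOp (resolvent P) t * resolvent P).comp (-shiftL P) := by
    funext t
    ext1 φ
    change -(sinOp (resolvent P) t (incl P φ))
      = sinOp (resolvent P) t (resolvent P (-(shiftL P φ)))
    rw [map_neg, map_neg, resolvent_shiftL hP]
  rw [h2]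
  exact h

/-- `G` is convolution with the kernel `k`, written as `θ E`. -/
structure IsConv (G : (ℝ → H P) → ℝ → H P) (θ : ℝ → ℝ) (k : ℝ → H P →L[ℂ] H P) : Prop where
  smul_apply : ∀ t φ, θ t • kernelE P t φ = k t φ
  eq_integral : ∀ f : ℝ → H P, ∀ t, G f t = ∫ t', θ (t - t') • kernelE P (t - t') (f t')

variable {G : (ℝ → H P) → ℝ → H P} {θ : ℝ → ℝ} {k : ℝ → H P →L[ℂ] H P}

theorem IsConv.eq_greenConv (h : IsConv G θ k) (f : ℝ → H P) (t : ℝ) :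
    G f t = greenConv k f t := by
  rw [h.eq_integral, greenConv, ← integral_sub_left_eq_self (fun τ => k τ (f (t - τ))) volume t]
  refine integral_congr_ae (Filter.Eventually.of_forall fun s => ?_)
  simp only [h.smul_apply, sub_sub_cancel]

theorem IsConv.isIntegralOperator (hP : P.PositivityConditions) (h : IsConv G θ k)
    (hk : IsGreenKernel (resolvent P) k) : IsIntegralOperator G θ (kernelE P) where
  continuous := (continuous_sinOp (resolvent_spectrum hP)).neg
  contDiff := contDiff_kernelE hP
  integrable f hf hc t := by
    have h1 := (integrable_greenConv hk.locallyIntegrable hf hc t).comp_sub_left t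
    refine h1.congr (Filter.Eventually.of_forall fun s => ?_)
    simp only [h.smul_apply, sub_sub_cancel]
  eq_integral f _ _ t := h.eq_integral f t
  maps f hf hc := by
    have hF : ContDiff ℝ 2 fun s => shiftL P (f s) :=
      ((shiftL P).restrictScalars ℝ).contDiff.comp hf
    have hFc : HasCompactSupport fun s => shiftL P (f s) := hc.comp_left (map_zero _)
    -- Formally `G f = R G (1 + A) f`; applying `R` last, as a map into the graph space, gives `C²`
    -- regularity in the graph norm.
    refine ⟨fun t => resolventDA hP (greenConv k (fun s => shiftL P (f s)) t), ?_, fun t => ?_⟩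
    · exact ((resolventDA hP).restrictScalars ℝ).contDiff.comp
        (contDiff_greenConv hk.locallyIntegrable hF hFc)
    · rw [incl_resolventDA, hk.clm_greenConv hF.continuous hFc, h.eq_greenConv]
      simp only [resolvent_shiftL hP]

theorem IsConv.left_inv (hP : P.PositivityConditions) (h : IsConv G θ k)
    (hk : IsGreenKernel (resolvent P) k) {f : ℝ → DA P} (hf : ContDiff ℝ 2 f)
    (hc : HasCompactSupport f) (t : ℝ) : G (QA f) t = incl P (f t) := by
  have hF : ContDiff ℝ 2 fun s => shiftL P (f s) :=
    ((shiftL P).restrictScalars ℝ).contDiff.comp hf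
  have hFc : HasCompactSupport fun s => shiftL P (f s) := hc.comp_left (map_zero _)
  rw [h.eq_greenConv, funext fun s => QA_eq hP hf s, hk.greenConv_eq hF hFc, resolvent_shiftL hP]

/-- Here `(1 + A) g` is the convolution of the kernel with `F = (1 + A) f`. Time derivatives and `R`
pass to `F`, which reduces the claim to `greenConv_eq`. -/
theorem IsConv.right_inv (hP : P.PositivityConditions) (h : IsConv G θ k)
    (hk : IsGreenKernel (resolvent P) k) {f g : ℝ → DA P} (hf : ContDiff ℝ 2 f)
    (hc : HasCompactSupport f) (hg : ContDiff ℝ 2 g)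
    (hgf : ∀ t, incl P (g t) = G (fun s => incl P (f s)) t) (t : ℝ) : QA g t = incl P (f t) := by
  have hF : ContDiff ℝ 2 fun s => shiftL P (f s) :=
    ((shiftL P).restrictScalars ℝ).contDiff.comp hf
  have hFc : HasCompactSupport fun s => shiftL P (f s) := hc.comp_left (map_zero _)
  have hF1 := contDiff_one_deriv hF
  have hF2 : Continuous (deriv (deriv fun s => shiftL P (f s))) := hF1.continuous_deriv le_rfl
  have hg' : ∀ t, shiftL P (g t) = greenConv k (fun s => shiftL P (f s)) t := fun t => by
    have h1 : g t = resolventDA hP (greenConv k (fun s => shiftL P (f s)) t) := by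
      apply incl_injective
      rw [incl_resolventDA, hk.clm_greenConv hF.continuous hFc, hgf, h.eq_greenConv]
      simp only [resolvent_shiftL hP]
    rw [h1, shiftL_apply, mapA_resolventDA, incl_resolventDA, add_sub_cancel]
  rw [QA_eq hP hg, funext hg', hg', deriv_greenConv hk.locallyIntegrable (hF.of_le one_le_two) hFc,
    deriv_greenConv hk.locallyIntegrable hF1 hFc.deriv, hk.clm_greenConv hF2 hFc.deriv.deriv,
    hk.clm_greenConv hF.continuous hFc, ← resolvent_shiftL hP (f t),
    ← hk.greenConv_eq hF hFc t]
  have i1 := integrable_greenConv hk.locallyIntegrable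
    ((resolvent P).continuous.comp hF2) (hFc.deriv.deriv.comp_left (map_zero _)) t
  have i2 := integrable_greenConv hk.locallyIntegrable hF.continuous hFc t
  have i3 := integrable_greenConv hk.locallyIntegrable
    ((resolvent P).continuous.comp hF.continuous) (hFc.comp_left (map_zero _)) t
  simp only [greenConv, map_add, map_sub]
  rw [integral_sub, integral_add]
  · exact i1
  · exact i2
  · exact i1.add i2
  · exact i3

theorem isConv_opAdv : IsConv (opAdv P) (-(Ioi 0).indicator 1)
    ((Ioi 0).indicator (sinOp (resolvent P))) where
  smul_apply t φ := by
    by_cases h : t ∈ Ioi (0 : ℝ)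
    · rw [Pi.neg_apply, indicator_of_mem h, indicator_of_mem h, kernelE_eq, Pi.one_apply, neg_apply,
        smul_neg, neg_smul, one_smul, neg_neg]
    · rw [Pi.neg_apply, indicator_of_notMem h, indicator_of_notMem h, zero_apply, neg_zero, zero_smul]
  eq_integral f t := by
    rw [opAdv, ← integral_indicator measurableSet_Iio, ← integral_neg]
    refine integral_congr_ae (Filter.Eventually.of_forall fun s => ?_)
    by_cases h : s < t
    · have h1 : t - s ∈ Ioi (0 : ℝ) := sub_pos.2 h
      simp [h]
    · simp [h]

theorem isConv_opRet : IsConv (opRet P) ((Iio 0).indicator 1)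
    ((Iio 0).indicator (fun τ => -sinOp (resolvent P) τ)) where
  smul_apply t φ := by
    by_cases h : t ∈ Iio (0 : ℝ)
    · rw [indicator_of_mem h, indicator_of_mem h, kernelE_eq, Pi.one_apply, one_smul]
    · rw [indicator_of_notMem h, indicator_of_notMem h, zero_apply, zero_smul]
  eq_integral f t := by
    rw [opRet, ← integral_indicator measurableSet_Ioi]
    refine integral_congr_ae (Filter.Eventually.of_forall fun s => ?_)
    by_cases h : t < s
    · simp [h]
    · simp [h]

end GreenOperators

/-! ### The local energy -/

section LocalEnergy

variable {P : System}

theorem re_inner_mulOp_le {w₁ w₂ : ℝ → ℝ} (hw₁ : ContinuousOn w₁ (Icc 0 P.ℓ))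
    (hw₂ : ContinuousOn w₂ (Icc 0 P.ℓ)) {c₁ c₂ a b : ℝ}
    (h : ∀ z ∈ Icc 0 P.ℓ, a * w₁ z ≤ b * w₂ z) (hc : a * c₁ ≤ b * c₂) (φ : H P) :
    a * (inner ℂ φ (mulOp hw₁ c₁ φ)).re ≤ b * (inner ℂ φ (mulOp hw₂ c₂ φ)).re := by
  rw [re_inner_mulOp_self, re_inner_mulOp_self, mul_add, mul_add, ← integral_const_mul,
    ← integral_const_mul]
  refine add_le_add ?_ ?_
  · refine setIntegral_mono_on ?_ ?_ measurableSet_Ioo fun z hz => ?_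
    · exact (integrable_mul_norm_sq hw₁ (memLp_comp₁ φ)).const_mul a
    · exact (integrable_mul_norm_sq hw₂ (memLp_comp₁ φ)).const_mul b
    · rw [← mul_assoc, ← mul_assoc]
      exact mul_le_mul_of_nonneg_right (h z (Ioo_subset_Icc_self hz)) (sq_nonneg _)
  · rw [mul_left_comm, mul_left_comm b, ← mul_assoc a, ← mul_assoc b]
    exact mul_le_mul_of_nonneg_left (mul_le_mul_of_nonneg_right hc (sq_nonneg _))
      (inv_nonneg.2 P.ρ_pos.le)

theorem re_inner_mulOp_nonneg {w : ℝ → ℝ} (hw : ContinuousOn w (Icc 0 P.ℓ))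
    (hpos : ∀ z ∈ Icc 0 P.ℓ, 0 ≤ w z) (φ : H P) :
    0 ≤ (inner ℂ φ (mulOp hw (w P.ℓ) φ)).re := by
  have := re_inner_mulOp_le hw hw (c₁ := w P.ℓ) (c₂ := w P.ℓ) (a := 0) (b := 1)
    (by simpa using hpos) (by simpa using hpos _ mem_end) φ
  simpa using this

theorem re_inner_mulOp_comm {w : ℝ → ℝ} (hw : ContinuousOn w (Icc 0 P.ℓ)) (c : ℝ) (φ χ : H P) :
    (inner ℂ φ (mulOp hw c χ)).re = (inner ℂ χ (mulOp hw c φ)).re := by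
  rw [← inner_conj_symm, Complex.conj_re, inner_mulOp_left]

theorem re_inner_mulOp_add {w : ℝ → ℝ} (hw : ContinuousOn w (Icc 0 P.ℓ)) (c : ℝ) (φ χ : H P) :
    (inner ℂ (φ + χ) (mulOp hw c (φ + χ))).re = (inner ℂ φ (mulOp hw c φ)).re
      + 2 * (inner ℂ φ (mulOp hw c χ)).re + (inner ℂ χ (mulOp hw c χ)).re := by
  rw [map_add, inner_add_left, inner_add_right, inner_add_right, Complex.add_re, Complex.add_re,
    Complex.add_re, re_inner_mulOp_comm hw c χ φ]
  ring

theorem re_inner_mulOp_sub {w : ℝ → ℝ} (hw : ContinuousOn w (Icc 0 P.ℓ)) (c : ℝ) (φ χ : H P) :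
    (inner ℂ (φ - χ) (mulOp hw c (φ - χ))).re = (inner ℂ φ (mulOp hw c φ)).re
      - 2 * (inner ℂ φ (mulOp hw c χ)).re + (inner ℂ χ (mulOp hw c χ)).re := by
  rw [map_sub, inner_sub_left, inner_sub_right, inner_sub_right, Complex.sub_re, Complex.sub_re,
    Complex.sub_re, re_inner_mulOp_comm hw c χ φ]
  ring

theorem two_mul_re_inner_mulOp_le {w : ℝ → ℝ} (hw : ContinuousOn w (Icc 0 P.ℓ))
    (hpos : ∀ z ∈ Icc 0 P.ℓ, 0 ≤ w z) (φ χ : H P) :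
    2 * (inner ℂ φ (mulOp hw (w P.ℓ) χ)).re ≤ (inner ℂ φ (mulOp hw (w P.ℓ) φ)).re
      + (inner ℂ χ (mulOp hw (w P.ℓ) χ)).re := by
  have h := re_inner_mulOp_nonneg hw hpos (φ - χ)
  rw [re_inner_mulOp_sub] at h
  linarith

/-- Polarization: use `-w' ≤ κ w` on `φ + χ` and `w' ≤ κ w` on `φ - χ`, then add. The constant loses
nothing, so the propagation speed comes out as exactly one. -/
theorem neg_two_mul_re_inner_mulOp_le {w w' : ℝ → ℝ} (hw : ContinuousOn w (Icc 0 P.ℓ))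
    (hw' : ContinuousOn w' (Icc 0 P.ℓ)) (hpos : ∀ z ∈ Icc 0 P.ℓ, 0 ≤ w z) {κ : ℝ} (hκ : 0 ≤ κ)
    (hd : ∀ z ∈ Icc 0 P.ℓ, |w' z| ≤ κ * w z) (φ χ : H P) :
    -(2 * (inner ℂ φ (mulOp hw' 0 χ)).re) ≤ κ * ((inner ℂ φ (mulOp hw (w P.ℓ) φ)).re
      + (inner ℂ χ (mulOp hw (w P.ℓ) χ)).re) := by
  have hend : 0 ≤ κ * w P.ℓ := mul_nonneg hκ (hpos _ mem_end)
  have h1 := re_inner_mulOp_le hw' hw (c₁ := 0) (c₂ := w P.ℓ) (a := -1) (b := κ)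
    (fun z hz => by linarith [neg_le_abs (w' z), hd z hz]) (by linarith) (φ + χ)
  have h2 := re_inner_mulOp_le hw' hw (c₁ := 0) (c₂ := w P.ℓ) (a := 1) (b := κ)
    (fun z hz => by linarith [le_abs_self (w' z), hd z hz]) (by linarith) (φ - χ)
  rw [re_inner_mulOp_add, re_inner_mulOp_add] at h1
  rw [re_inner_mulOp_sub, re_inner_mulOp_sub] at h2
  linarith

/-- The derivative `φ ↦ (∂_z φ₁, 0)` as a bounded operator `D(A) → H`. -/
def derivL (hP : P.PositivityConditions) : DA P →L[ℂ] H P :=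
  (derivLin P).mkContinuous 1 fun φ => by
    rw [one_mul]
    exact norm_derivLin_le hP φ

/-- The operator `φ ↦ -∂_z (w ∂_z φ) + w q φ` with the corresponding boundary part. -/
def weightedOp (hP : P.PositivityConditions) {w : ℝ → ℝ} (hw : ContDiff ℝ 1 w) : DA P →L[ℂ] H P :=
  (mulOp (P := P) hw.continuous.continuousOn (w P.ℓ)).comp (mapAL P)
    - (mulOp (P := P) (hw.continuous_deriv le_rfl).continuousOn 0).comp (derivL hP)

theorem inner_weightedOp (hP : P.PositivityConditions) {w : ℝ → ℝ} (hw : ContDiff ℝ 1 w)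
    (χ φ : DA P) : inner ℂ (incl P χ) (weightedOp hP hw φ) = energyForm (P := P) w χ φ :=
  inner_mulOp_mapA_sub hw hw.continuous.continuousOn
    (hw.continuous_deriv le_rfl).continuousOn χ φ

theorem re_inner_weightedOp_symm (hP : P.PositivityConditions) {w : ℝ → ℝ} (hw : ContDiff ℝ 1 w)
    (χ φ : DA P) : (inner ℂ (incl P χ) (weightedOp hP hw φ)).re
      = (inner ℂ (incl P φ) (weightedOp hP hw χ)).re := by
  rw [inner_weightedOp, inner_weightedOp]
  have h := congrArg Complex.re (energyForm_conj (P := P) w χ φ)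
  rw [Complex.conj_re] at h
  exact h.symm

theorem re_inner_weightedOp_ge (hP : P.PositivityConditions) {w : ℝ → ℝ} (hw : ContDiff ℝ 1 w)
    (hpos : ∀ z ∈ Icc 0 P.ℓ, 0 ≤ w z) (φ : DA P) :
    (inner ℂ (derivLin P φ) (mulOp (P := P) hw.continuous.continuousOn (w P.ℓ)
      (derivLin P φ))).re ≤ (inner ℂ (incl P φ) (weightedOp hP hw φ)).re := by
  rw [inner_weightedOp]
  refine le_trans ?_ (re_energyForm_self_ge (P := P) hP hw.continuous.continuousOn hpos φ)
  rw [re_inner_mulOp_self, comp₂_derivLin, norm_zero, zero_pow two_ne_zero, mul_zero, mul_zero,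
    add_zero]
  have h1 : (∫ z in Ioo 0 P.ℓ, w z * ‖comp₁ (derivLin P φ) z‖ ^ 2)
      = ∫ z in Ioo 0 P.ℓ, w z * ‖bulk' (P := P) φ z‖ ^ 2 := by
    refine integral_congr_ae ?_
    filter_upwards [comp₁_derivLin φ] with z h
    rw [h]
  rw [h1, le_add_iff_nonneg_right]
  refine setIntegral_nonneg measurableSet_Ioo fun z hz => ?_
  have hz' := Ioo_subset_Icc_self hz
  exact mul_nonneg (mul_nonneg (hpos z hz') (hP.potential_nonneg z hz')) (sq_nonneg _)

/-- The energy with weight `w` of a field `φ` with time derivative `χ`. -/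
def localEnergy (hP : P.PositivityConditions) {w : ℝ → ℝ} (hw : ContDiff ℝ 1 w) (φ χ : DA P) : ℝ :=
  (inner ℂ (incl P χ) (mulOp (P := P) hw.continuous.continuousOn (w P.ℓ) (incl P χ))
    + inner ℂ (incl P φ) (weightedOp hP hw φ)
    + inner ℂ (incl P φ) (mulOp (P := P) hw.continuous.continuousOn (w P.ℓ) (incl P φ))).re

theorem re_inner_le_localEnergy (hP : P.PositivityConditions) {w : ℝ → ℝ} (hw : ContDiff ℝ 1 w)
    (hpos : ∀ z ∈ Icc 0 P.ℓ, 0 ≤ w z) (φ χ : DA P) :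
    (inner ℂ (incl P φ) (mulOp (P := P) hw.continuous.continuousOn (w P.ℓ) (incl P φ))).re
      ≤ localEnergy hP hw φ χ := by
  have h1 := re_inner_mulOp_nonneg hw.continuous.continuousOn hpos (incl P χ)
  have h2 := re_inner_weightedOp_ge hP hw hpos φ
  have h3 := re_inner_mulOp_nonneg hw.continuous.continuousOn hpos (derivLin P φ)
  rw [localEnergy, Complex.add_re, Complex.add_re]
  linarith

theorem hasDerivAt_incl {g : ℝ → DA P} {g' : DA P} {t : ℝ} (hg : HasDerivAt g g' t) :
    HasDerivAt (fun t => incl P (g t)) (incl P g') t :=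
  ((incl P).restrictScalars ℝ).hasFDerivAt.comp_hasDerivAt t hg

theorem incl_deriv_deriv {f g : ℝ → DA P} (hg : ContDiff ℝ 2 g)
    (hQ : ∀ t, QA g t = incl P (f t)) (t : ℝ) :
    incl P (deriv (deriv g) t) = incl P (f t) - mapA P (g t) := by
  have h1 : ∀ t, HasDerivAt g (deriv g t) t := fun t =>
    (hg.differentiable two_ne_zero t).hasDerivAt
  have h2 : HasDerivAt (deriv g) (deriv (deriv g) t) t :=
    ((contDiff_succ_iff_deriv (n := 1).1 hg).2.2.differentiable one_ne_zero t).hasDerivAt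
  rw [← hQ, QA, iteratedDeriv_succ, iteratedDeriv_one, add_sub_cancel_right,
    funext fun t => (hasDerivAt_incl (h1 t)).deriv, (hasDerivAt_incl h2).deriv]

/-- Replace the second time derivative by `f - A g`. Since `w A` minus the weighted operator is `w'
∂_z`, the principal terms cancel. What remains is `∂_t g` paired with `f`, with `w' ∂_z g` and with
`g`; these contribute `1`, `κ` and `1` to the coefficient of the weighted `‖∂_t g‖²`. -/
theorem localEnergy_deriv_le (hP : P.PositivityConditions) {w : ℝ → ℝ} (hw : ContDiff ℝ 1 w)
    (hpos : ∀ z ∈ Icc 0 P.ℓ, 0 ≤ w z) {κ : ℝ} (hκ : 0 ≤ κ)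
    (hd : ∀ z ∈ Icc 0 P.ℓ, |deriv w z| ≤ κ * w z) {f g : ℝ → DA P} (hg : ContDiff ℝ 2 g)
    (hQ : ∀ t, QA g t = incl P (f t)) (t : ℝ) :
    ∃ e', HasDerivAt (fun t => localEnergy hP hw (g t) (deriv g t)) e' t ∧
      e' ≤ (κ + 2) * localEnergy hP hw (g t) (deriv g t) + (inner ℂ (incl P (f t))
        (mulOp (P := P) hw.continuous.continuousOn (w P.ℓ) (incl P (f t)))).re := by
  have h1 : HasDerivAt g (deriv g t) t := (hg.differentiable two_ne_zero t).hasDerivAt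
  have h2 : HasDerivAt (deriv g) (deriv (deriv g) t) t :=
    ((contDiff_succ_iff_deriv (n := 1).1 hg).2.2.differentiable one_ne_zero t).hasDerivAt
  have hx := hasDerivAt_incl h1
  have hy := hasDerivAt_incl h2
  rw [incl_deriv_deriv hg hQ] at hy
  have hs : ∀ φ χ : DA P, localEnergy hP hw φ χ
      = (inner ℂ (incl P χ) (mulOp (P := P) hw.continuous.continuousOn (w P.ℓ) (incl P χ))).re
        + (inner ℂ (incl P φ) (weightedOp hP hw φ)).re
        + (inner ℂ (incl P φ) (mulOp (P := P) hw.continuous.continuousOn (w P.ℓ)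
          (incl P φ))).re := fun φ χ => by
    rw [localEnergy, Complex.add_re, Complex.add_re]
  have e1 : (inner ℂ (incl P (deriv g t)) (weightedOp hP hw (g t))).re
      = (inner ℂ (incl P (deriv g t)) (mulOp (P := P) hw.continuous.continuousOn (w P.ℓ)
        (mapA P (g t)))).re - (inner ℂ (incl P (deriv g t)) (mulOp (P := P)
        (hw.continuous_deriv le_rfl).continuousOn 0 (derivLin P (g t)))).re := by
    rw [← Complex.sub_re, ← inner_sub_right]
    rfl
  have e2 := re_inner_weightedOp_symm hP hw (g t) (deriv g t)
  have e3 := re_inner_mulOp_comm hw.continuous.continuousOn (w P.ℓ)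
    (incl P (f t) - mapA P (g t)) (incl P (deriv g t))
  have e4 := re_inner_mulOp_comm hw.continuous.continuousOn (w P.ℓ) (incl P (g t))
    (incl P (deriv g t))
  have b1 := two_mul_re_inner_mulOp_le hw.continuous.continuousOn hpos (incl P (deriv g t))
    (incl P (f t))
  have b2 := two_mul_re_inner_mulOp_le hw.continuous.continuousOn hpos (incl P (deriv g t))
    (incl P (g t))
  have b3 := neg_two_mul_re_inner_mulOp_le hw.continuous.continuousOn
    (hw.continuous_deriv le_rfl).continuousOn hpos hκ hd (incl P (deriv g t)) (derivLin P (g t))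
  have b4 := re_inner_weightedOp_ge hP hw hpos (g t)
  have b8 := re_inner_mulOp_nonneg hw.continuous.continuousOn hpos (incl P (g t))
  have b5 := mul_nonneg hκ b8
  have b6 := re_inner_mulOp_nonneg hw.continuous.continuousOn hpos (derivLin P (g t))
  have b7 := mul_le_mul_of_nonneg_left b4 hκ
  set W := mulOp (P := P) hw.continuous.continuousOn (w P.ℓ)
  have hWx : HasDerivAt (fun t => W (incl P (g t))) (W (incl P (deriv g t))) t :=
    (W.restrictScalars ℝ).hasFDerivAt.comp_hasDerivAt t hx
  have hWy : HasDerivAt (fun t => W (incl P (deriv g t))) (W (incl P (f t) - mapA P (g t))) t :=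
    (W.restrictScalars ℝ).hasFDerivAt.comp_hasDerivAt t hy
  have hB : HasDerivAt (fun t => weightedOp hP hw (g t)) (weightedOp hP hw (deriv g t)) t :=
    ((weightedOp hP hw).restrictScalars ℝ).hasFDerivAt.comp_hasDerivAt t h1
  have h3 := Complex.reCLM.hasFDerivAt.comp_hasDerivAt t
    (((hy.inner ℂ hWy).add (hx.inner ℂ hB)).add (hx.inner ℂ hWx))
  refine ⟨_, h3, ?_⟩
  rw [map_sub, inner_sub_right, Complex.sub_re] at e3
  rw [hs, Complex.reCLM_apply, Complex.add_re, Complex.add_re, Complex.add_re, Complex.add_re,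
    Complex.add_re, map_sub, inner_sub_right, Complex.sub_re]
  linarith

end LocalEnergy

/-! ### Finite propagation speed -/

section Propagation

/-- The weight `exp (-2 s √((z - z₀)² + ε²))`. -/
def expWeight (s z₀ ε z : ℝ) : ℝ := Real.exp (-(2 * s) * √((z - z₀) ^ 2 + ε ^ 2))

theorem sq_add_sq_pos {ε : ℝ} (hε : 0 < ε) (x : ℝ) : 0 < x ^ 2 + ε ^ 2 := by positivity

theorem contDiff_expWeight (s z₀ : ℝ) {ε : ℝ} (hε : 0 < ε) :
    ContDiff ℝ 1 (expWeight s z₀ ε) := by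
  unfold expWeight
  refine Real.contDiff_exp.comp (contDiff_const.mul ?_)
  refine ContDiff.sqrt ?_ fun z => (sq_add_sq_pos hε _).ne'
  fun_prop

/-- The smoothed distance `√((z - z₀)² + ε²)` has slope at most one in absolute value. -/
theorem abs_deriv_expWeight_le {s : ℝ} (hs : 0 ≤ s) (z₀ : ℝ) {ε : ℝ} (hε : 0 < ε) (z : ℝ) :
    |deriv (expWeight s z₀ ε) z| ≤ 2 * s * expWeight s z₀ ε z := by
  have hpos := sq_add_sq_pos hε (z - z₀)
  have h1 : HasDerivAt (fun z => (z - z₀) ^ 2 + ε ^ 2) (2 * (z - z₀)) z := by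
    refine ((((hasDerivAt_id z).sub_const z₀).pow 2).add_const _).congr_deriv ?_
    simp
  have h2 : HasDerivAt (expWeight s z₀ ε) _ z :=
    ((h1.sqrt hpos.ne').const_mul (-(2 * s))).exp
  have h3 : |2 * (z - z₀) / (2 * √((z - z₀) ^ 2 + ε ^ 2))| ≤ 1 := by
    rw [mul_div_mul_left _ _ two_ne_zero, abs_div, abs_of_nonneg (Real.sqrt_nonneg _),
      div_le_one (Real.sqrt_pos.2 hpos)]
    exact Real.abs_le_sqrt (by nlinarith [sq_nonneg ε])
  rw [h2.deriv, abs_mul, abs_mul, abs_neg, abs_of_nonneg (by positivity : 0 ≤ 2 * s),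
    abs_of_pos (Real.exp_pos _), mul_comm]
  exact mul_le_mul_of_nonneg_right (mul_le_of_le_one_right (by positivity) h3) (Real.exp_pos _).le

theorem expWeight_le {s : ℝ} (hs : 0 ≤ s) (z₀ ε : ℝ) {z d : ℝ} (hd : d ≤ |z - z₀|) :
    expWeight s z₀ ε z ≤ Real.exp (-(2 * s) * d) := by
  refine Real.exp_le_exp.2 (mul_le_mul_of_nonpos_left (hd.trans ?_) (by linarith))
  exact Real.abs_le_sqrt (by nlinarith [sq_nonneg ε])

theorem le_expWeight {s : ℝ} (hs : 0 ≤ s) {z₀ ε : ℝ} (hε : 0 < ε) {z : ℝ} (hz : |z - z₀| ≤ ε) :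
    Real.exp (-(2 * s) * (2 * ε)) ≤ expWeight s z₀ ε z := by
  refine Real.exp_le_exp.2 (mul_le_mul_of_nonpos_left ?_ (by linarith))
  rw [Real.sqrt_le_left (by positivity)]
  nlinarith [sq_abs (z - z₀), abs_nonneg (z - z₀)]

/-! ### Supports, light cones and the weighted estimate -/

variable {P : System}

theorem supp₁_bulk_eq_zero {f : ℝ → DA P} {t : ℝ} {z : ℝ} (hz : z ∈ Icc 0 P.ℓ)
    (h : (t, ⟨z, hz⟩) ∉ supp₁ f) : bulk (P := P) (f t) z = 0 := by
  by_contra h1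
  exact h (subset_closure h1)

/-- Away from the support of the bulk component the derivative vanishes as well. -/
theorem supp₁_bulk'_eq_zero {f : ℝ → DA P} {t : ℝ} {z : ℝ} (hz : z ∈ Icc 0 P.ℓ)
    (h : (t, ⟨z, hz⟩) ∉ supp₁ f) : bulk' (P := P) (f t) z = 0 := by
  have h1 : {x : Icc (0 : ℝ) P.ℓ | (t, x) ∉ supp₁ f} ∈ nhds (⟨z, hz⟩ : Icc (0 : ℝ) P.ℓ) :=
    (isClosed_closure.isOpen_compl.preimage (Continuous.prodMk_right t)).mem_nhds h
  rw [nhds_subtype_eq_comap] at h1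
  obtain ⟨U, hU, hUs⟩ := Filter.mem_comap.1 h1
  have h2 : HasDerivWithinAt (bulk (P := P) (f t)) 0 (Icc 0 P.ℓ) z := by
    refine (hasDerivWithinAt_const z (Icc 0 P.ℓ) (0 : ℂ)).congr_of_eventuallyEq ?_
      (supp₁_bulk_eq_zero hz h)
    filter_upwards [mem_nhdsWithin_of_mem_nhds hU, self_mem_nhdsWithin] with x hx hx'
    exact supp₁_bulk_eq_zero hx' (hUs (show (⟨x, hx'⟩ : Icc (0 : ℝ) P.ℓ) ∈ Subtype.val ⁻¹' U from hx))
  exact (uniqueDiffOn_Icc P.ℓ_pos z hz).eq_deriv _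
    ((represents_bulk (P := P) (f t)).deriv_eq z hz) h2

theorem isCompact_supp₁ {f : ℝ → DA P} (hc : HasCompactSupport f) : IsCompact (supp₁ f) := by
  refine (hc.isCompact.prod (isCompact_univ (X := Icc (0 : ℝ) P.ℓ))).of_isClosed_subset
    isClosed_closure (closure_minimal (fun p hp => ⟨?_, mem_univ _⟩)
      ((isClosed_tsupport f).prod isClosed_univ))
  refine subset_tsupport f fun h => hp ?_
  have h1 : bulk (P := P) (f p.1) p.2 = 0 := by
    rw [h]
    exact ((represents_bulk (P := P) (0 : domainA P)).unique (represents_zero P)).1 p.2.2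
  exact h1

/-- The future is the projection of a closed relation along the compact factor `O`, and such
projections are closed maps. -/
theorem isClosed_Jplus {O : Set (Spacetime P)} (hO : IsCompact O) : IsClosed (Jplus O) := by
  have : CompactSpace O := isCompact_iff_compactSpace.1 hO
  have h1 : IsClosed {x : Spacetime P × O |
      |(x.1.2 : ℝ) - (x.2 : Spacetime P).2| ≤ x.1.1 - (x.2 : Spacetime P).1} := by
    refine isClosed_le ?_ ?_ <;> fun_prop
  have h2 : Jplus O = Prod.fst '' {x : Spacetime P × O |
      |(x.1.2 : ℝ) - (x.2 : Spacetime P).2| ≤ x.1.1 - (x.2 : Spacetime P).1} := by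
    ext q
    constructor
    · rintro ⟨p, hp, hq⟩
      exact ⟨(q, ⟨p, hp⟩), hq, rfl⟩
    · rintro ⟨⟨q, p⟩, hq, rfl⟩
      exact ⟨p, p.2, hq⟩
  rw [h2]
  exact isClosedMap_fst_of_compactSpace _ h1

theorem exists_cone_distance {O : Set (Spacetime P)} (hO : IsCompact O) {p : Spacetime P}
    (hp : p ∉ Jplus O) : ∃ δ > 0, ∀ q ∈ O, δ ≤ |(q.2 : ℝ) - p.2| - (p.1 - q.1) := by
  obtain ⟨δ, hδ, h⟩ := hO.exists_forall_le' (f := fun q : Spacetime P =>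
    |(q.2 : ℝ) - p.2| - (p.1 - q.1)) (a := 0) (by fun_prop) (fun q hq => by
      by_contra! h
      refine hp ⟨q, hq, ?_⟩
      rw [abs_sub_comm]
      linarith)
  exact ⟨δ, hδ, h⟩

/-- The source term of the energy estimate is small when the source is away from the cone. -/
theorem re_inner_expWeight_le {s : ℝ} (hs : 0 ≤ s) {z₀ ε d : ℝ} (hε : 0 < ε) {f : ℝ → DA P} {t : ℝ}
    (h : ∀ z (hz : z ∈ Icc 0 P.ℓ), (t, (⟨z, hz⟩ : Icc (0 : ℝ) P.ℓ)) ∈ supp₁ f → d ≤ |z - z₀|) :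
    (inner ℂ (incl P (f t)) (mulOp (P := P) (contDiff_expWeight s z₀ hε).continuous.continuousOn
      (expWeight s z₀ ε P.ℓ) (incl P (f t)))).re
      ≤ Real.exp (-(2 * s) * d) * ‖incl P (f t)‖ ^ 2 := by
  have h1 : Real.exp (-(2 * s) * d) * ‖incl P (f t)‖ ^ 2 = (inner ℂ (incl P (f t))
      (mulOp (P := P) (w := fun _ => Real.exp (-(2 * s) * d)) continuousOn_const
        (Real.exp (-(2 * s) * d)) (incl P (f t)))).re := by
    rw [re_inner_mulOp_self, norm_sq_H, integral_const_mul]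
    ring
  rw [h1]
  have key : ∀ z (hz : z ∈ Icc 0 P.ℓ), (t, (⟨z, hz⟩ : Icc (0 : ℝ) P.ℓ)) ∈ supp₁ f →
      expWeight s z₀ ε z ≤ Real.exp (-(2 * s) * d) :=
    fun z hz hm => expWeight_le hs z₀ ε (h z hz hm)
  refine re_inner_mulOp_mono _ _ _ ?_ ?_
  · filter_upwards [comp₁_incl (f t), ae_restrict_mem (μ := volume) measurableSet_Ioo] with z e hz
    have hz' := Ioo_subset_Icc_self hz
    by_cases hm : (t, (⟨z, hz'⟩ : Icc (0 : ℝ) P.ℓ)) ∈ supp₁ f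
    · exact mul_le_mul_of_nonneg_right (key z hz' hm) (sq_nonneg _)
    · rw [e, supp₁_bulk_eq_zero hz' hm]
      simp
  · by_cases hm : (t, (⟨P.ℓ, mem_end⟩ : Icc (0 : ℝ) P.ℓ)) ∈ supp₁ f
    · exact mul_le_mul_of_nonneg_right (key _ mem_end hm) (sq_nonneg _)
    -- The boundary component involves the derivative at `ℓ` too; it vanishes because the support is
    -- closed, so `f₁` is zero in a neighbourhood.
    · rw [comp₂_incl, supp₁_bulk_eq_zero mem_end hm, supp₁_bulk'_eq_zero mem_end hm]
      simp

/-- Grönwall estimate for a quantity that starts from zero. -/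
theorem le_of_deriv_le_mul_add {e e' : ℝ → ℝ} {c M T t₀ : ℝ} (hT : T ≤ t₀)
    (he : ∀ t, HasDerivAt e (e' t) t) (hT0 : e T = 0)
    (hle : ∀ t ∈ Icc T t₀, Real.exp (-c * t) * (e' t - c * e t) ≤ M) :
    e t₀ ≤ Real.exp (c * t₀) * (M * (t₀ - T)) := by
  have h1 : ∀ t, HasDerivAt (fun t => Real.exp (-c * t) * e t)
      (Real.exp (-c * t) * (e' t - c * e t)) t := fun t => by
    have h2 : HasDerivAt (fun t => Real.exp (-c * t)) _ t := ((hasDerivAt_id t).const_mul (-c)).exp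
    refine (h2.mul (he t)).congr_deriv ?_
    simp only [id]
    ring
  have h2 := (convex_Icc T t₀).image_sub_le_mul_sub_of_deriv_le
    (f := fun t => Real.exp (-c * t) * e t) (C := M)
    (fun t _ => (h1 t).continuousAt.continuousWithinAt)
    (fun t _ => (h1 t).differentiableAt.differentiableWithinAt)
    (fun t ht => by
      rw [(h1 t).deriv]
      exact hle t (interior_subset ht)) T (left_mem_Icc.2 hT) t₀ (right_mem_Icc.2 hT) hT
  simp only [hT0, mul_zero, sub_zero] at h2
  calc e t₀ = Real.exp (c * t₀) * (Real.exp (-c * t₀) * e t₀) := by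
        rw [← mul_assoc, ← Real.exp_add]
        simp
    _ ≤ _ := mul_le_mul_of_nonneg_left h2 (Real.exp_pos _).le

/-- The source at time `t` is weighted by at most `exp(-2s(δ + t₀ - t))`, while the energy grows by
`exp((2s + 2)(t₀ - t))`. The `s`-dependent parts cancel except for `exp(-2sδ)`. -/
theorem re_inner_expWeight_solution_le (hP : P.PositivityConditions) {f g : ℝ → DA P}
    (hg : ContDiff ℝ 2 g) (hQ : ∀ t, QA g t = incl P (f t)) {T t₀ z₀ δ ε B s : ℝ} (hs : 0 ≤ s)
    (hε : 0 < ε) (hT : T ≤ t₀) (hgT : ∀ t ≤ T, g t = 0) (hB : ∀ t, ‖incl P (f t)‖ ^ 2 ≤ B)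
    (hδ : ∀ t z (hz : z ∈ Icc 0 P.ℓ), (t, (⟨z, hz⟩ : Icc (0 : ℝ) P.ℓ)) ∈ supp₁ f →
      δ + (t₀ - t) ≤ |z - z₀|) :
    (inner ℂ (incl P (g t₀)) (mulOp (P := P) (contDiff_expWeight s z₀ hε).continuous.continuousOn
      (expWeight s z₀ ε P.ℓ) (incl P (g t₀)))).re
      ≤ Real.exp (-(2 * s) * δ) * (Real.exp (2 * (t₀ - T)) * (B * (t₀ - T))) := by
  have hw := contDiff_expWeight s z₀ hε
  have hpos : ∀ z ∈ Icc 0 P.ℓ, 0 ≤ expWeight s z₀ ε z := fun z _ => (Real.exp_pos _).le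
  refine (re_inner_le_localEnergy hP hw hpos (g t₀) (deriv g t₀)).trans ?_
  choose e' he' hle using localEnergy_deriv_le hP hw hpos (by positivity : 0 ≤ 2 * s)
    (fun z _ => abs_deriv_expWeight_le hs z₀ hε z) hg hQ
  -- Only the past of `T` is known to carry the zero field, so the derivative is identified from the
  -- left.
  have hdg : deriv g T = 0 := by
    have h1 : HasDerivWithinAt g (deriv g T) (Iic T) T :=
      (hg.differentiable two_ne_zero T).hasDerivAt.hasDerivWithinAt
    have h2 : HasDerivWithinAt g 0 (Iic T) T :=
      (hasDerivWithinAt_const T (Iic T) (0 : DA P)).congr hgT (hgT T le_rfl)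
    exact (uniqueDiffWithinAt_Iic T).eq_deriv _ h1 h2
  have hT0 : localEnergy hP hw (g T) (deriv g T) = 0 := by
    rw [hgT T le_rfl, hdg, localEnergy]
    simp
  have hB0 : 0 ≤ B := (sq_nonneg _).trans (hB 0)
  -- Multiplying the source bound by `exp(-(2s + 2) t)` leaves `exp(-2s(δ + t₀) - 2t)`, and `t ≥ T`
  -- gives `M`.
  have h1 := le_of_deriv_le_mul_add (c := 2 * s + 2)
    (M := Real.exp (-(2 * s) * (δ + t₀) - 2 * T) * B) hT he' hT0 (fun t ht => by
      have h2 := re_inner_expWeight_le hs hε (d := δ + (t₀ - t)) (fun z hz => hδ t z hz)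
      have h3 : e' t - (2 * s + 2) * localEnergy hP hw (g t) (deriv g t)
          ≤ Real.exp (-(2 * s) * (δ + (t₀ - t))) * B := by
        refine (sub_le_iff_le_add'.2 (hle t)).trans (h2.trans ?_)
        exact mul_le_mul_of_nonneg_left (hB t) (Real.exp_pos _).le
      refine (mul_le_mul_of_nonneg_left h3 (Real.exp_pos _).le).trans ?_
      rw [← mul_assoc, ← Real.exp_add]
      refine mul_le_mul_of_nonneg_right (Real.exp_le_exp.2 ?_) hB0
      linarith [ht.1])
  refine h1.trans_eq ?_
  have h4 : Real.exp ((2 * s + 2) * t₀) * Real.exp (-(2 * s) * (δ + t₀) - 2 * T)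
      = Real.exp (-(2 * s) * δ) * Real.exp (2 * (t₀ - T)) := by
    rw [← Real.exp_add, ← Real.exp_add]
    congr 1
    ring
  linear_combination B * (t₀ - T) * h4

/-- The weighted estimate holds for every `s ≥ 0` with a constant independent of `s`; sending `s` to
infinity annihilates the mass near `z₀`, and continuity gives the pointwise statement. -/
theorem bulk_eq_zero_of_notMem_Jplus (hP : P.PositivityConditions) {f g : ℝ → DA P}
    (hf : Continuous f) (hc : HasCompactSupport f) (hg : ContDiff ℝ 2 g)
    (hQ : ∀ t, QA g t = incl P (f t)) {T : ℝ} (hgT : ∀ t ≤ T, g t = 0) {p : Spacetime P}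
    (hp : p ∉ Jplus (supp₁ f)) : bulk (P := P) (g p.1) p.2 = 0 := by
  obtain ⟨t₀, z₀, hz₀⟩ := p
  simp only at hp ⊢
  rcases le_total t₀ T with hT | hT
  · rw [hgT t₀ hT]
    exact ((represents_bulk (P := P) (0 : domainA P)).unique (represents_zero P)).1 hz₀
  obtain ⟨δ, hδ, h⟩ := exists_cone_distance (isCompact_supp₁ hc) hp
  obtain ⟨B, hB⟩ := (hc.comp_left (g := incl P) (map_zero _)).exists_bound_of_continuous
    ((incl P).continuous.comp hf)
  have hB2 : ∀ t, ‖incl P (f t)‖ ^ 2 ≤ B ^ 2 := fun t => pow_le_pow_left₀ (norm_nonneg _) (hB t) 2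
  -- Within `ε` of `z₀` the weight is at least `exp(-4sε) = exp(-sδ)`, which spends only half of the
  -- decay `exp(-2sδ)`.
  set ε := δ / 4 with hε_def
  have hε : 0 < ε := by positivity
  -- Truncation to `[0, ℓ]` keeps the interval nondegenerate, so the argument also covers `z₀ = 0`
  -- and `z₀ = ℓ`.
  set a := max 0 (z₀ - ε)
  set b := min P.ℓ (z₀ + ε)
  have hab : a < b := by
    refine max_lt (lt_min P.ℓ_pos ?_) (lt_min ?_ ?_) <;> linarith [hz₀.1, hz₀.2]
  have hsub : Ioo a b ⊆ Ioo 0 P.ℓ := Ioo_subset_Ioo (le_max_left _ _) (min_le_left _ _)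
  set x := comp₁ (incl P (g t₀))
  have hxi : IntegrableOn (fun z => ‖x z‖ ^ 2) (Ioo 0 P.ℓ) :=
    (memLp_comp₁ (incl P (g t₀))).integrable_norm_pow (by norm_num)
  set C := Real.exp (2 * (t₀ - T)) * (B ^ 2 * (t₀ - T))
  have hbound : ∀ s, 0 ≤ s → ∫ z in Ioo a b, ‖x z‖ ^ 2 ≤ C * Real.exp (-(s * δ)) := by
    intro s hs
    have h1 := re_inner_expWeight_solution_le hP hg hQ (δ := δ) (z₀ := z₀) hs hε hT hgT hB2
      (fun t z hz hm => by
        have := h _ hm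
        simp only at this
        linarith)
    have hwi := integrable_mul_norm_sq (P := P)
      (contDiff_expWeight s z₀ hε).continuous.continuousOn (memLp_comp₁ (incl P (g t₀)))
    have h2 : Real.exp (-(2 * s) * (2 * ε)) * ∫ z in Ioo a b, ‖x z‖ ^ 2
        ≤ (inner ℂ (incl P (g t₀)) (mulOp (P := P)
          (contDiff_expWeight s z₀ hε).continuous.continuousOn
          (expWeight s z₀ ε P.ℓ) (incl P (g t₀)))).re := by
      rw [re_inner_mulOp_self, ← integral_const_mul]
      have h3 : 0 ≤ P.ρ⁻¹ * (expWeight s z₀ ε P.ℓ * ‖comp₂ (incl P (g t₀))‖ ^ 2) :=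
        mul_nonneg (inv_nonneg.2 P.ρ_pos.le) (mul_nonneg (Real.exp_pos _).le (sq_nonneg _))
      refine le_trans ?_ (le_add_of_nonneg_right h3)
      calc ∫ z in Ioo a b, Real.exp (-(2 * s) * (2 * ε)) * ‖x z‖ ^ 2
          ≤ ∫ z in Ioo a b, expWeight s z₀ ε z * ‖x z‖ ^ 2 := by
            refine setIntegral_mono_on ((hxi.mono_set hsub).const_mul _)
              (IntegrableOn.mono_set hwi hsub) measurableSet_Ioo fun z hz => ?_
            refine mul_le_mul_of_nonneg_right (le_expWeight hs hε ?_) (sq_nonneg _)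
            rw [abs_le]
            have h4 := (le_max_right 0 (z₀ - ε)).trans_lt hz.1
            have h5 := hz.2.trans_le (min_le_right P.ℓ (z₀ + ε))
            constructor <;> linarith
        _ ≤ ∫ z in Ioo 0 P.ℓ, expWeight s z₀ ε z * ‖x z‖ ^ 2 := by
            refine setIntegral_mono_set hwi (Filter.Eventually.of_forall fun z => ?_)
              hsub.eventuallyLE
            exact mul_nonneg (Real.exp_pos _).le (sq_nonneg _)
    have h3 := h2.trans h1
    have h4 : Real.exp (-(2 * s) * δ) = Real.exp (-(2 * s) * (2 * ε)) * Real.exp (-(s * δ)) := by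
      rw [← Real.exp_add, hε_def]
      congr 1
      ring
    rw [h4, mul_assoc] at h3
    have h5 := le_of_mul_le_mul_left h3 (Real.exp_pos _)
    rwa [mul_comm] at h5
  have hzero : ∫ z in Ioo a b, ‖x z‖ ^ 2 = 0 := by
    refine le_antisymm ?_ (integral_nonneg fun z => sq_nonneg _)
    have h1 : Filter.Tendsto (fun s : ℝ => C * Real.exp (-(s * δ))) Filter.atTop (nhds (C * 0)) :=
      (Real.tendsto_exp_neg_atTop_nhds_zero.comp
        (Filter.tendsto_id.atTop_mul_const hδ)).const_mul C
    rw [mul_zero] at h1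
    refine ge_of_tendsto h1 ?_
    filter_upwards [Filter.eventually_ge_atTop 0] with s hs using hbound s hs
  have hae : bulk (P := P) (g t₀) =ᵐ[volume.restrict (Icc a b)] fun _ => 0 := by
    rw [← Measure.restrict_congr_set Ioo_ae_eq_Icc]
    have h1 := (setIntegral_eq_zero_iff_of_nonneg_ae
      (Filter.Eventually.of_forall fun z => sq_nonneg ‖x z‖) (hxi.mono_set hsub)).1 hzero
    filter_upwards [h1, ae_restrict_of_ae_restrict_of_subset hsub (comp₁_incl (g t₀))]
      with z e1 e2
    rw [← e2]
    simpa using e1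
  have hcont : ContinuousOn (bulk (P := P) (g t₀)) (Icc a b) :=
    (continuousOn_bulk (P := P) (g t₀)).mono (Icc_subset_Icc (le_max_left _ _) (min_le_left _ _))
  refine Measure.eqOn_Icc_of_ae_eq volume hab.ne hae hcont continuousOn_const ⟨?_, ?_⟩
  · exact max_le hz₀.1 (by linarith)
  · exact le_min hz₀.2 (by linarith)

theorem supp₁_subset_Jplus (hP : P.PositivityConditions) {f g : ℝ → DA P}
    (hf : Continuous f) (hc : HasCompactSupport f) (hg : ContDiff ℝ 2 g)
    (hQ : ∀ t, QA g t = incl P (f t)) {T : ℝ} (hgT : ∀ t ≤ T, g t = 0) :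
    supp₁ g ⊆ Jplus (supp₁ f) := by
  refine closure_minimal (fun p hp => ?_) (isClosed_Jplus (isCompact_supp₁ hc))
  by_contra h
  exact hp (bulk_eq_zero_of_notMem_Jplus hP hf hc hg hQ hgT h)

theorem mem_supp₁_comp_neg {f : ℝ → DA P} {t : ℝ} {z : Icc (0 : ℝ) P.ℓ} (h : (t, z) ∈ supp₁ f) :
    (-t, z) ∈ supp₁ (fun s => f (-s)) := by
  have hcont : Continuous fun p : Spacetime P => ((-p.1, p.2) : Spacetime P) := by fun_prop
  refine map_mem_closure (f := fun p : Spacetime P => ((-p.1, p.2) : Spacetime P)) hcont h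
    fun p hp => ?_
  change bulk (P := P) (f (- -p.1)) p.2 ≠ 0
  rw [neg_neg]
  exact hp

theorem QA_comp_neg (g : ℝ → DA P) (t : ℝ) : QA (fun s => g (-s)) t = QA g (-t) := by
  have h := iteratedDeriv_comp_neg 2 (fun s => incl P (g s)) t
  rw [QA, QA, h]
  simp

/-- Time reversal preserves `Q_A` and exchanges past and future. -/
theorem supp₁_subset_Jminus (hP : P.PositivityConditions) {f g : ℝ → DA P}
    (hf : Continuous f) (hc : HasCompactSupport f) (hg : ContDiff ℝ 2 g)
    (hQ : ∀ t, QA g t = incl P (f t)) {T : ℝ} (hgT : ∀ t, T ≤ t → g t = 0) :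
    supp₁ g ⊆ Jminus (supp₁ f) := by
  rintro ⟨t, z⟩ hp
  obtain ⟨⟨t', z'⟩, h1, h2⟩ := supp₁_subset_Jplus hP (f := fun s => f (-s)) (g := fun s => g (-s))
    (T := -T) (hf.comp continuous_neg) (hc.comp_homeomorph (Homeomorph.neg ℝ))
    (hg.comp contDiff_neg) (fun s => by rw [QA_comp_neg, hQ])
    (fun s hs => hgT _ (by linarith)) (mem_supp₁_comp_neg hp)
  have h3 := mem_supp₁_comp_neg h1
  simp only [neg_neg] at h3
  refine ⟨(-t', z'), h3, ?_⟩
  simp only at h2 ⊢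
  linarith

/-! ### Vanishing before or after the source, and conclusion -/

theorem eq_zero_of_opAdv {f g : ℝ → DA P}
    (hgf : ∀ t, incl P (g t) = opAdv P (fun s => incl P (f s)) t) {T : ℝ}
    (hfT : ∀ t ≤ T, f t = 0) (t : ℝ) (ht : t ≤ T) : g t = 0 := by
  apply incl_injective
  rw [hgf, opAdv, setIntegral_eq_zero_of_forall_eq_zero, neg_zero, map_zero]
  intro s hs
  rw [hfT s (le_trans (le_of_lt hs) ht), map_zero, map_zero]

theorem eq_zero_of_opRet {f g : ℝ → DA P}
    (hgf : ∀ t, incl P (g t) = opRet P (fun s => incl P (f s)) t) {T : ℝ}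
    (hfT : ∀ t, T ≤ t → f t = 0) (t : ℝ) (ht : T ≤ t) : g t = 0 := by
  apply incl_injective
  rw [hgf, opRet, setIntegral_eq_zero_of_forall_eq_zero, map_zero]
  intro s hs
  rw [hfT s (ht.trans (le_of_lt hs)), map_zero, map_zero]

theorem exists_forall_le_eq_zero {f : ℝ → DA P} (hc : HasCompactSupport f) :
    ∃ T, ∀ t ≤ T, f t = 0 := by
  obtain ⟨T, hT⟩ := hc.isCompact.bddBelow
  -- The bound `T` may itself belong to the support, so the threshold is moved strictly below it.
  refine ⟨T - 1, fun t ht => image_eq_zero_of_notMem_tsupport fun h => ?_⟩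
  linarith [hT h]

theorem exists_forall_ge_eq_zero {f : ℝ → DA P} (hc : HasCompactSupport f) :
    ∃ T, ∀ t, T ≤ t → f t = 0 := by
  obtain ⟨T, hT⟩ := hc.isCompact.bddAbove
  refine ⟨T + 1, fun t ht => image_eq_zero_of_notMem_tsupport fun h => ?_⟩
  linarith [hT h]

theorem isAdvancedGreen_opAdv (hP : P.PositivityConditions) : IsAdvancedGreen (opAdv P) := by
  have hk := isGreenKernel_advanced (resolvent_isSelfAdjoint hP) (resolvent_spectrum hP)
  refine ⟨⟨kernelE P, isConv_opAdv.isIntegralOperator hP hk⟩,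
    fun f g hf hc hg hgf t => isConv_opAdv.right_inv hP hk hf hc hg hgf t,
    fun f hf hc t => isConv_opAdv.left_inv hP hk hf hc t, fun f g hf hc hg hgf => ?_⟩
  obtain ⟨T, hT⟩ := exists_forall_le_eq_zero hc
  exact supp₁_subset_Jplus hP hf.continuous hc hg
    (isConv_opAdv.right_inv hP hk hf hc hg hgf) (eq_zero_of_opAdv hgf hT)

theorem isRetardedGreen_opRet (hP : P.PositivityConditions) : IsRetardedGreen (opRet P) := by
  have hk := isGreenKernel_retarded (resolvent_isSelfAdjoint hP) (resolvent_spectrum hP)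
  refine ⟨⟨kernelE P, isConv_opRet.isIntegralOperator hP hk⟩,
    fun f g hf hc hg hgf t => isConv_opRet.right_inv hP hk hf hc hg hgf t,
    fun f hf hc t => isConv_opRet.left_inv hP hk hf hc t, fun f g hf hc hg hgf => ?_⟩
  obtain ⟨T, hT⟩ := exists_forall_ge_eq_zero hc
  exact supp₁_subset_Jminus hP hf.continuous hc hg
    (isConv_opRet.right_inv hP hk hf hc hg hgf) (eq_zero_of_opRet hgf hT)

end Propagation

end DynBC

end

theorem mainTheorem2 (P : DynBC.System) (hP : P.PositivityConditions) (hβ₂ : P.β₂ ≠ 0) :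
    DynBC.IsRetardedGreen (DynBC.opRet P) ∧ DynBC.IsAdvancedGreen (DynBC.opAdv P) :=
  ⟨DynBC.isRetardedGreen_opRet hP, DynBC.isAdvancedGreen_opAdv hP⟩
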